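/- Let $p$ be a prime and $k$ a field of characteristic $p$. Let $\Lambda_\infty$ be the category with objects $[n]$, $n\ge 1$, whose morphisms $[n]\to[m]$ are the order-preserving maps $f:\mathbb Z\to\mathbb Z$ with $f(a+n)=f(a)+m$, and let $\sigma$ act on them by $f\mapsto f+m$. For $q\ge 1$ let $\Lambda_q$ be the category with the same objects and $\Lambda_q([n],[m])=\Lambda_\infty([n],[m])/\sigma^q$; thus $\Lambda=\Lambda_1$ is Connes' cyclic category. Let $\pi:\Lambda_p\to\Lambda$ be the projection (the identity on objects) and let $j_q:\Delta^{o}\to\Lambda_q$ be the embedding whose image consists of the classes of the maps $f$ with $f(0)=0$. For a small category $\Gamma$ let $\operatorname{Fun}(\Gamma,k)$ be the category of functors from $\Gamma$ to $k$-vector spaces, let $H_\bullet(\Gamma,-)$ be the derived functors of $\operatorname{colim}:\operatorname{Fun}(\Gamma,k)\to k\text{-Vect}$, and let $H^\bullet(\Gamma,k)=\operatorname{Ext}^\bullet_{\operatorname{Fun}(\Gamma,k)}(k,k)$; a class $x\in H^m(\Gamma,k)$ acts on $H_\bullet(\Gamma,E)$ through $E\otimes x\in\operatorname{Ext}^m(E,E)$,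 lowering the degree by $m$. For $E\in\operatorname{Fun}(\Lambda_q,k)$ put $HC_\bullet(E)=H_\bullet(\Lambda_q,E)$ and $HH_\bullet(E)=H_\bullet(\Delta^{o},j_q^*E)$. Let $u\in H^2(\Lambda_q,k)$ be the periodicity class, that is, the Yoneda class of the exact sequence $0\to k\to C_1\to C_0\to k\to 0$ whose value at $[n]$ is the augmented cellular chain complex of the circle with $qn$ marked points $\mathbb Z/qn$, extended on the left by the inclusion of the fundamental cycle. It gives the periodicity map $u:HC_\bullet(E)\to HC_{\bullet-2}(E)$, and $HP_\bullet(E)$ is the derived inverse limit of the cyclic homology complexes along $u$, i.e. the homology of the homotopy fibre of $\mathrm{id}-tu$ on $\prod_{i\ge 0}HC(E)[-2i]$, where $HC(E)$ denotes the complex computing $HC_\bullet(E)$ and $t$ shifts the factors. Then for every cyclic vector space $E\in\operatorname{Fun}(\Lambda,k)$ there are isomorphisms of graded $k$-vector spaces $$HC_\bullet(\pi^*E)\cong HH_\bullet(E)[u^{-1}],\qquad HP_\bullet(\pi^*E)\cong HH_\bullet(E)((u)),$$ that is, $HC_n(\pi^*E)\cong\bigoplus_{l\ge 0}HH_{n-2l}(E)$,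 and $HP_n(\pi^*E)$ is isomorphic to the space of formal Laurent series $\sum_l a_lu^l$ with $a_l\in HH_{n+2l}(E)$ and $a_l=0$ for $l\ll 0$. They can be chosen such that the periodicity map on $HC_\bullet(\pi^*E)$ corresponds to multiplication by $u$ on $HH_\bullet(E)[u^{-1}]$ (with $u\cdot u^{0}=0$), and such that, for every $m\ge 0$, the projection $HP_n(\pi^*E)\to HC_{n+2m}(\pi^*E)$ corresponds to multiplication by $u^{-m}$ followed by dropping the positive powers of $u$. Moreover, the restriction map $\pi^*:H^2(\Lambda,k)\to H^2(\Lambda_p,k)$ is zero. -/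

import Mathlib

open CategoryTheory Limits MonoidalCategory Abelian
universe u
noncomputable section
namespace CyclicHomology

/-! ### Homology and cohomology of small categories -/

section Homology
variable {Γ : Type} [SmallCategory Γ] {k : Type u} [Field k]

/-- `Fun(Γ, k)`: functors from a small category `Γ` to `k`-vector spaces. -/
abbrev FunCat (Γ : Type) [SmallCategory Γ] (k : Type u) [Field k] := Γ ⥤ ModuleCat.{u} k

/-- `Fun(Γ, k)` has enough projectives: sums of left Kan extensions from the objects of `Γ`. -/
instance : EnoughProjectives (FunCat Γ k) where
  presentation E := by
    let L (a : Γ) := (evaluationLeftAdjoint (ModuleCat.{u} k) a).obj (Projective.over (E.obj a))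
    have hL (a : Γ) : Projective (L a) :=
      (evaluationAdjunctionRight (ModuleCat.{u} k) a).map_projective _ inferInstance
    let φ (a : Γ) : L a ⟶ E :=
      ((evaluationAdjunctionRight (ModuleCat.{u} k) a).homEquiv _ _).symm
        (Projective.π (E.obj a))
    refine ⟨{ p := ∐ L, f := Sigma.desc φ, epi := ⟨?_⟩, projective := ⟨?_⟩ }⟩
    · intro X Y f e _
      exact ⟨Sigma.desc fun a => Projective.factorThru (Sigma.ι L a ≫ f) e, by
        apply Sigma.hom_ext
        intro a
        simp⟩
    intro Z g h w
    ext a : 2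
    rw [← cancel_epi (Projective.π (E.obj a))]
    have key : φ a ≫ g = φ a ≫ h := by
      simpa using congrArg (fun t => Sigma.ι L a ≫ t) w
    have := congrArg ((evaluationAdjunctionRight (ModuleCat.{u} k) a).homEquiv _ _) key
    simpa [φ, Adjunction.homEquiv_naturality_right] using this

instance : HasExt.{u} (FunCat Γ k) := hasExt_of_enoughProjectives _

variable (Γ k) in
/-- The constant functor `k ∈ Fun(Γ, k)`. -/
def constFun : FunCat Γ k := (Functor.const Γ).obj (ModuleCat.of k k)

/-- The derived functor `L τ_! E` of the colimit functor `τ_! = colim : Fun(Γ, k) ⥤ k-Vect`, as a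
complex: apply `colim` to a projective resolution of `E`. The grading is cohomological, so the term
of homological degree `n` sits in degree `-n`. -/
def chains (E : FunCat Γ k) : CochainComplex (ModuleCat.{u} k) ℤ :=
  (colim.mapHomologicalComplex (ComplexShape.up ℤ)).obj (projectiveResolution E).cochainComplex

/-- The homology `H_n(Γ, E)` of the small category `Γ` with coefficients in `E`. -/
def homologyOf (E : FunCat Γ k) (n : ℤ) : ModuleCat.{u} k := (chains E).homology (-n)

variable (Γ k) in
/-- The cohomology `H^n(Γ, k) = Ext^n(k, k)`, the `Ext` being taken in `Fun(Γ, k)`. -/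
abbrev Coh (n : ℕ) := Ext (constFun Γ k) (constFun Γ k) n

instance (E : FunCat Γ k) : (tensorLeft E).Additive where
  map_add {X Y f g} := by
    ext a : 2
    exact MonoidalPreadditive.whiskerLeft_add ..

instance (E : FunCat Γ k) : PreservesFiniteColimits (tensorLeft E) :=
  preservesFiniteColimits_of_evaluation _ fun a =>
    inferInstanceAs (PreservesFiniteColimits
      ((evaluation Γ (ModuleCat.{u} k)).obj a ⋙ tensorLeft (E.obj a)))
instance (E : FunCat Γ k) : PreservesFiniteLimits (tensorLeft E) :=
  preservesFiniteLimits_of_evaluation _ fun a =>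
    inferInstanceAs (PreservesFiniteLimits
      ((evaluation Γ (ModuleCat.{u} k)).obj a ⋙ tensorLeft (E.obj a)))

theorem exact_of_pointwise (S : ShortComplex (FunCat Γ k))
    (h : ∀ a, (S.map ((evaluation Γ (ModuleCat.{u} k)).obj a)).Exact) : S.Exact := by
  rw [ShortComplex.exact_iff_isZero_homology, Functor.isZero_iff]
  intro a
  have := h a
  rw [ShortComplex.exact_iff_isZero_homology] at this
  exact this.of_iso (S.mapHomologyIso ((evaluation Γ (ModuleCat.{u} k)).obj a)).symm


/-- The isomorphism `E ⊗ k ≅ E` for the pointwise tensor product on `Fun(Γ, k)`. -/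
def unitorIso (E : FunCat Γ k) : (tensorLeft E).obj (constFun Γ k) ≅ E := ρ_ E

/-- The class `E ⊗ x ∈ Ext^m(E, E)` for `x ∈ H^m(Γ, k) = Ext^m(k, k)`. -/
def tensorClass (E : FunCat Γ k) {m : ℕ} (x : Coh Γ k m) : Ext E E m :=
  (Ext.mk₀ (unitorIso E).inv).comp
    ((x.mapExactFunctor (tensorLeft E)).comp (Ext.mk₀ (unitorIso E).hom) (add_zero m)) (zero_add m)

open CochainComplex Localization in
/-- `Ext^m(E, E')` as homotopy classes of degree `m` maps between projective resolutions. -/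
def extEquiv (E E' : FunCat Γ k) (m : ℕ) : Ext E E' m ≃
    HomComplex.CohomologyClass (projectiveResolution E).cochainComplex
      (projectiveResolution E').cochainComplex m :=
  ((SmallShiftedHom.precompEquiv.{u} (projectiveResolution E).π'
    (by rw [HomologicalComplex.mem_quasiIso_iff]; infer_instance)).trans
   (SmallShiftedHom.postcompEquiv.{u} (projectiveResolution E').π'
    (by rw [HomologicalComplex.mem_quasiIso_iff]; infer_instance)).symm).trans
      HomComplex.CohomologyClass.equivOfIsKProjective.{u}.symm

/-- A chain map between the projective resolutions that represents an `Ext`-class; it is unique up to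
homotopy. -/
def extRep {E E' : FunCat Γ k} {m : ℕ} (x : Ext E E' m) :
    (projectiveResolution E).cochainComplex ⟶ (projectiveResolution E').cochainComplex⟦(m : ℤ)⟧ :=
  CochainComplex.HomComplex.Cocycle.equivHomShift.symm (extEquiv E E' m x).mk_surjective.choose

/-- The map `L τ_! E ⟶ L τ_! E'[m]` induced by a class in `Ext^m(E, E')`. -/
def chainsMap {E E' : FunCat Γ k} {m : ℕ} (x : Ext E E' m) : chains E ⟶ (chains E')⟦(m : ℤ)⟧ :=
  (colim.mapHomologicalComplex (ComplexShape.up ℤ)).map (extRep x) ≫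
    ((colim.mapHomologicalComplex (ComplexShape.up ℤ)).commShiftIso (m : ℤ)).hom.app _

/-- The action of `x ∈ H^m(Γ, k)` on `L τ_! E`. -/
def capMap (E : FunCat Γ k) {m : ℕ} (x : Coh Γ k m) : chains E ⟶ (chains E)⟦(m : ℤ)⟧ :=
  chainsMap (tensorClass E x)

/-- The action `H_n(Γ, E) ⟶ H_{n-m}(Γ, E)` of `x ∈ H^m(Γ, k)`. -/
def cap (E : FunCat Γ k) {m : ℕ} (x : Coh Γ k m) (n : ℤ) :
   homologyOf E n ⟶ homologyOf E (n - m) :=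
  HomologicalComplex.homologyMap (capMap E x) (-n) ≫
    (CochainComplex.ShiftSequence.shiftIso (ModuleCat.{u} k) (m : ℤ) (-n) (-(n - m)) (by ring)).hom.app _

variable {Γ₂ : Type} [SmallCategory Γ₂]
/-- The restriction functor `F^* : Fun(Γ, k) ⥤ Fun(Γ₂, k)` along `F : Γ₂ ⥤ Γ`. -/
abbrev pull (F : Γ₂ ⥤ Γ) : FunCat Γ k ⥤ FunCat Γ₂ k := (Functor.whiskeringLeft _ _ _).obj F
instance (F : Γ₂ ⥤ Γ) : (pull (k := k) F).Additive := ⟨by cat_disch⟩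
instance (F : Γ₂ ⥤ Γ) : PreservesFiniteLimits (pull (k := k) F) := ⟨fun _ ↦ inferInstance⟩
instance (F : Γ₂ ⥤ Γ) : PreservesFiniteColimits (pull (k := k) F) := ⟨fun _ ↦ inferInstance⟩

variable (k) in
/-- The restriction map `F^* : H^n(Γ, k) → H^n(Γ₂, k)`. -/
def cohPull (F : Γ₂ ⥤ Γ) (n : ℕ) : Coh Γ k n →+ Coh Γ₂ k n :=
  (pull F).mapExtAddHom (constFun Γ k) (constFun Γ k) n
end Homology
/-! ### Derived inverse limits -/

section Telescope
variable {k : Type u} [Field k]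
/-- The inverse system `⋯ ⟶ K[-4] ⟶ K[-2] ⟶ K` of a degree `2` endomorphism `U : K ⟶ K[2]`. -/
def towerMap {K : CochainComplex (ModuleCat.{u} k) ℤ} (U : K ⟶ K⟦(2 : ℤ)⟧) (i : ℕ) :
    K⟦(-2 * ((i + 1 : ℕ) : ℤ))⟧ ⟶ K⟦(-2 * (i : ℤ))⟧ :=
  U⟦(-2 * ((i + 1 : ℕ) : ℤ))⟧' ≫
    (shiftFunctorAdd' (CochainComplex (ModuleCat.{u} k) ℤ) 2 (-2 * ((i + 1 : ℕ) : ℤ)) (-2 * (i : ℤ))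
      (by push_cast; ring)).inv.app K

/-- The product `K[[t]] = ∏_{i ≥ 0} K[-2i]`. -/
def towerProd (K : CochainComplex (ModuleCat.{u} k) ℤ) :
    CochainComplex (ModuleCat.{u} k) ℤ := ∏ᶜ fun i : ℕ => K⟦(-2 * (i : ℤ))⟧

/-- The map `id - tU` on `K[[t]]`. -/
def idSubShift {K : CochainComplex (ModuleCat.{u} k) ℤ} (U : K ⟶ K⟦(2 : ℤ)⟧) :
    towerProd K ⟶ towerProd K :=
  𝟙 _ - Pi.lift fun i => Pi.π _ (i + 1) ≫ towerMap U i

/-- The derived inverse limit of the system `⋯ ⟶ K[-4] ⟶ K[-2] ⟶ K`: the cone of `id - tU`, shifted so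
that it is the homotopy fibre. -/
def telescope {K : CochainComplex (ModuleCat.{u} k) ℤ} (U : K ⟶ K⟦(2 : ℤ)⟧) :
    CochainComplex (ModuleCat.{u} k) ℤ := (CochainComplex.mappingCone (idSubShift U))⟦(-1 : ℤ)⟧

/-- The projection of the derived inverse limit to the `i`-th term `K[-2i]` of the system. -/
def telescopeProj {K : CochainComplex (ModuleCat.{u} k) ℤ} (U : K ⟶ K⟦(2 : ℤ)⟧) (i : ℕ) :
    telescope U ⟶ K⟦(-2 * (i : ℤ))⟧ :=
  (CochainComplex.mappingCone.triangle (idSubShift U)).mor₃⟦(-1 : ℤ)⟧' ≫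
   (shiftShiftNeg (towerProd K) (1 : ℤ)).hom ≫ Pi.π _ i
end Telescope

/-- Morphisms `[n] ⟶ [m]` of `Λ_∞`: order-preserving maps `f : ℤ → ℤ` that commute with the
endomorphisms `σ`, which are `a ↦ a + n` on `[n]` and `a ↦ a + m` on `[m]`. -/
@[ext]
structure LiftHom (n m : ℕ+) where
  toFun : ℤ → ℤ
  monotone' : Monotone toFun
  map_add' : ∀ a, toFun (a + n) = toFun a + m

namespace LiftHom
instance (n m : ℕ+) : CoeFun (LiftHom n m) (fun _ => ℤ → ℤ) := ⟨toFun⟩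

def id (n : ℕ+) : LiftHom n n := ⟨fun a => a, monotone_id, fun _ => rfl⟩

def comp {n m l : ℕ+} (f : LiftHom n m) (g : LiftHom m l) : LiftHom n l :=
  ⟨fun a => g (f a), g.monotone'.comp f.monotone', fun a => by
    rw [f.map_add', g.map_add']⟩

theorem map_add_mul {n m : ℕ+} (f : LiftHom n m) (a c : ℤ) :
    f (a + c * n) = f a + c * m := by
  induction c using Int.induction_on with
  | zero => simp
  | succ i ih =>
    rw [show a + ((i : ℤ) + 1) * n = (a + i * n) + n by ring, f.map_add', ih]; ring
  | pred i ih =>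
    have := f.map_add' (a + (-(i : ℤ) - 1) * n)
    rw [show a + (-(i : ℤ) - 1) * n + n = a + -(i : ℤ) * n by ring, ih] at this
    linarith

/-- Two maps `[n] ⟶ [m]` of `Λ_∞` are identified in `Λ_p` if they differ by a power of `σ ^ p`. -/
def setoid (p : ℕ) (n m : ℕ+) : Setoid (LiftHom n m) where
  r f g := ∃ c : ℤ, ∀ a, g a = f a + c * p * m
  iseqv :=
    { refl := fun f => ⟨0, by simp⟩
      symm := fun {f g} ⟨c, h⟩ => ⟨-c, fun a => by rw [h]; ring⟩
      trans := fun {f g i} ⟨c, h⟩ ⟨d, h'⟩ => ⟨c + d, fun a => by rw [h', h]; ring⟩ }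

end LiftHom

/-- Objects `[n]`, `n ≥ 1`, of the `p`-cyclic category `Λ_p`; `Lambda 1` is Connes' cyclic category `Λ`. -/
structure Lambda (p : ℕ) where
  card : ℕ+

namespace Lambda

/-- The `p`-cyclic category, with `Λ_p([n], [m]) = Λ_∞([n], [m]) / σ ^ p`. -/
instance category (p : ℕ) : SmallCategory (Lambda p) where
  Hom X Y := Quotient (LiftHom.setoid p X.card Y.card)
  id X := Quotient.mk _ (LiftHom.id X.card)
  comp {X Y Z} := Quotient.map₂ LiftHom.comp (by
    rintro f f' ⟨c, hc⟩ g g' ⟨d, hd⟩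
    refine ⟨c + d, fun a => ?_⟩
    have := g.map_add_mul (f a) (c * p)
    simp only [LiftHom.comp, hc, hd]
    rw [this]; ring)
  id_comp := by rintro X Y ⟨f⟩; rfl
  comp_id := by rintro X Y ⟨f⟩; rfl
  assoc := by rintro X Y Z W ⟨f⟩ ⟨g⟩ ⟨h⟩; rfl

variable {p : ℕ}
/-- The class in `Λ_p` of a map of `Λ_∞`. -/
def homMk {X Y : Lambda p} (f : LiftHom X.card Y.card) : X ⟶ Y :=
  Quotient.mk (LiftHom.setoid p X.card Y.card) f

variable (p) in
/-- The projection `π : Λ_p ⥤ Λ`. -/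
def proj : Lambda p ⥤ Lambda 1 where
  obj X := ⟨X.card⟩
  map {X Y} := Quotient.map' (s₁ := LiftHom.setoid p X.card Y.card)
    (s₂ := LiftHom.setoid 1 X.card Y.card) (fun f => f)
    (by rintro f g ⟨c, h⟩; exact ⟨c * p, fun a => by rw [h]; simp⟩)
  map_id _ := rfl
  map_comp := by rintro X Y Z ⟨f⟩ ⟨g⟩; rfl

/-- The number of elements of a finite nonempty linearly ordered set. -/
def simplexCard (S : SimplexCategory) : ℕ+ := ⟨S.len + 1, Nat.succ_pos _⟩

/-- The periodic extension `ℤ → ℤ` of an order-preserving map `{0, …, s-1} → {0, …, t-1}`: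
`q s + r ↦ q t + φ(r)` for `0 ≤ r < s`. -/
def periodicExt {S T : SimplexCategory} (φ : S ⟶ T) (b : ℤ) : ℤ :=
  b / (S.len + 1) * (T.len + 1) + (φ.toOrderHom (Fin.ofNat (S.len + 1) (b % (S.len + 1)).toNat) : ℕ)

theorem periodicExt_apply {S T : SimplexCategory} (φ : S ⟶ T) (q : ℤ) (r : Fin (S.len + 1)) :
    periodicExt φ (q * (S.len + 1) + r) = q * (T.len + 1) + (φ.toOrderHom r : ℕ) := by
  have hr : ((r : ℕ) : ℤ) < S.len + 1 := by exact_mod_cast r.2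
  have h1 : (q * ((S.len : ℤ) + 1) + (r : ℕ)) / (S.len + 1) = q := by
    rw [add_comm, Int.add_mul_ediv_right _ _ (by positivity), Int.ediv_eq_zero_of_lt (by positivity) hr,
      zero_add]
  have h2 : (q * ((S.len : ℤ) + 1) + (r : ℕ)) % (S.len + 1) = (r : ℕ) := by
    rw [add_comm, Int.add_mul_emod_self_right, Int.emod_eq_of_lt (by positivity) hr]
  have h3 : Fin.ofNat (S.len + 1) (r : ℕ) = r := by
    ext; simp [Fin.ofNat, Nat.mod_eq_of_lt r.2]
  rw [periodicExt, h1, h2, Int.toNat_natCast, h3]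

theorem exists_rep (S : SimplexCategory) (b : ℤ) :
    ∃ (q : ℤ) (r : Fin (S.len + 1)), b = q * (S.len + 1) + (r : ℕ) := by
  have hpos : (0 : ℤ) < S.len + 1 := by positivity
  refine ⟨b / (S.len + 1), ⟨(b % (S.len + 1)).toNat, ?_⟩, ?_⟩
  · have := Int.emod_lt_of_pos b hpos
    have := Int.emod_nonneg b hpos.ne'
    omega
  · have := Int.emod_nonneg b hpos.ne'
    have := Int.mul_ediv_add_emod b (S.len + 1)
    simp only [Int.toNat_of_nonneg ‹0 ≤ b % _›]
    linarith

theorem periodicExt_mono {S T : SimplexCategory} (φ : S ⟶ T) : Monotone (periodicExt φ) := by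
  intro b b' h
  obtain ⟨q, r, rfl⟩ := exists_rep S b
  obtain ⟨q', r', rfl⟩ := exists_rep S b'
  rw [periodicExt_apply, periodicExt_apply]
  have hr : ((r : ℕ) : ℤ) < S.len + 1 := by exact_mod_cast r.2
  have hr' : ((r' : ℕ) : ℤ) < S.len + 1 := by exact_mod_cast r'.2
  have hS : (0 : ℤ) < S.len + 1 := by positivity
  have hT : (0 : ℤ) < T.len + 1 := by positivity
  have hφ : ((φ.toOrderHom r : ℕ) : ℤ) < T.len + 1 := by exact_mod_cast (φ.toOrderHom r).2
  have hq : q ≤ q' := by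
    by_contra hlt
    push Not at hlt
    have : (q' + 1) * ((S.len : ℤ) + 1) ≤ q * (S.len + 1) :=
      mul_le_mul_of_nonneg_right (by omega) hS.le
    linarith [Int.natCast_nonneg (r : ℕ)]
  rcases hq.eq_or_lt with rfl | hlt
  · have hrr : r ≤ r' := by
      rw [Fin.le_def]; omega
    have : (φ.toOrderHom r : ℕ) ≤ φ.toOrderHom r' := φ.toOrderHom.monotone hrr
    have : ((φ.toOrderHom r : ℕ) : ℤ) ≤ (φ.toOrderHom r' : ℕ) := by exact_mod_cast this
    linarith
  · have : (q + 1) * ((T.len : ℤ) + 1) ≤ q' * (T.len + 1) :=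
      mul_le_mul_of_nonneg_right (by omega) hT.le
    linarith [Int.natCast_nonneg (φ.toOrderHom r' : ℕ)]

theorem periodicExt_add {S T : SimplexCategory} (φ : S ⟶ T) (b c : ℤ) :
    periodicExt φ (b + c * (S.len + 1)) = periodicExt φ b + c * (T.len + 1) := by
  obtain ⟨q, r, rfl⟩ := exists_rep S b
  rw [show q * ((S.len : ℤ) + 1) + (r : ℕ) + c * (S.len + 1) = (q + c) * (S.len + 1) + (r : ℕ) by ring,
    periodicExt_apply, periodicExt_apply]
  ring

theorem periodicExt_id (S : SimplexCategory) (b : ℤ) : periodicExt (𝟙 S) b = b := by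
  obtain ⟨q, r, rfl⟩ := exists_rep S b
  rw [periodicExt_apply]
  simp

theorem periodicExt_comp {S T R : SimplexCategory} (φ : S ⟶ T) (ψ : T ⟶ R) (b : ℤ) :
    periodicExt (φ ≫ ψ) b = periodicExt ψ (periodicExt φ b) := by
  obtain ⟨q, r, rfl⟩ := exists_rep S b
  rw [periodicExt_apply, periodicExt_apply, periodicExt_apply]
  simp

/-- The left adjoint `a ↦ min {b | a ≤ φ(b)}` of the periodic extension of `φ`. -/
def dualFun {S T : SimplexCategory} (φ : S ⟶ T) (a : ℤ) : ℤ := sInf {b : ℤ | a ≤ periodicExt φ b}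

theorem dualFun_gc {S T : SimplexCategory} (φ : S ⟶ T) :
    GaloisConnection (dualFun φ) (periodicExt φ) := by
  intro a b
  have hT : (0 : ℤ) < T.len + 1 := by positivity
  have hne : {b : ℤ | a ≤ periodicExt φ b}.Nonempty := by
    refine ⟨0 + |a| * (S.len + 1), ?_⟩
    rw [Set.mem_ofPred_eq, periodicExt_add]
    have h0 : 0 ≤ periodicExt φ 0 := by
      have := periodicExt_apply φ 0 0
      simp only [zero_mul, Fin.val_zero, Nat.cast_zero, zero_add] at this
      rw [this]; positivity
    nlinarith [le_abs_self a, abs_nonneg a]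
  have hbdd : BddBelow {b : ℤ | a ≤ periodicExt φ b} := by
    refine ⟨(-|a| - 1) * (S.len + 1), fun b hb => ?_⟩
    by_contra hlt
    push Not at hlt
    have h1 := periodicExt_mono φ hlt.le
    have h2 := periodicExt_add φ 0 (-|a| - 1)
    rw [zero_add] at h2
    have h0 : periodicExt φ 0 < T.len + 1 := by
      have := periodicExt_apply φ 0 0
      simp only [zero_mul, Fin.val_zero, Nat.cast_zero, zero_add] at this
      rw [this]; exact_mod_cast (φ.toOrderHom 0).2
    have hb' : a ≤ periodicExt φ b := hb
    have : periodicExt φ b ≤ -|a| * (T.len + 1) + (periodicExt φ 0 - (T.len + 1)) := by linarith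
    nlinarith [neg_abs_le a, abs_nonneg a]
  constructor
  · intro h
    exact le_trans (Int.csInf_mem hne hbdd) (periodicExt_mono φ h)
  · intro h
    exact csInf_le hbdd h

/-- The map of `Λ_∞` dual to a map `φ` of `Δ`. In this way maps `S ⟶ T` in `Δ` correspond to the maps
`[T] ⟶ [S]` in `Λ_∞` that send `0 ∈ ℤ` to `0 ∈ ℤ`. -/
def dualHom {S T : SimplexCategory} (φ : S ⟶ T) : LiftHom (simplexCard T) (simplexCard S) where
  toFun := dualFun φ
  monotone' := (dualFun_gc φ).monotone_l
  map_add' a := by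
    refine eq_of_forall_ge_iff fun b => ?_
    have h := periodicExt_add φ b (-1)
    have e : b - ((simplexCard S : ℕ+) : ℤ) = b + -1 * (S.len + 1) := by simp [simplexCard]; ring
    have e' : (((simplexCard T : ℕ+) : ℕ) : ℤ) = T.len + 1 := by simp [simplexCard]
    rw [dualFun_gc φ, ← le_sub_iff_add_le (a := dualFun φ a), dualFun_gc φ, e, h, e']
    constructor <;> intro <;> linarith

theorem dualHom_id (S : SimplexCategory) : dualHom (𝟙 S) = LiftHom.id (simplexCard S) := by
  ext a
  refine eq_of_forall_ge_iff fun b => ?_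
  change dualFun (𝟙 S) a ≤ b ↔ a ≤ b
  rw [dualFun_gc, periodicExt_id]

theorem dualHom_comp {S T R : SimplexCategory} (φ : S ⟶ T) (ψ : T ⟶ R) :
    dualHom (φ ≫ ψ) = (dualHom ψ).comp (dualHom φ) := by
  ext a
  refine eq_of_forall_ge_iff fun b => ?_
  change dualFun (φ ≫ ψ) a ≤ b ↔ dualFun φ (dualFun ψ a) ≤ b
  rw [dualFun_gc, dualFun_gc, dualFun_gc, periodicExt_comp]

variable (p) in
/-- The embedding `j_p : Δᵒᵖ ⥤ Λ_p`; a linearly ordered set with `n` elements goes to `[n]`. -/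
def j : SimplexCategoryᵒᵖ ⥤ Lambda p where
  obj S := ⟨simplexCard S.unop⟩
  map f := homMk (dualHom f.unop)
  map_id S := by
    change homMk (dualHom (𝟙 S.unop)) = _
    rw [dualHom_id]; rfl
  map_comp f g := by
    change homMk (dualHom (g.unop ≫ f.unop)) = _
    rw [dualHom_comp]; rfl

end Lambda
/-! ### The periodicity class -/

section Circle
variable (k : Type u) [Field k]

/-- On the circle `[n]` of `Λ_p`, with marked points `ℤ/N`, `N = p n`, and edges `x ⟶ x + 1`, the chain
`∑ e_y` of edges that make up the path from `a` to `b`, for integers `a ≤ b`. -/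
def path (N : ℕ) (a b : ℤ) : ZMod N →₀ k :=
  ∑ y ∈ Finset.Ico a b, Finsupp.single (y : ZMod N) 1

variable {k}

theorem path_add (N : ℕ) {a b c : ℤ} (h : a ≤ b) (h' : b ≤ c) :
    path k N a b + path k N b c = path k N a c := by
  rw [path, path, path, ← Finset.Ico_union_Ico_eq_Ico h h',
    Finset.sum_union (Finset.Ico_disjoint_Ico_consecutive a b c)]

theorem path_succ (N : ℕ) (a : ℤ) : path k N a (a + 1) = Finsupp.single (a : ZMod N) 1 := by
  have : Finset.Ico a (a + 1) = {a} := by ext; simp; omega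
  simp [path, this]

theorem path_shift (N : ℕ) (a b c : ℤ) :
    path k N (a + c * N) (b + c * N) = path k N a b := by
  rw [path, ← Finset.map_add_right_Ico, Finset.sum_map]
  simp [path]

theorem path_period (N : ℕ) (a : ℤ) : path k N a (a + N) = path k N 0 N := by
  have step : ∀ a : ℤ, path k N (a + 1) (a + 1 + N) = path k N a (a + N) := by
    intro a
    have h := path_shift (k := k) N a (a + 1) 1
    rcases Nat.eq_zero_or_pos N with rfl | hN
    · simp [path]
    · rw [← path_add N (a := a) (b := a + 1) (c := a + N) (by omega) (by omega),
        ← path_add N (a := a + 1) (b := a + N) (c := a + 1 + N) (by omega) (by omega), ← h]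
      rw [add_comm]; simp [add_right_comm]
  induction a using Int.induction_on with
  | zero => simp
  | succ i ih => rw [step, ih]
  | pred i ih => rw [← ih, ← step]; simp

/-- The action of a map of `Λ_∞` on marked points, `v_a ↦ v_{f(a)}`. -/
def pointMap (p : ℕ) {n m : ℕ+} (f : LiftHom n m) :
    (ZMod (p * n) →₀ k) →ₗ[k] (ZMod (p * m) →₀ k) :=
  Finsupp.linearCombination k fun x : ZMod (p * n) =>
    Finsupp.single ((f (x.cast : ℤ) : ℤ) : ZMod (p * m)) (1 : k)

/-- The action of a map of `Λ_∞` on edges: the edge from `a` to `a + 1` goes to the path from `f(a)` to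
`f(a + 1)`. -/
def edgeMap (p : ℕ) {n m : ℕ+} (f : LiftHom n m) :
    (ZMod (p * n) →₀ k) →ₗ[k] (ZMod (p * m) →₀ k) :=
  Finsupp.linearCombination k fun x : ZMod (p * n) =>
    path k (p * m) (f (x.cast : ℤ)) (f ((x.cast : ℤ) + 1))

theorem exists_cast_eq (N : ℕ) (a : ℤ) : ∃ c : ℤ, (((a : ZMod N).cast : ℤ)) = a + c * N := by
  have h : (((((a : ZMod N).cast : ℤ)) : ℤ) : ZMod N) = (a : ZMod N) := by simp
  rw [ZMod.intCast_eq_intCast_iff_dvd_sub] at h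
  obtain ⟨c, hc⟩ := h
  exact ⟨-c, by linarith⟩

theorem lift_add_mul (p : ℕ) {n m : ℕ+} (f : LiftHom n m) (a c : ℤ) :
    f (a + c * (p * n : ℕ)) = f a + c * (p * m : ℕ) := by
  have := f.map_add_mul a (c * p)
  push_cast
  rw [← mul_assoc, this, mul_assoc]

theorem pointMap_single (p : ℕ) {n m : ℕ+} (f : LiftHom n m) (a : ℤ) :
    pointMap (k := k) p f (Finsupp.single (a : ZMod (p * n)) 1) =
      Finsupp.single ((f a : ℤ) : ZMod (p * m)) 1 := by
  obtain ⟨c, hc⟩ := exists_cast_eq (p * n) a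
  rw [pointMap, Finsupp.linearCombination_single, one_smul, hc, lift_add_mul]
  congr 1
  rw [Int.cast_add, Int.cast_mul, Int.cast_natCast, ZMod.natCast_self, mul_zero, add_zero]

theorem edgeMap_single (p : ℕ) {n m : ℕ+} (f : LiftHom n m) (a : ℤ) :
    edgeMap (k := k) p f (Finsupp.single (a : ZMod (p * n)) 1) =
      path k (p * m) (f a) (f (a + 1)) := by
  obtain ⟨c, hc⟩ := exists_cast_eq (p * n) a
  rw [edgeMap, Finsupp.linearCombination_single, one_smul, hc, add_right_comm, lift_add_mul,
    lift_add_mul, path_shift]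

theorem edgeMap_path (p : ℕ) {n m : ℕ+} (f : LiftHom n m) {a b : ℤ} (h : a ≤ b) :
    edgeMap (k := k) p f (path k (p * n) a b) = path k (p * m) (f a) (f b) := by
  induction b, h using Int.leInduction with
  | base => simp [path]
  | succ b hb ih =>
    rw [← path_add _ hb (by omega), map_add, ih, path_succ, edgeMap_single,
      path_add _ (f.monotone' hb) (f.monotone' (by omega))]

theorem pointMap_congr (p : ℕ) {n m : ℕ+} (f g : LiftHom n m)
    (h : LiftHom.setoid p n m f g) : pointMap (k := k) p f = pointMap p g := by
  obtain ⟨c, hc⟩ := h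
  have hc' (a : ℤ) : g a = f a + c * (p * m : ℕ) := by rw [hc]; push_cast; ring
  unfold pointMap
  congr 1
  funext x
  rw [hc', Int.cast_add, Int.cast_mul, Int.cast_natCast, ZMod.natCast_self, mul_zero, add_zero]

theorem edgeMap_congr (p : ℕ) {n m : ℕ+} (f g : LiftHom n m)
    (h : LiftHom.setoid p n m f g) : edgeMap (k := k) p f = edgeMap p g := by
  obtain ⟨c, hc⟩ := h
  have hc' (a : ℤ) : g a = f a + c * (p * m : ℕ) := by rw [hc]; push_cast; ring
  unfold edgeMap
  congr 1
  funext x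
  rw [hc', hc', path_shift]

theorem finsupp_ext (N : ℕ) {M : Type*} [AddCommMonoid M] [Module k M]
    {f g : (ZMod N →₀ k) →ₗ[k] M}
    (h : ∀ a : ℤ, f (Finsupp.single (a : ZMod N) 1) = g (Finsupp.single (a : ZMod N) 1)) :
    f = g := by
  refine Finsupp.lhom_ext' fun x => LinearMap.ext_ring ?_
  obtain ⟨a, rfl⟩ := ZMod.intCast_surjective x
  simpa using h a

variable (k) (p : ℕ)

/-- The functor `j_{p!} k`: it sends `[n]` to the span of `Λ_p([1], [n]) = ℤ/pn`, the marked points. -/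
def pointFun : FunCat (Lambda p) k where
  obj X := ModuleCat.of k (ZMod (p * X.card) →₀ k)
  map {X Y} := Quotient.lift (s := LiftHom.setoid p X.card Y.card)
    (fun f => ModuleCat.ofHom (pointMap p f))
    (fun f g h => by rw [pointMap_congr p f g h])
  map_id X := by
    refine ModuleCat.hom_ext (finsupp_ext _ fun a => ?_)
    exact pointMap_single p (LiftHom.id X.card) a
  map_comp := by
    rintro X Y Z ⟨f⟩ ⟨g⟩
    refine ModuleCat.hom_ext (finsupp_ext _ fun a => ?_)
    change pointMap p (f.comp g) _ = pointMap p g (pointMap p f _)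
    rw [pointMap_single, pointMap_single, pointMap_single]; rfl

/-- The functor `j^o_{p*} k`: it sends `[n]` to the space of functions on `Λ_p([n], [1])`. The basis
element `e_x`, `x ∈ ℤ/pn`, is the delta function of the class of the map `[n] ⟶ [1]` of `Λ_∞` that
jumps from `0` to `1` between `x` and `x + 1`. -/
def edgeFun : FunCat (Lambda p) k where
  obj X := ModuleCat.of k (ZMod (p * X.card) →₀ k)
  map {X Y} := Quotient.lift (s := LiftHom.setoid p X.card Y.card)
    (fun f => ModuleCat.ofHom (edgeMap p f))
    (fun f g h => by rw [edgeMap_congr p f g h])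
  map_id X := by
    refine ModuleCat.hom_ext (finsupp_ext _ fun a => ?_)
    refine (edgeMap_single p (LiftHom.id X.card) a).trans ?_
    exact path_succ _ a
  map_comp := by
    rintro X Y Z ⟨f⟩ ⟨g⟩
    refine ModuleCat.hom_ext (finsupp_ext _ fun a => ?_)
    change edgeMap p (f.comp g) _ = edgeMap p g (edgeMap p f _)
    rw [edgeMap_single, edgeMap_single, edgeMap_path _ _ (f.monotone' (by omega))]; rfl

/-- The map `e_x ↦ v_{x+1} - v_x`, that is `σ - id`. -/
def bdry (N : ℕ) : (ZMod N →₀ k) →ₗ[k] (ZMod N →₀ k) :=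
  Finsupp.linearCombination k fun x : ZMod N =>
    Finsupp.single (x + 1) (1 : k) - Finsupp.single x 1

/-- The map `k → k[ℤ/N]` with value `∑_x e_x` at `1`. -/
def fund (N : ℕ) : k →ₗ[k] (ZMod N →₀ k) := LinearMap.toSpanSingleton k _ (path k N 0 N)

theorem fund_apply (N : ℕ) (c : k) : fund k N c = c • path k N 0 N := rfl

/-- The sum of coefficients `k[ℤ/N] → k`. -/
def augm (N : ℕ) : (ZMod N →₀ k) →ₗ[k] k := Finsupp.linearCombination k fun _ => (1 : k)

variable {k} in
theorem bdry_path (N : ℕ) {a b : ℤ} (h : a ≤ b) :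
    bdry k N (path k N a b) = Finsupp.single (b : ZMod N) 1 - Finsupp.single (a : ZMod N) 1 := by
  induction b, h using Int.leInduction with
  | base => simp [path]
  | succ b hb ih =>
    rw [← path_add _ hb (by omega), map_add, ih, path_succ, bdry, Finsupp.linearCombination_single]
    simp

/-- The connecting map `B : j^o_{p*} k ⟶ j_{p!} k`. -/
def boundaryMap : edgeFun k p ⟶ pointFun k p where
  app X := ModuleCat.ofHom (bdry k (p * X.card))
  naturality := by
    rintro X Y ⟨f⟩
    refine ModuleCat.hom_ext (finsupp_ext _ fun a => ?_)
    change bdry k _ (edgeMap p f _) = pointMap p f (bdry k _ _)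
    rw [edgeMap_single, bdry_path _ (f.monotone' (by omega)), ← path_succ (p * X.card) a,
      bdry_path _ (by omega), map_sub, pointMap_single, pointMap_single]

/-- The adjunction map `j_{p!} k ⟶ k`. -/
def augmentation : pointFun k p ⟶ constFun (Lambda p) k where
  app X := ModuleCat.ofHom (augm k (p * X.card))
  naturality := by
    rintro X Y ⟨f⟩
    refine ModuleCat.hom_ext (finsupp_ext _ fun a => ?_)
    change augm k _ (pointMap p f _) = augm k _ _
    rw [pointMap_single]; simp [augm]

/-- The adjunction map `k ⟶ j^o_{p*} k`. -/
def fundamentalCycle : constFun (Lambda p) k ⟶ edgeFun k p where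
  app X := ModuleCat.ofHom (fund k (p * X.card))
  naturality := by
    rintro X Y ⟨f⟩
    refine ModuleCat.hom_ext (LinearMap.ext_ring ?_)
    change fund k (p * Y.card) 1 = edgeMap p f (fund k (p * X.card) 1)
    have := lift_add_mul p f 0 1
    rw [one_mul, one_mul, zero_add] at this
    rw [fund_apply, fund_apply, one_smul, one_smul, edgeMap_path p f (by positivity), this,
      path_period]

variable {k}

theorem bdry_apply (N : ℕ) (φ : ZMod N →₀ k) (x : ZMod N) : bdry k N φ x = φ (x - 1) - φ x := by
  have : Finsupp.lapply x ∘ₗ bdry k N = Finsupp.lapply (x - 1) - Finsupp.lapply x := by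
    refine Finsupp.lhom_ext' fun y => LinearMap.ext_ring ?_
    simp [bdry, Finsupp.single_apply, eq_sub_iff_add_eq]
  exact LinearMap.congr_fun this φ

theorem path_period_apply (N : ℕ) [NeZero N] (x : ZMod N) : path k N 0 N x = 1 := by
  have hN : 0 < N := Nat.pos_of_ne_zero (NeZero.ne N)
  rw [path, Finsupp.finsetSum_apply, Finset.sum_eq_single (x.val : ℤ)]
  · simp
  · intro b hb hne
    rw [Finset.mem_Ico] at hb
    refine Finsupp.single_eq_of_ne fun h => hne ?_
    lift b to ℕ using hb.1
    rw [h, Int.cast_natCast, ZMod.val_natCast_of_lt (by omega)]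
  · intro h
    exact absurd (Finset.mem_Ico.2 ⟨by positivity, by exact_mod_cast x.val_lt⟩) h

theorem const_of_bdry_eq_zero (N : ℕ) (φ : ZMod N →₀ k) (h : bdry k N φ = 0) (x : ZMod N) :
    φ x = φ 0 := by
  have step (x : ZMod N) : φ (x - 1) = φ x := by
    have := bdry_apply N φ x
    rw [h, Finsupp.zero_apply] at this
    exact (sub_eq_zero.1 this.symm)
  obtain ⟨a, rfl⟩ := ZMod.intCast_surjective x
  induction a using Int.induction_on with
  | zero => simp
  | succ i ih => rw [← ih, ← step]; simp
  | pred i ih => rw [← ih, Int.cast_sub, Int.cast_one, step]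

theorem fund_injective (N : ℕ) [NeZero N] : Function.Injective (fund k N) := by
  intro a b h
  simpa [fund_apply, path_period_apply] using DFunLike.congr_fun h 0

theorem augm_single (N : ℕ) (x : ZMod N) (c : k) : augm k N (Finsupp.single x c) = c := by
  simp [augm]

theorem exact_fund_bdry (N : ℕ) [NeZero N] :
    Function.Exact (fund k N) (bdry k N) := by
  intro φ
  constructor
  · intro h
    refine ⟨φ 0, ?_⟩
    ext x
    rw [const_of_bdry_eq_zero N φ h x]
    simp [fund_apply, path_period_apply]
  · rintro ⟨c, rfl⟩
    rw [fund_apply, map_smul, bdry_path N (by positivity)]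
    simp

theorem exact_bdry_augm (N : ℕ) [NeZero N] : Function.Exact (bdry k N) (augm k N) := by
  have hz : augm k N ∘ₗ bdry k N = 0 := by
    refine Finsupp.lhom_ext' fun y => LinearMap.ext_ring ?_
    simp [bdry, augm]
  intro φ
  constructor
  · intro h
    have key (ψ : ZMod N →₀ k) :
        ψ - augm k N ψ • Finsupp.single 0 1 ∈ LinearMap.range (bdry k N) := by
      induction ψ using Finsupp.induction_linear with
      | zero => simp
      | add f g hf hg =>
        convert Submodule.add_mem _ hf hg using 1
        rw [map_add, add_smul]; abel
      | single x c =>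
        refine ⟨c • path k N 0 x.val, ?_⟩
        rw [map_smul, bdry_path N (by positivity)]
        simp [augm, smul_sub]
    simpa [h] using key φ
  · rintro ⟨ψ, rfl⟩
    exact LinearMap.congr_fun hz ψ

variable (k)

/-- The sequence `0 ⟶ Z ⟶ j_{p!} k ⟶ k ⟶ 0`. -/
def rightSeq : ShortComplex (FunCat (Lambda p) k) :=
  ShortComplex.mk (kernel.ι (augmentation k p)) (augmentation k p) (kernel.condition _)

instance : Epi (augmentation k p) := by
  have (X : Lambda p) : Epi ((augmentation k p).app X) := by
    rw [ModuleCat.epi_iff_surjective]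
    intro c
    exact ⟨Finsupp.single 0 c, augm_single (k := k) (p * X.card) 0 c⟩
  exact NatTrans.epi_of_epi_app _

theorem rightSeq_shortExact : (rightSeq k p).ShortExact where
  exact := ShortComplex.exact_of_f_is_kernel _ (kernelIsKernel _)
  mono_f := by dsimp [rightSeq]; infer_instance
  epi_g := by dsimp [rightSeq]; infer_instance

variable [NeZero p]

/-- The complex `k ⟶ j^o_{p*} k ⟶ j_{p!} k`. -/
def fundComplex : ShortComplex (FunCat (Lambda p) k) :=
  ShortComplex.mk (fundamentalCycle k p) (boundaryMap k p) (by
    ext X : 2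
    exact ModuleCat.hom_ext (LinearMap.ext fun x =>
      (exact_fund_bdry (k := k) (p * X.card)).apply_apply_eq_zero x))

/-- The complex `j^o_{p*} k ⟶ j_{p!} k ⟶ k`. -/
def augComplex : ShortComplex (FunCat (Lambda p) k) :=
  ShortComplex.mk (boundaryMap k p) (augmentation k p) (by
    ext X : 2
    exact ModuleCat.hom_ext (LinearMap.ext fun x =>
      (exact_bdry_augm (k := k) (p * X.card)).apply_apply_eq_zero x))

theorem fundComplex_exact : (fundComplex k p).Exact :=
  exact_of_pointwise _ fun X => (ShortComplex.ShortExact.moduleCat_exact_iff_function_exact _).2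
    (exact_fund_bdry (k := k) (p * X.card))

theorem augComplex_exact : (augComplex k p).Exact :=
  exact_of_pointwise _ fun X => (ShortComplex.ShortExact.moduleCat_exact_iff_function_exact _).2
    (exact_bdry_augm (k := k) (p * X.card))

instance : Mono (fundamentalCycle k p) := by
  have (X : Lambda p) : Mono ((fundamentalCycle k p).app X) := by
    rw [ModuleCat.mono_iff_injective]
    exact fund_injective (k := k) (p * X.card)
  exact NatTrans.mono_of_mono_app _

/-- The sequence `0 ⟶ k ⟶ j^o_{p*} k ⟶ Z ⟶ 0`, with `Z` the kernel of `j_{p!} k ⟶ k`. -/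
def leftSeq : ShortComplex (FunCat (Lambda p) k) :=
  ShortComplex.mk (fundamentalCycle k p)
    (kernel.lift (augmentation k p) (boundaryMap k p) (augComplex k p).zero)
    (by
      rw [← cancel_mono (kernel.ι (augmentation k p)), Category.assoc, zero_comp]
      exact (congrArg _ (kernel.lift_ι _ _ _)).trans (fundComplex k p).zero)

theorem leftSeq_shortExact : (leftSeq k p).ShortExact where
  exact := by
    let φ : leftSeq k p ⟶ fundComplex k p :=
      { τ₁ := 𝟙 _, τ₂ := 𝟙 _, τ₃ := kernel.ι (augmentation k p)
        comm₁₂ := by simp [leftSeq, fundComplex]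
        comm₂₃ := (Category.id_comp _).trans (kernel.lift_ι _ _ (augComplex k p).zero).symm }
    have : Epi φ.τ₁ := inferInstanceAs (Epi (𝟙 _))
    have : IsIso φ.τ₂ := inferInstanceAs (IsIso (𝟙 _))
    have : Mono φ.τ₃ := inferInstanceAs (Mono (kernel.ι (augmentation k p)))
    exact (ShortComplex.exact_iff_of_epi_of_isIso_of_mono φ).2 (fundComplex_exact k p)
  mono_f := by dsimp [leftSeq]; infer_instance
  epi_g := (ShortComplex.exact_iff_epi_kernel_lift (augComplex k p)).1 (augComplex_exact k p)

/-- The periodicity class `u ∈ H^2(Λ_p, k) = Ext^2(k, k)`, the Yoneda class of the exact sequence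
`0 ⟶ k ⟶ j^o_{p*} k ⟶ j_{p!} k ⟶ k ⟶ 0`. -/
def periodicityClass : Coh (Lambda p) k 2 :=
  (rightSeq_shortExact k p).extClass.comp (leftSeq_shortExact k p).extClass rfl

end Circle

/-! ### Cyclic, Hochschild and periodic cyclic homology -/

section Main
variable {k : Type u} [Field k] {p : ℕ}

/-- Cyclic homology `HC_n(E) = H_n(Λ_p, E)` of a `p`-cyclic vector space. -/
def HC (E : FunCat (Lambda p) k) (n : ℤ) : ModuleCat.{u} k := homologyOf E n

/-- Hochschild homology `HH_n(E) = H_n(Δᵒᵖ, j_p^* E)` of a `p`-cyclic vector space. -/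
def HH (E : FunCat (Lambda p) k) (n : ℤ) : ModuleCat.{u} k :=
  homologyOf (Lambda.j p ⋙ E) n

/-- The periodicity map `u : HC_n(E) ⟶ HC_{n-2}(E)`. -/
def periodicity [NeZero p] (E : FunCat (Lambda p) k) (n : ℤ) : HC E n ⟶ HC E (n - 2) :=
  cap E (periodicityClass k p) n

/-- Periodic cyclic homology `HP_n(E)`: the derived inverse limit of the cyclic homology complex with
respect to the periodicity map. -/
def HP [NeZero p] (E : FunCat (Lambda p) k) (n : ℤ) : ModuleCat.{u} k :=
  (telescope (capMap E (periodicityClass k p))).homology (-n)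

/-- The projection `HP_n(E) ⟶ HC_{n+2i}(E)` to the `i`-th term of the inverse system. -/
def HPtoHC [NeZero p] (E : FunCat (Lambda p) k) (n : ℤ) (i : ℕ) : HP E n ⟶ HC E (n + 2 * i) :=
  HomologicalComplex.homologyMap (telescopeProj (capMap E (periodicityClass k p)) i) (-n) ≫
    (CochainComplex.ShiftSequence.shiftIso (ModuleCat.{u} k) (-2 * (i : ℤ)) (-n) (-(n + 2 * i))
      (by ring)).hom.app _

/-- The degree `n` part of `M[u⁻¹]`, polynomials with coefficients in the graded space `M` in a variable
`u⁻¹` of degree `2`; the component at `(i, l)` is the coefficient in `M_i` of `u^{-l}`, `i + 2l = n`. -/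
abbrev PolyInv (M : ℤ → ModuleCat.{u} k) (n : ℤ) : Type u :=
  DirectSum {s : ℤ × ℕ // s.1 + 2 * (s.2 : ℤ) = n} fun s => M s.1.1

/-- The degree `n` part of `M((u))`, Laurent series with coefficients in the graded space `M` in a
variable `u` of degree `-2`; the component at `(i, l)` is the coefficient in `M_i` of `u^l`,
`i - 2l = n`. -/
def Laurent (M : ℤ → ModuleCat.{u} k) (n : ℤ) :
    Submodule k (∀ s : {s : ℤ × ℤ // s.1 - 2 * s.2 = n}, M s.1.1) where
  carrier := {a | ∃ N : ℤ, ∀ s, s.1.2 < N → a s = 0}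
  zero_mem' := ⟨0, fun _ _ => rfl⟩
  add_mem' := by
    rintro a b ⟨N, h⟩ ⟨N', h'⟩
    exact ⟨min N N', fun s hs => by
      rw [Pi.add_apply, h s (by omega), h' s (by omega), add_zero]⟩
  smul_mem' := by
    rintro c a ⟨N, h⟩
    exact ⟨N, fun s hs => by rw [Pi.smul_apply, h s hs, smul_zero]⟩

end Main

end CyclicHomology

end

open CyclicHomology

/-! Tensor the sequence `0 → k → j^o_* k → j_! k → k → 0` with `A ∈ Fun(Λ_q, k)`. The term `A ⊗
j^o_* k` is acyclic, and `A ⊗ j_! k ≅ j_! j^* A` has homology `HH(A)`. What remains is the Connes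
sequence `HH_n(A) → HC_n(A) → HC_{n-2}(A) → HH_{n-1}(A)`, whose middle arrow is `u`. For `A = π^* E`
in characteristic `p` its connecting map vanishes, and that is the heart of the theorem.

The reason is that reduction `ℤ/pn → ℤ/n` is a covering of circles of degree `p`. It maps the
four-term sequence over `Λ_p` to the pull-back of the one over `Λ`, with the identity on the
right-hand `k` and multiplication by `p`, that is `0`, on the left-hand `k`. Hence `π^* u = 0`.
Since `H^2(Λ, k)` consists of multiples of `u`, the restriction is zero on all of it. For
coefficients, `A ⊗ j_{p!} k` and `E ⊗ j_! k` have the same cohomology, because both are computed on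
`Δᵒᵖ` and `π j_p = j_1`. So a class on `A ⊗ j_{p!} k` is induced from `Λ`, and its restriction to
the cycles `A ⊗ Z` passes through the zero map on the left-hand `k` (`kernel_ι_comp_eq_zero`).

Thus `u` is surjective on `HC(π^* E)` with kernel `HH(E)`. Linear splittings give `HC(π^* E) ≅
HH(E)[u⁻¹]`. Surjectivity of `u` kills the `lim¹` term, so `HP` is the plain inverse limit, which
consists of Laurent series.

The exact sequences are established for `Ext(-, k)`, where they come from products with extension
classes. Over a field `Ext^N(E, k)` is the dual of `H_N(Γ, E)`, compatibly with these products, so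
surjectivity, injectivity and exactness pass back to homology (`extAct_surjective`,
`extAct_injective`, `extAct_exact`). The acyclicity rests on `ext_fnFun_tensor_eq_zero`, a décalage
argument over `Δᵒᵖ` for the functor `S ↦ k^S`, and on `ext_tensor_eq_zero`, which carries it to
`Λ_q`. The passage between `Λ_q` and `Δᵒᵖ` is the Shapiro-type lemma `extVertex_bijective`. The
final algebra concerns a divisible tower with its kernel (`DivisibleTower`). -/

noncomputable section
namespace CyclicHomology

/-! ### Exact functors, natural transformations and adjunctions on `Ext` -/

section ExtFunctoriality

universe w w' w'' v v' v'' u' u''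
variable {C : Type u} [Category.{v} C] [Abelian C] [HasExt.{w} C]
  {D : Type u'} [Category.{v'} D] [Abelian D] [HasExt.{w'} D]
  {D' : Type u''} [Category.{v''} D'] [Abelian D'] [HasExt.{w''} D']

/-- Every class of positive degree is the product of an extension class with a class of lower
degree. -/
theorem exists_eq_extClass_comp [EnoughProjectives C] {X Y : C} {n : ℕ} (x : Ext X Y (n + 1)) :
    ∃ (S : ShortComplex C) (hS : S.ShortExact) (e : S.X₃ = X) (y : Ext S.X₁ Y n),
      x = (Ext.mk₀ (eqToHom e.symm)).comp (hS.extClass.comp y (add_comm 1 n)) (zero_add _) := by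
  let P : ProjectivePresentation X := Classical.arbitrary _
  let S := ShortComplex.mk _ _ (kernel.condition P.f)
  have hS : S.ShortExact := { exact := ShortComplex.exact_kernel P.f }
  have : Projective S.X₂ := P.projective
  have := Ext.subsingleton_of_projective S.X₂ Y n
  obtain ⟨y, hy⟩ := Ext.contravariant_sequence_exact₃ hS Y x (Subsingleton.elim _ _) (add_comm 1 n)
  exact ⟨S, hS, rfl, y, by simp [hy]⟩

/-- Induction on `Ext`: a property of classes that holds in degree `0` and is inherited by
products with an extension class on the left holds for all classes. -/
theorem ext_induction [EnoughProjectives C] {Y : C}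
    {motive : ∀ (X : C) (n : ℕ), Ext X Y n → Prop}
    (zero : ∀ (X : C) (f : X ⟶ Y), motive X 0 (Ext.mk₀ f))
    (succ : ∀ (S : ShortComplex C) (hS : S.ShortExact) (n : ℕ) (y : Ext S.X₁ Y n),
      motive S.X₁ n y → motive S.X₃ (n + 1) (hS.extClass.comp y (add_comm 1 n)))
    {X : C} {n : ℕ} (x : Ext X Y n) : motive X n x := by
  induction n generalizing X with
  | zero =>
    obtain ⟨f, rfl⟩ := (Ext.mk₀_bijective X Y).2 x
    exact zero X f
  | succ n ih =>
    obtain ⟨S, hS, rfl, y, rfl⟩ := exists_eq_extClass_comp x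
    simpa using succ S hS n y (ih y)

/-- Dimension shifting leaves only maps and extension classes. For the class of `S`, the
transformation `α` is a morphism of short exact sequences from `F S` to `G S`, and extension classes
are natural in such morphisms. -/
theorem mapExactFunctor_naturality [EnoughProjectives C] {F G : C ⥤ D}
    [F.Additive] [PreservesFiniteLimits F] [PreservesFiniteColimits F]
    [G.Additive] [PreservesFiniteLimits G] [PreservesFiniteColimits G] (α : F ⟶ G)
    {X Y : C} {n : ℕ} (x : Ext X Y n) :
    (x.mapExactFunctor F).comp (Ext.mk₀ (α.app Y)) (add_zero n) =
      (Ext.mk₀ (α.app X)).comp (x.mapExactFunctor G) (zero_add n) := by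
  induction x using ext_induction with
  | zero X f => simp [Ext.mapExactFunctor_mk₀]
  | succ S hS n y ih =>
    have key : (hS.extClass.mapExactFunctor F).comp (Ext.mk₀ (α.app S.X₁)) (add_zero 1) =
        (Ext.mk₀ (α.app S.X₃)).comp (hS.extClass.mapExactFunctor G) (zero_add 1) := by
      rw [Ext.mapExactFunctor_extClass, Ext.mapExactFunctor_extClass]
      exact ShortComplex.ShortExact.extClass_naturality (hS.map_of_exact F) (hS.map_of_exact G)
        (S.mapNatTrans α)
    rw [Ext.mapExactFunctor_comp, Ext.mapExactFunctor_comp, Ext.comp_assoc_of_third_deg_zero, ih,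
      ← Ext.comp_assoc_of_second_deg_zero, key]
    exact Ext.comp_assoc _ _ _ _ _ (by omega)

theorem mapExactFunctor_id [EnoughProjectives C] {X Y : C} {n : ℕ} (x : Ext X Y n) :
    x.mapExactFunctor (𝟭 C) = x := by
  induction x using ext_induction with
  | zero X f => exact Ext.mapExactFunctor_mk₀ _ _
  | succ S hS n y ih =>
    rw [Ext.mapExactFunctor_comp, ih, Ext.mapExactFunctor_extClass]
    rfl

theorem mapExactFunctor_functorComp [EnoughProjectives C] (F : C ⥤ D) (G : D ⥤ D')
    [F.Additive] [PreservesFiniteLimits F] [PreservesFiniteColimits F]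
    [G.Additive] [PreservesFiniteLimits G] [PreservesFiniteColimits G]
    [(F ⋙ G).Additive] [PreservesFiniteLimits (F ⋙ G)] [PreservesFiniteColimits (F ⋙ G)]
    {X Y : C} {n : ℕ} (x : Ext X Y n) :
    x.mapExactFunctor (F ⋙ G) = (x.mapExactFunctor F).mapExactFunctor G := by
  induction x using ext_induction with
  | zero X f => simp only [Ext.mapExactFunctor_mk₀]; rfl
  | succ S hS n y ih =>
    have key : hS.extClass.mapExactFunctor (F ⋙ G) =
        (hS.extClass.mapExactFunctor F).mapExactFunctor G := by
      rw [Ext.mapExactFunctor_extClass, Ext.mapExactFunctor_extClass]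
      exact (Ext.mapExactFunctor_extClass G (hS.map_of_exact F)).symm
    rw [Ext.mapExactFunctor_comp, ih, key, Ext.mapExactFunctor_comp, Ext.mapExactFunctor_comp]

/-- The map `Ext(L X, Y) ⟶ Ext(X, R Y)` of an adjoint pair of exact functors. -/
def extAdj {L : C ⥤ D} {R : D ⥤ C} (adj : L ⊣ R)
    [R.Additive] [PreservesFiniteLimits R] [PreservesFiniteColimits R]
    {X : C} {Y : D} {n : ℕ} (y : Ext (L.obj X) Y n) : Ext X (R.obj Y) n :=
  (Ext.mk₀ (adj.unit.app X)).comp (y.mapExactFunctor R) (zero_add n)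

/-- The inverse applies `L` and composes with the counit. Naturality of the unit and the counit on
`Ext` reduces both round trips to the triangle identities. -/
theorem extAdj_bijective [EnoughProjectives C] [EnoughProjectives D] {L : C ⥤ D} {R : D ⥤ C}
    (adj : L ⊣ R) [L.Additive] [PreservesFiniteLimits L] [PreservesFiniteColimits L]
    [R.Additive] [PreservesFiniteLimits R] [PreservesFiniteColimits R] (X : C) (Y : D) (n : ℕ) :
    Function.Bijective (extAdj adj (X := X) (Y := Y) (n := n)) := by
  refine Function.bijective_iff_has_inverse.2
    ⟨fun x => (x.mapExactFunctor L).comp (Ext.mk₀ (adj.counit.app Y)) (add_zero n),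
      fun y => ?_, fun x => ?_⟩
  · have h := mapExactFunctor_naturality adj.counit y
    rw [mapExactFunctor_id, mapExactFunctor_functorComp] at h
    dsimp only [extAdj]
    rw [Ext.mapExactFunctor_comp, Ext.mapExactFunctor_mk₀]
    refine (Ext.comp_assoc_of_third_deg_zero _ _ _ _).trans ?_
    refine (congrArg (fun t => Ext.comp (Ext.mk₀ (L.map (adj.unit.app X))) t (zero_add n)) h).trans ?_
    refine (Ext.mk₀_comp_mk₀_assoc _ _ _).trans ?_
    simp
  · have h := mapExactFunctor_naturality adj.unit x
    rw [mapExactFunctor_id, mapExactFunctor_functorComp] at h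
    dsimp only [extAdj]
    rw [Ext.mapExactFunctor_comp, Ext.mapExactFunctor_mk₀]
    refine (Ext.comp_assoc_of_third_deg_zero _ _ _ _).symm.trans ?_
    refine (congrArg (fun t => Ext.comp t _ _) h.symm).trans ?_
    refine (Ext.comp_assoc_of_third_deg_zero _ _ _ _).trans ?_
    rw [Ext.mk₀_comp_mk₀]
    simp

end ExtFunctoriality

/-! ### Linear forms on the homology of a complex -/

section Pairing

universe v
variable {C : Type u} [Category.{v} C] [Abelian C]

/-- A map `w : K^a ⟶ V` induces the map `ℓ : H^a(K) ⟶ V`. -/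
def Induces (K : CochainComplex C ℤ) (a : ℤ) {V : C} (ℓ : K.homology a ⟶ V) (w : K.X a ⟶ V) :
    Prop :=
  K.homologyπ a ≫ ℓ = K.iCycles a ≫ w

theorem Induces.sub {K : CochainComplex C ℤ} {a : ℤ} {V : C} {ℓ ℓ' : K.homology a ⟶ V}
    {w w' : K.X a ⟶ V} (h : Induces K a ℓ w) (h' : Induces K a ℓ' w') :
    Induces K a (ℓ - ℓ') (w - w') := by
  simp only [Induces, Preadditive.comp_sub] at *
  rw [h, h']

theorem exists_induces (K : CochainComplex C ℤ) (a b : ℤ) (hb : b + 1 = a) {V : C}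
    (w : K.X a ⟶ V) (hw : K.d b a ≫ w = 0) : ∃ ℓ, Induces K a ℓ w :=
  ⟨K.homologyι a ≫ K.descOpcycles w b (by simp; omega) hw, by simp [Induces]⟩

/-- Homology embeds in the opcycles, so a form with injective target extends to them; composing with
the projection from `K^a` gives a form that kills boundaries. -/
theorem exists_induces_of_injective (K : CochainComplex C ℤ) (a b : ℤ) {V : C}
    [Injective V] (ℓ : K.homology a ⟶ V) : ∃ w, K.d b a ≫ w = 0 ∧ Induces K a ℓ w := by
  refine ⟨K.pOpcycles a ≫ Injective.factorThru ℓ (K.homologyι a), by simp, ?_⟩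
  rw [Induces, ← K.homology_π_ι_assoc, Injective.comp_factorThru]

/-- The induced form is zero exactly when `w` vanishes on cycles. Such a `w` factors through the
image of `d`, and injectivity of `V` extends it to the next term. -/
theorem Induces.eq_zero_iff {K : CochainComplex C ℤ} {a b : ℤ} (hb : a + 1 = b) {V : C}
    [Injective V] {ℓ : K.homology a ⟶ V} {w : K.X a ⟶ V} (h : Induces K a ℓ w) :
    ℓ = 0 ↔ ∃ g : K.X b ⟶ V, K.d a b ≫ g = w := by
  rw [← cancel_epi (K.homologyπ a), h, comp_zero]
  constructor
  · intro h0
    let S := ShortComplex.mk (K.iCycles a) (K.d a b) (by simp)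
    have hS : S.Exact := S.exact_of_f_is_kernel (K.cyclesIsKernel a b (by simp [hb]))
    exact ⟨hS.descToInjective w h0, hS.comp_descToInjective w h0⟩
  · rintro ⟨g, rfl⟩
    simp

theorem Induces.comp_shift {K L : CochainComplex C ℤ} {m a : ℤ} (φ : K ⟶ L⟦m⟧) {V : C}
    {ℓ : L.homology (a + m) ⟶ V} {w : L.X (a + m) ⟶ V} (h : Induces L (a + m) ℓ w) :
    Induces K a (HomologicalComplex.homologyMap φ a ≫
      (CochainComplex.ShiftSequence.shiftIso C m a (a + m) (add_comm m a)).hom.app L ≫ ℓ)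
      (φ.f a ≫ w) := by
  have key : (L⟦m⟧).homologyπ a ≫
      (CochainComplex.ShiftSequence.shiftIso C m a (a + m) (add_comm m a)).hom.app L ≫ ℓ =
      (L⟦m⟧).iCycles a ≫ w := by
    rw [CochainComplex.ShiftSequence.shiftIso_hom_app]
    have h1 := ShortComplex.homologyπ_naturality
      ((CochainComplex.shiftShortComplexFunctorIso C m a (a + m) (add_comm m a)).hom.app L)
    have h2 := ShortComplex.cyclesMap_i
      ((CochainComplex.shiftShortComplexFunctorIso C m a (a + m) (add_comm m a)).hom.app L)
    refine (Category.assoc _ _ _).symm.trans ((congrArg (· ≫ ℓ) h1).trans ?_)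
    refine (Category.assoc _ _ _).trans ((congrArg (_ ≫ ·) h).trans ?_)
    refine (Category.assoc _ _ _).symm.trans ((congrArg (· ≫ w) h2).trans ?_)
    refine (Category.assoc _ _ _).trans (congrArg (_ ≫ ·) ?_)
    exact (congrArg (· ≫ w) (show _ = 𝟙 _ from by simp)).trans (Category.id_comp w)
  rw [Induces, HomologicalComplex.homologyπ_naturality_assoc, key]
  exact HomologicalComplex.cyclesMap_i_assoc φ a w

end Pairing

/-! ### Cocycles on resolutions and the pairing of `Ext` with homology -/

section ExtOf
open CochainComplex Localization
variable {Γ : Type} [SmallCategory Γ] {k : Type u} [Field k]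

/-- The class in `Ext^n(E, Y)` of a cocycle on the projective resolution of `E`. -/
def extOf (E : FunCat Γ k) {Y : FunCat Γ k} (n : ℕ) (a : ℤ) (ha : a + n = 0)
    (z : (projectiveResolution E).cochainComplex.X a ⟶ Y)
    (hz : (projectiveResolution E).cochainComplex.d (a - 1) a ≫ z = 0) : Ext E Y n :=
  (projectiveResolution E).extEquivCohomologyClass.symm
    (.mk (HomComplex.Cocycle.toSingleMk z ha (a - 1) (by omega) hz))

theorem exists_eq_extOf {E Y : FunCat Γ k} {n : ℕ} (a : ℤ) (ha : a + n = 0) (y : Ext E Y n) :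
    ∃ z hz, y = extOf E n a ha z hz := by
  obtain ⟨x, rfl⟩ := (projectiveResolution E).extEquivCohomologyClass.symm.surjective y
  obtain ⟨x, rfl⟩ := x.mk_surjective
  obtain ⟨f, hf, rfl⟩ := HomComplex.Cocycle.toSingleMk_surjective x a ha (a - 1) (by omega)
  exact ⟨f, hf, rfl⟩

theorem extOf_eq_zero_iff {E Y : FunCat Γ k} {n : ℕ} {a : ℤ} (ha : a + n = 0)
    (z : (projectiveResolution E).cochainComplex.X a ⟶ Y)
    (hz : (projectiveResolution E).cochainComplex.d (a - 1) a ≫ z = 0) :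
    extOf E n a ha z hz = 0 ↔
      ∃ g, (projectiveResolution E).cochainComplex.d a (a + 1) ≫ g = z := by
  rw [extOf, ← (projectiveResolution E).extEquivCohomologyClass.apply_eq_iff_eq,
    ProjectiveResolution.extEquivCohomologyClass_zero, Equiv.apply_symm_apply,
    HomComplex.CohomologyClass.mk_eq_zero_iff,
    HomComplex.Cocycle.toSingleMk_mem_coboundaries_iff _ _ _ _ _ (a + 1) rfl]

theorem extOf_sub {E Y : FunCat Γ k} {n : ℕ} {a : ℤ} (ha : a + n = 0)
    (z z' : (projectiveResolution E).cochainComplex.X a ⟶ Y)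
    (hz : (projectiveResolution E).cochainComplex.d (a - 1) a ≫ z = 0)
    (hz' : (projectiveResolution E).cochainComplex.d (a - 1) a ≫ z' = 0) :
    extOf E n a ha z hz - extOf E n a ha z' hz' =
      extOf E n a ha (z - z') (by rw [Preadditive.comp_sub, hz, hz', sub_zero]) := by
  rw [extOf, extOf, extOf, HomComplex.Cocycle.toSingleMk_sub _ _ _ _ _ hz hz',
    HomComplex.CohomologyClass.mk_sub, ProjectiveResolution.extEquivCohomologyClass_symm_sub]

theorem smallShiftedHom_mk_comp_mk {C : Type*} [Category C] [Abelian C] {K L M : CochainComplex C ℤ}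
    [HasSmallLocalizedShiftedHom.{u} (HomologicalComplex.quasiIso C (ComplexShape.up ℤ)) ℤ K L]
    [HasSmallLocalizedShiftedHom.{u} (HomologicalComplex.quasiIso C (ComplexShape.up ℤ)) ℤ L M]
    [HasSmallLocalizedShiftedHom.{u} (HomologicalComplex.quasiIso C (ComplexShape.up ℤ)) ℤ K M]
    [HasSmallLocalizedShiftedHom.{u} (HomologicalComplex.quasiIso C (ComplexShape.up ℤ)) ℤ M M]
    {a b c : ℤ} (f : ShiftedHom K L a) (g : ShiftedHom L M b) (h : b + a = c) :
    (SmallShiftedHom.mk (HomologicalComplex.quasiIso C (ComplexShape.up ℤ)) f).comp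
      (SmallShiftedHom.mk (HomologicalComplex.quasiIso C (ComplexShape.up ℤ)) g) h =
      SmallShiftedHom.mk _ (f.comp g h) := by
  have := HasDerivedCategory.standard C
  apply (SmallShiftedHom.equiv _ DerivedCategory.Q).injective
  simp only [SmallShiftedHom.equiv_comp, SmallShiftedHom.equiv_mk, ShiftedHom.map_comp]

/-- In the derived category `x` is the inverse of the resolution map of `E`, then `extRep x`, then
the resolution map of `E'`. The last factor cancels against its inverse in the other class, so the
product is computed by composing with `extRep x`. -/
theorem comp_extEquivCohomologyClass_symm {E E' Y : FunCat Γ k} {m n N : ℕ} (x : Ext E E' m)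
    (h : m + n = N) (c : HomComplex.Cocycle (projectiveResolution E').cochainComplex
      ((singleFunctor _ 0).obj Y) n) :
    x.comp ((projectiveResolution E').extEquivCohomologyClass.symm (.mk c)) h =
      (projectiveResolution E).extEquivCohomologyClass.symm
        (.mk (HomComplex.Cocycle.equivHomShift (ShiftedHom.comp (extRep x)
          (HomComplex.Cocycle.equivHomShift.symm c) (c := (N : ℤ)) (by omega)))) := by
  have hW (F : FunCat Γ k) : HomologicalComplex.quasiIso _ (ComplexShape.up ℤ)
      (projectiveResolution F).π' := by
    rw [HomologicalComplex.mem_quasiIso_iff]; infer_instance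
  have hx : x = (SmallShiftedHom.mk₀Inv (0 : ℤ) rfl _ (hW E)).comp
      ((SmallShiftedHom.mk _ (extRep x)).comp
        (SmallShiftedHom.mk₀ _ (0 : ℤ) rfl (projectiveResolution E').π') (zero_add _))
        (add_zero _) := by
    have h0 := (extEquiv E E' m x).mk_surjective.choose_spec
    refine ((extEquiv E E' m).symm_apply_apply x).symm.trans ?_
    rw [← h0]
    rfl
  have hy : (projectiveResolution E').extEquivCohomologyClass.symm (.mk c) =
      (SmallShiftedHom.mk₀Inv (0 : ℤ) rfl _ (hW E')).comp
        (SmallShiftedHom.mk _ (HomComplex.Cocycle.equivHomShift.symm c)) (add_zero _) := rfl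
  have hz (c' : HomComplex.Cocycle (projectiveResolution E).cochainComplex
      ((singleFunctor _ 0).obj Y) N) :
      (projectiveResolution E).extEquivCohomologyClass.symm (.mk c') =
      (SmallShiftedHom.mk₀Inv (0 : ℤ) rfl _ (hW E)).comp
        (SmallShiftedHom.mk _ (HomComplex.Cocycle.equivHomShift.symm c')) (add_zero _) := rfl
  rw [hz, AddEquiv.symm_apply_apply, ← smallShiftedHom_mk_comp_mk, hy]
  conv_lhs => rw [hx]
  refine (SmallShiftedHom.comp_assoc _ _ _ _ (add_zero _) (a₂₃ := (N : ℤ)) (by omega) (by omega)).trans ?_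
  congr 1
  refine (SmallShiftedHom.comp_assoc _ _ _ _ (zero_add _) (a₂₃ := (n : ℤ)) (by omega) (by omega)).trans ?_
  congr 1
  refine (SmallShiftedHom.comp_assoc _ _ _ _ (a₁₂ := (0 : ℤ)) (by omega) (add_zero _) (by omega)).symm.trans ?_
  rw [SmallShiftedHom.mk₀_comp_mk₀Inv]
  exact SmallShiftedHom.mk₀_id_comp _ _ _

theorem xIsoOfEq_cycle {C : Type*} [Category C] [Abelian C] (K : CochainComplex C ℤ) {p q r : ℤ}
    (h : q = p) (h' : q = r) (h'' : r = p) :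
    (K.XIsoOfEq h).inv ≫ (K.XIsoOfEq h').hom ≫ (K.XIsoOfEq h'').hom = 𝟙 _ := by
  subst h h'
  simp

theorem comp_cancel_aux {C : Type*} [Category C] {A B Y S₀ S₁ S₂ : C} (f : A ⟶ B) (z : B ⟶ Y)
    (s : Y ⟶ S₀) (i : S₀ ⟶ S₁) (i' : S₁ ⟶ S₂) (i'' : S₂ ⟶ S₀) (t : S₀ ⟶ Y)
    (h : i ≫ i' ≫ i'' = 𝟙 _) :
    ((f ≫ ((z ≫ s) ≫ i) ≫ i') ≫ i'') ≫ t = ((f ≫ z) ≫ s) ≫ t := by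
  simp only [Category.assoc, reassoc_of% h]

theorem equivHomShift_comp_toSingleMk {C : Type*} [Category C] [Abelian C]
    {K L : CochainComplex C ℤ} {Y : C} {m n N a b : ℤ} (φ : K ⟶ L⟦m⟧) (h : n + m = N)
    (ha : a + m + n = 0) (z : L.X (a + m) ⟶ Y) (hb : b + 1 = a) (hz : L.d (b + m) (a + m) ≫ z = 0)
    (hz' : K.d b a ≫ φ.f a ≫ z = 0) :
    HomComplex.Cocycle.equivHomShift (ShiftedHom.comp φ
      (HomComplex.Cocycle.equivHomShift.symm
        (HomComplex.Cocycle.toSingleMk (q := 0) z ha (b + m) (by omega) hz)) h) =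
      HomComplex.Cocycle.toSingleMk (q := 0) (n := N) (φ.f a ≫ z) (by omega) b hb hz' := by
  ext : 1
  apply (HomComplex.Cochain.toSingleEquiv (p := a) (by omega)).injective
  simp only [HomComplex.Cochain.toSingleEquiv, HomComplex.Cocycle.equivHomShift_apply, HomComplex.Cocycle.equivHomShift_symm_apply,
    HomComplex.Cocycle.toSingleMk_coe]
  simp [ShiftedHom.comp,  HomComplex.Cochain.rightUnshift_v _ _ _ _ _ _ _ (add_zero a)]
  rw [HomComplex.Cochain.rightShift_v _ _ _ _ _ _ _ 0 ha, HomComplex.Cochain.toSingleMk_v,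
    shiftFunctorAdd'_inv_app_f']
  refine comp_cancel_aux _ _ _ _ _ _ _ ?_
  exact xIsoOfEq_cycle _ _ _ _

theorem comp_extOf {E E' Y : FunCat Γ k} {m n N : ℕ} (x : Ext E E' m) (h : m + n = N) {a : ℤ}
    (ha : a + m + n = 0) (z : (projectiveResolution E').cochainComplex.X (a + m) ⟶ Y)
    (hz : (projectiveResolution E').cochainComplex.d (a + m - 1) (a + m) ≫ z = 0) :
    ∃ hz', x.comp (extOf E' n (a + m) ha z hz) h =
      extOf E N a (by omega) ((extRep x).f a ≫ z) hz' := by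
  have hz1 : (projectiveResolution E').cochainComplex.d (a - 1 + m) (a + m) ≫ z = 0 := by
    rw [show a - 1 + (m : ℤ) = a + m - 1 by ring, hz]
  have hz' : (projectiveResolution E).cochainComplex.d (a - 1) a ≫ (extRep x).f a ≫ z = 0 := by
    refine (Category.assoc _ _ _).symm.trans
      ((congrArg (· ≫ z) ((extRep x).comm (a - 1) a).symm).trans ?_)
    -- The sign in the shifted differential is harmless, since only a vanishing is needed.
    have h0 : ((projectiveResolution E').cochainComplex⟦(m : ℤ)⟧).d (a - 1) a ≫ z = 0 := by
      change ((m : ℤ).negOnePow •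
        (projectiveResolution E').cochainComplex.d (a - 1 + m) (a + m)) ≫ z = 0
      rw [Linear.units_smul_comp, hz1, smul_zero]
    exact (Category.assoc _ _ _).trans ((congrArg (_ ≫ ·) h0).trans comp_zero)
  refine ⟨hz', ?_⟩
  rw [extOf, comp_extEquivCohomologyClass_symm, extOf]
  congr 2
  rw [← equivHomShift_comp_toSingleMk (extRep x) (by omega) ha z (by omega) hz1]
  rfl

/-- The map `H^a(chains E) ⟶ H^{a+m}(chains E')` induced by a class in `Ext^m(E, E')`. -/
def extAct {E E' : FunCat Γ k} {m : ℕ} (x : Ext E E' m) (a a' : ℤ) (h : m + a = a') :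
    (chains E).homology a ⟶ (chains E').homology a' :=
  HomologicalComplex.homologyMap (chainsMap x) a ≫
    (CochainComplex.ShiftSequence.shiftIso (ModuleCat.{u} k) (m : ℤ) a a' h).hom.app _

/-- Maps from the resolution of `E` to the constant functor are linear forms on `chains E`. -/
def chainsForm {E : FunCat Γ k} {a : ℤ} :
    ((projectiveResolution E).cochainComplex.X a ⟶ constFun Γ k) ≃+
      ((chains E).X a ⟶ ModuleCat.of k k) :=
  (colimConstAdj.homAddEquiv ((projectiveResolution E).cochainComplex.X a)
    (ModuleCat.of k k)).symm

theorem chainsForm_d {E : FunCat Γ k} {a b : ℤ}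
    (z : (projectiveResolution E).cochainComplex.X b ⟶ constFun Γ k) :
    chainsForm ((projectiveResolution E).cochainComplex.d a b ≫ z) =
      (chains E).d a b ≫ chainsForm z :=
  colimConstAdj.homEquiv_naturality_left_symm _ z

theorem chainsForm_extRep {E E' : FunCat Γ k} {m : ℕ} (x : Ext E E' m) {a : ℤ}
    (z : (projectiveResolution E').cochainComplex.X (a + m) ⟶ constFun Γ k) :
    chainsForm ((extRep x).f a ≫ z) = (chainsMap x).f a ≫ chainsForm z := by
  refine (colimConstAdj.homEquiv_naturality_left_symm ((extRep x).f a) z).trans ?_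
  refine eq_whisker (?_ : colim.map ((extRep x).f a) = (chainsMap x).f a) _
  exact (Category.comp_id _).symm

/-- The linear form `ℓ` on homology corresponds to the class `y ∈ Ext^N(E, k)`. -/
def IsDual {E : FunCat Γ k} {a : ℤ} {N : ℕ} (ha : a + N = 0)
    (ℓ : (chains E).homology a ⟶ ModuleCat.of k k) (y : Ext E (constFun Γ k) N) : Prop :=
  ∃ z hz, y = extOf E N a ha z hz ∧ Induces (chains E) a ℓ (chainsForm z)

instance : Injective (ModuleCat.of k k) :=
  have := Module.injective_of_isSemisimpleRing k k
  Module.injective_object_of_injective_module k k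

/-- `IsDual` is the graph of the duality between `Ext^N(E, k)` and `H_N(Γ, E)`. This lemma and the
next say that it is total on both sides. As a relation it needs no choice of cocycles. -/
theorem exists_isDual_left {E : FunCat Γ k} {a : ℤ} {N : ℕ} (ha : a + N = 0)
    (ℓ : (chains E).homology a ⟶ ModuleCat.of k k) : ∃ y, IsDual ha ℓ y := by
  obtain ⟨w, hw, h⟩ := exists_induces_of_injective (chains E) a (a - 1) ℓ
  obtain ⟨z, rfl⟩ := chainsForm.surjective w
  rw [← chainsForm_d, map_eq_zero_iff _ chainsForm.injective] at hw
  exact ⟨_, z, hw, rfl, h⟩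

theorem exists_isDual_right {E : FunCat Γ k} {a : ℤ} {N : ℕ} (ha : a + N = 0)
    (y : Ext E (constFun Γ k) N) : ∃ ℓ : (chains E).homology a ⟶ _, IsDual ha ℓ y := by
  obtain ⟨z, hz, rfl⟩ := exists_eq_extOf a ha y
  obtain ⟨ℓ, h⟩ := exists_induces (chains E) a (a - 1) (by omega) (chainsForm z)
    (by rw [← chainsForm_d, hz, map_zero])
  exact ⟨ℓ, z, hz, rfl, h⟩

/-- Both sides say that the representing cocycle is a coboundary. Together with compatibility with
differences this makes the relation a bijection. -/
theorem IsDual.eq_zero_iff {E : FunCat Γ k} {a : ℤ} {N : ℕ} {ha : a + N = 0}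
    {ℓ : (chains E).homology a ⟶ ModuleCat.of k k} {y : Ext E (constFun Γ k) N}
    (h : IsDual ha ℓ y) : ℓ = 0 ↔ y = 0 := by
  obtain ⟨z, hz, rfl, h⟩ := h
  rw [h.eq_zero_iff rfl, extOf_eq_zero_iff, chainsForm.surjective.exists]
  simp only [← chainsForm_d, EmbeddingLike.apply_eq_iff_eq]

theorem IsDual.sub {E : FunCat Γ k} {a : ℤ} {N : ℕ} {ha : a + N = 0}
    {ℓ ℓ' : (chains E).homology a ⟶ ModuleCat.of k k} {y y' : Ext E (constFun Γ k) N}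
    (h : IsDual ha ℓ y) (h' : IsDual ha ℓ' y') : IsDual ha (ℓ - ℓ') (y - y') := by
  obtain ⟨z, hz, rfl, h⟩ := h
  obtain ⟨z', hz', rfl, h'⟩ := h'
  refine ⟨z - z', _, extOf_sub _ _ _ _ _, ?_⟩
  rw [map_sub]
  exact h.sub h'

/-- Left multiplication by `x` on `Ext(-, k)` is the transpose of the action of `x` on homology,
because `extRep x` computes both. -/
theorem IsDual.extAct {E E' : FunCat Γ k} {m N N' : ℕ} (x : Ext E E' m) {a a' : ℤ}
    (h : m + a = a') {ha' : a' + N' = 0} {ha : a + N = 0} (hN : m + N' = N)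
    {ℓ : (chains E').homology a' ⟶ ModuleCat.of k k} {y : Ext E' (constFun Γ k) N'}
    (hd : IsDual ha' ℓ y) : IsDual ha (extAct x a a' h ≫ ℓ) (x.comp y hN) := by
  obtain rfl : a' = a + m := by omega
  obtain ⟨z, hz, rfl, hd⟩ := hd
  obtain ⟨hz', h'⟩ := comp_extOf x hN ha' z hz
  refine ⟨_, hz', h', ?_⟩
  rw [chainsForm_extRep]
  exact (iff_of_eq (congrArg (Induces (chains E) a · _) (Category.assoc _ _ _))).2
    (hd.comp_shift (chainsMap x))

end ExtOf

/-! ### From exactness on `Ext` to exactness on homology -/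

section Duality
variable {Γ : Type} [SmallCategory Γ] {k : Type u} [Field k]

theorem subsingleton_chains_homology (E : FunCat Γ k) {a : ℤ} (ha : 0 < a) :
    Subsingleton ((chains E).homology a) := by
  have h : IsZero ((projectiveResolution E).cochainComplex.X a) :=
    CochainComplex.isZero_of_isStrictlyLE _ 0 _ ha
  have h' : IsZero ((chains E).X a) := colim.map_isZero h
  rw [← ModuleCat.isZero_iff_subsingleton]
  exact ShortComplex.isZero_homology_of_isZero_X₂ _ h'

/-- A linear map is surjective if its transpose is injective, and the transpose is multiplication by
`x`. -/
theorem extAct_surjective {E E' : FunCat Γ k} {m N N' : ℕ} (x : Ext E E' m) {a a' : ℤ}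
    (h : m + a = a') (ha' : a' + N' = 0) (ha : a + N = 0) (hN : m + N' = N)
    (hx : ∀ y : Ext E' (constFun Γ k) N', x.comp y hN = 0 → y = 0) :
    Function.Surjective (extAct x a a' h) := by
  change Function.Surjective (extAct x a a' h).hom
  rw [← LinearMap.dualMap_injective_iff, injective_iff_map_eq_zero]
  intro ℓ hℓ
  obtain ⟨y, hy⟩ := exists_isDual_left ha' (ModuleCat.ofHom ℓ)
  have h0 := (hy.extAct x h (ha := ha) hN).eq_zero_iff.1 (ModuleCat.hom_ext hℓ)
  exact congrArg ModuleCat.Hom.hom (hy.eq_zero_iff.2 (hx y h0))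

theorem extAct_injective {E E' : FunCat Γ k} {m N N' : ℕ} (x : Ext E E' m) {a a' : ℤ}
    (h : m + a = a') (ha' : a' + N' = 0) (ha : a + N = 0) (hN : m + N' = N)
    (hx : ∀ z : Ext E (constFun Γ k) N, ∃ y : Ext E' (constFun Γ k) N', x.comp y hN = z) :
    Function.Injective (extAct x a a' h) := by
  change Function.Injective (extAct x a a' h).hom
  rw [← LinearMap.dualMap_surjective_iff]
  intro ℓ
  obtain ⟨z, hz⟩ := exists_isDual_left ha (ModuleCat.ofHom ℓ)
  obtain ⟨y, rfl⟩ := hx z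
  obtain ⟨ℓ', hy⟩ := exists_isDual_right ha' y
  have h0 := (hz.sub (hy.extAct x h (ha := ha) hN)).eq_zero_iff.2 (sub_self _)
  have h1 := sub_eq_zero.1 h0
  exact ⟨ℓ'.hom, (congrArg (fun t => t.hom) h1).symm⟩

theorem extAct_exact {E E' E'' : FunCat Γ k} {m m' N N' N'' : ℕ} (x : Ext E E' m)
    (x' : Ext E' E'' m') {a a' a'' : ℤ} (h : m + a = a') (h' : m' + a' = a'')
    (ha'' : a'' + N'' = 0) (ha' : a' + N' = 0) (ha : a + N = 0) (hN : m + N' = N)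
    (hN' : m' + N'' = N') (hzero : x.comp x' rfl = 0)
    (hx : ∀ y : Ext E' (constFun Γ k) N', x.comp y hN = 0 → ∃ z, x'.comp z hN' = y) :
    Function.Exact (extAct x a a' h) (extAct x' a' a'' h') := by
  intro v
  constructor
  · intro hv
    by_contra hmem
    -- A form that vanishes on the image but not at `v` is dual to a class killed by `x`. That class
    -- is a multiple of `x'`, so the form vanishes on the kernel of the action of `x'`, which
    -- contains `v`.
    obtain ⟨ℓ, hℓ, hr⟩ := Submodule.exists_le_ker_of_notMem
      (p := LinearMap.range (extAct x a a' h).hom) (v := v) (by simpa using hmem)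
    obtain ⟨y, hy⟩ := exists_isDual_left ha' (ModuleCat.ofHom ℓ)
    have h0 : extAct x a a' h ≫ ModuleCat.ofHom ℓ = 0 :=
      ModuleCat.hom_ext (LinearMap.ext fun w => hr ⟨w, rfl⟩)
    obtain ⟨z, rfl⟩ := hx y ((hy.extAct x h (ha := ha) hN).eq_zero_iff.1 h0)
    obtain ⟨ℓ', hz⟩ := exists_isDual_right ha'' z
    have h1 := (hy.sub (hz.extAct x' h' (ha := ha') hN')).eq_zero_iff.2 (sub_self _)
    have h2 : ℓ v = ℓ' (extAct x' a' a'' h' v) :=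
      congrArg (fun t => t.hom v) (sub_eq_zero.1 h1)
    rw [hv, map_zero] at h2
    exact hℓ h2
  · rintro ⟨w, rfl⟩
    rw [← Module.forall_dual_apply_eq_zero_iff k]
    intro ℓ
    obtain ⟨y, hy⟩ := exists_isDual_left ha'' (ModuleCat.ofHom ℓ)
    have h1 := ((hy.extAct x' h' (ha := ha') hN').extAct x h (ha := ha) hN).eq_zero_iff.2 (by
      rw [← Ext.comp_assoc x x' y rfl hN' (by omega), hzero, Ext.zero_comp])
    exact congrArg (fun t => t.hom w) h1

end Duality

/-! ### Injectivity of the constant functor -/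

section ConstInjective
variable {Γ : Type} [SmallCategory Γ] {k : Type u} [Field k]

/-- The constant functor is injective if the source category has a terminal object. -/
theorem injective_constFun {t : Γ} (ht : IsTerminal t) : Injective (constFun Γ k) where
  factors {X Y} g f _ := by
    -- A map to the constant functor is determined by its component at `t`, so it suffices to extend
    -- a linear form there.
    let h : Y.obj t ⟶ ModuleCat.of k k := Injective.factorThru (g.app t) (f.app t)
    have hh : f.app t ≫ h = g.app t := Injective.comp_factorThru _ _
    refine ⟨{ app := fun a => Y.map (ht.from a) ≫ h, naturality := fun a b φ => ?_ }, ?_⟩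
    · have h1 : Y.map φ ≫ Y.map (ht.from b) = Y.map (ht.from a) :=
        (Y.map_comp _ _).symm.trans (congrArg Y.map (ht.hom_ext _ _))
      exact (Category.assoc _ _ _).symm.trans
        ((congrArg (· ≫ h) h1).trans (Category.comp_id (Y.map (ht.from a) ≫ h)).symm)
    · ext a : 2
      have h1 : f.app a ≫ Y.map (ht.from a) ≫ h = X.map (ht.from a) ≫ g.app t := by
        exact (Category.assoc _ _ _).symm.trans ((congrArg (· ≫ h) (f.naturality _).symm).trans
          ((Category.assoc _ _ _).trans (congrArg (X.map (ht.from a) ≫ ·) hh)))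
      exact h1.trans ((g.naturality (ht.from a)).trans (Category.comp_id _))

theorem app_eq_of_isTerminal {t : Γ} (ht : IsTerminal t) {X : FunCat Γ k}
    (g : X ⟶ constFun Γ k) (a : Γ) : g.app a = X.map (ht.from a) ≫ g.app t :=
  ((g.naturality (ht.from a)).trans (Category.comp_id _)).symm

end ConstInjective

/-! ### Décalage -/

/-- Objects of the category of nonempty finite ordinals and order-preserving maps that preserve
the least element. -/
structure MinSimplex where
  len : ℕ

namespace MinSimplex

instance : SmallCategory MinSimplex where
  Hom X Y := {φ : Fin (X.len + 1) →o Fin (Y.len + 1) // φ 0 = 0}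
  id X := ⟨OrderHom.id, rfl⟩
  comp f g := ⟨g.1.comp f.1, by simp [f.2, g.2]⟩

/-- The forgetful functor to `Δ`. -/
def forget : MinSimplex ⥤ SimplexCategory where
  obj X := SimplexCategory.mk X.len
  map f := SimplexCategory.mkHom f.1

/-- Extension of an order-preserving map by a new least element. -/
def consHom {m n : ℕ} (φ : Fin m →o Fin (n + 1)) : Fin (m + 1) →o Fin (n + 1) where
  toFun := Fin.cases 0 φ
  monotone' := by
    intro i j
    induction i using Fin.cases with
    | zero => intro _; exact Fin.zero_le _
    | succ i =>
      induction j using Fin.cases with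
      | zero => intro h; simp at h
      | succ j => intro h; exact φ.monotone (Fin.succ_le_succ_iff.1 h)

/-- The functor that adds a new least element. -/
def cons : SimplexCategory ⥤ MinSimplex where
  obj S := ⟨S.len + 1⟩
  map {S T} φ := ⟨consHom ((Fin.succOrderEmb (T.len + 1)).toOrderHom.comp φ.toOrderHom), rfl⟩
  map_id S := by
    refine Subtype.ext (OrderHom.ext _ _ (funext fun i => ?_))
    induction i using Fin.cases <;> rfl
  map_comp f g := by
    refine Subtype.ext (OrderHom.ext _ _ (funext fun i => ?_))
    induction i using Fin.cases <;> rfl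

/-- Adding a least element is left adjoint to the forgetful functor. -/
def consAdj : cons ⊣ forget :=
  Adjunction.mkOfHomEquiv
    { homEquiv := fun S T =>
        { toFun := fun f => SimplexCategory.mkHom
            (f.1.comp (Fin.succOrderEmb (S.len + 1)).toOrderHom)
          invFun := fun φ => ⟨consHom φ.toOrderHom, rfl⟩
          left_inv := fun f => by
            refine Subtype.ext (OrderHom.ext _ _ (funext fun i => ?_))
            induction i using Fin.cases with
            | zero => exact f.2.symm
            | succ i => rfl
          right_inv := fun φ => SimplexCategory.Hom.ext _ _ (OrderHom.ext _ _ (funext fun i => rfl)) }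
      homEquiv_naturality_left_symm := fun f g => by
        refine Subtype.ext (OrderHom.ext _ _ (funext fun i => ?_))
        induction i using Fin.cases <;> rfl
      homEquiv_naturality_right := fun f g => rfl }

/-- The one-point ordinal is initial. -/
def isInitial : IsInitial (MinSimplex.mk 0) :=
  IsInitial.ofUniqueHom (fun Y => ⟨⟨fun _ => 0, fun _ _ _ => le_rfl⟩, rfl⟩) (fun Y f => by
    refine Subtype.ext (OrderHom.ext _ _ (funext fun i => ?_))
    obtain rfl : i = 0 := Subsingleton.elim (α := Fin 1) _ _
    exact f.2)

end MinSimplex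

section Decalage
open MinSimplex
variable {k : Type u} [Field k]

/-- The adjunction between the restriction functors along `cons` and `forget`. -/
def pullConsAdj : pull (k := k) cons.op ⊣ pull (k := k) forget.op :=
  consAdj.op.whiskerLeft (ModuleCat.{u} k)

/-- By adjunction this is an `Ext` into the constant functor on `MinSimplexᵒᵖ`, which is injective
because the one-point ordinal becomes terminal. -/
theorem ext_pull_cons_eq_zero (G : FunCat MinSimplexᵒᵖ k) {n : ℕ}
    (y : Ext ((pull cons.op).obj G) (constFun SimplexCategoryᵒᵖ k) (n + 1)) : y = 0 := by
  have hI : Injective ((pull forget.op).obj (constFun SimplexCategoryᵒᵖ k)) :=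
    injective_constFun (terminalOpOfInitial MinSimplex.isInitial)
  have := Ext.subsingleton_of_injective G ((pull forget.op).obj (constFun SimplexCategoryᵒᵖ k)) n
  exact (extAdj_bijective pullConsAdj G (constFun SimplexCategoryᵒᵖ k) (n + 1)).1
    (Subsingleton.elim _ _)

/-- The complement in degree `0`: a map from a décalage to the constants sees only the restriction
to the one-point ordinal, that is, to the new least element. -/
theorem pull_cons_app_eq (G : FunCat MinSimplexᵒᵖ k)
    (h : (pull cons.op).obj G ⟶ constFun SimplexCategoryᵒᵖ k) (S : SimplexCategoryᵒᵖ) :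
    ∃ g : G.obj (Opposite.op ⟨0⟩) ⟶ ModuleCat.of k k,
      h.app S = G.map (MinSimplex.isInitial.to (cons.obj S.unop)).op ≫ g := by
  let h' := pullConsAdj.homEquiv _ _ h
  refine ⟨h'.app _, ?_⟩
  have e : h = (pull cons.op).map h' ≫ pullConsAdj.counit.app _ := by
    exact ((pullConsAdj.homEquiv _ _).symm_apply_apply h).symm.trans
      (pullConsAdj.homEquiv_counit (g := h'))
  have e' := app_eq_of_isTerminal (terminalOpOfInitial MinSimplex.isInitial) h' (cons.op.obj S)
  rw [e]
  refine Eq.trans ?_ e'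
  exact Category.comp_id _

variable (k) in
/-- The functor of functions, `S ↦ k^S`. -/
def fnFun : FunCat SimplexCategoryᵒᵖ k where
  obj S := ModuleCat.of k (Fin (S.unop.len + 1) → k)
  map φ := ModuleCat.ofHom (LinearMap.funLeft k k φ.unop.toOrderHom)

/-- Functions on `S` extend by zero to the ordinal with one more least element. -/
def fnExtend : fnFun k ⟶ cons.op ⋙ forget.op ⋙ fnFun k where
  app S := ModuleCat.ofHom
    { toFun := fun g => Fin.cases 0 g
      map_add' := fun g g' => funext fun i => by
        induction i using Fin.cases with
        | zero => exact (add_zero (0 : k)).symm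
        | succ i => rfl
      map_smul' := fun c g => funext fun i => by
        induction i using Fin.cases with
        | zero => exact (mul_zero c).symm
        | succ i => rfl }
  naturality S T φ := by
    refine ModuleCat.hom_ext (LinearMap.ext fun g => funext fun i => ?_)
    induction i using Fin.cases <;> rfl

/-- The natural map from the décalage of `F` to `F`. -/
def decalageMap (F : FunCat SimplexCategoryᵒᵖ k) : cons.op ⋙ forget.op ⋙ F ⟶ F :=
  Functor.whiskerRight (NatTrans.op consAdj.unit) F

theorem fnExtend_decalageMap : fnExtend ≫ decalageMap (fnFun k) = 𝟙 _ := by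
  refine NatTrans.ext (funext fun S => ModuleCat.hom_ext (LinearMap.ext
    fun (g : Fin (S.unop.len + 1) → k) => funext fun (i : Fin (S.unop.len + 1)) => ?_))
  have h : (consAdj.unit.app S.unop).toOrderHom i = i.succ := rfl
  exact congrArg (Fin.cases (motive := fun _ => k) 0 g) h

/-- Collapsing the new least element onto the old one splits the map at each `S`, by a triangle
identity. -/
instance (F : FunCat SimplexCategoryᵒᵖ k) : Epi (decalageMap F) := by
  have (S : SimplexCategoryᵒᵖ) : Epi ((decalageMap F).app S) := by
    have h : consAdj.unit.app (forget.obj ⟨S.unop.len⟩) ≫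
      forget.map (consAdj.counit.app ⟨S.unop.len⟩) = 𝟙 _ :=
        consAdj.right_triangle_components _
    have h' := congrArg (fun t => F.map t.op) h
    rw [op_comp, F.map_comp] at h'
    refine @epi_of_epi _ _ _ _ _ (F.map (forget.map (consAdj.counit.app ⟨S.unop.len⟩)).op) _ ?_
    refine (congrArg Epi (h'.trans (F.map_id _))).mpr ?_
    infer_instance
  exact NatTrans.epi_of_epi_app _

/-- Extension by zero makes `fnFun k ⊗ Dec F` a retract of `Dec (fnFun k ⊗ F)`, which settles
positive degrees. In degree `0` a map factors through the value at the new least element, where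
functions extended by zero vanish. -/
theorem ext_fnFun_tensor_decalage_eq_zero (F : FunCat SimplexCategoryᵒᵖ k) {n : ℕ}
    (y : Ext (fnFun k ⊗ (cons.op ⋙ forget.op ⋙ F)) (constFun SimplexCategoryᵒᵖ k) n) : y = 0 := by
  let i : fnFun k ⊗ (cons.op ⋙ forget.op ⋙ F) ⟶ cons.op ⋙ forget.op ⋙ (fnFun k ⊗ F) :=
    fnExtend ▷ (cons.op ⋙ forget.op ⋙ F)
  let r : cons.op ⋙ forget.op ⋙ (fnFun k ⊗ F) ⟶ fnFun k ⊗ (cons.op ⋙ forget.op ⋙ F) :=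
    decalageMap (fnFun k) ▷ (cons.op ⋙ forget.op ⋙ F)
  have hir : i ≫ r = 𝟙 _ := by
    refine (comp_whiskerRight _ _ _).symm.trans ?_
    rw [fnExtend_decalageMap, id_whiskerRight]
  have hy : y = (Ext.mk₀ i).comp ((Ext.mk₀ r).comp y (zero_add n)) (zero_add n) := by
    rw [Ext.mk₀_comp_mk₀_assoc, hir, Ext.mk₀_id_comp]
  cases n with
  | succ n =>
    rw [hy, ext_pull_cons_eq_zero (forget.op ⋙ (fnFun k ⊗ F)) ((Ext.mk₀ r).comp y (zero_add _)),
      Ext.comp_zero]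
  | zero =>
    obtain ⟨h, rfl⟩ := (Ext.mk₀_bijective _ _).2 y
    rw [hy, Ext.mk₀_comp_mk₀, Ext.mk₀_comp_mk₀, Ext.mk₀_eq_zero_iff]
    refine NatTrans.ext (funext fun S => ?_)
    obtain ⟨g, hg⟩ := pull_cons_app_eq (forget.op ⋙ (fnFun k ⊗ F)) (r ≫ h) S
    refine (congrArg (i.app S ≫ ·) hg).trans ?_
    refine (Category.assoc _ _ _).symm.trans ?_
    have h0 : i.app S ≫ (forget.op ⋙ (fnFun k ⊗ F)).map
        (MinSimplex.isInitial.to (cons.obj S.unop)).op = 0 := ?_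
    · exact (eq_whisker h0 g).trans zero_comp
    refine ModuleCat.hom_ext (TensorProduct.ext' fun (x : Fin (S.unop.len + 1) → k) y => ?_)
    exact (rfl : _ = (0 : Fin 1 → k) ⊗ₜ[k]
      F.map (forget.map (MinSimplex.isInitial.to (cons.obj S.unop))).op y).trans
        (TensorProduct.zero_tmul _ _)

/-- Dimension shifting along `Dec F → F`. The kernel is another arbitrary functor, hence the
induction for all `F` at once. -/
theorem ext_fnFun_tensor_eq_zero (F : FunCat SimplexCategoryᵒᵖ k) {n : ℕ}
    (y : Ext (fnFun k ⊗ F) (constFun SimplexCategoryᵒᵖ k) n) : y = 0 := by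
  induction n generalizing F with
  | zero =>
    obtain ⟨h, rfl⟩ := (Ext.mk₀_bijective _ _).2 y
    have := ext_fnFun_tensor_decalage_eq_zero F
      (Ext.mk₀ ((tensorLeft (fnFun k)).map (decalageMap F) ≫ h))
    rw [Ext.mk₀_eq_zero_iff] at this
    have h0 : h = 0 := (cancel_epi ((tensorLeft (fnFun k)).map (decalageMap F))).1
      (this.trans comp_zero.symm)
    rw [h0, Ext.mk₀_zero]
  | succ n ih =>
    let S := ShortComplex.mk _ _ (kernel.condition (decalageMap F))
    have hS : S.ShortExact := { exact := ShortComplex.exact_kernel _ }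
    have hS' := hS.map_of_exact (tensorLeft (fnFun k))
    obtain ⟨x, hx⟩ := Ext.contravariant_sequence_exact₃ hS' (constFun SimplexCategoryᵒᵖ k) y
      (ext_fnFun_tensor_decalage_eq_zero F _) (add_comm 1 n)
    exact hx.symm.trans ((congrArg (fun t => hS'.extClass.comp t (add_comm 1 n))
      (ih (kernel (decalageMap F)) x)).trans (Ext.comp_zero _ _ _ _ _))
end Decalage

/-! ### Sums over the fibres of a category of elements -/

section Elements
variable {Γ : Type} [SmallCategory Γ] {k : Type u} [Field k] {Φ : Γ ⥤ Type}

/-- The value of a functor on the category of elements, as a family indexed by the fibre. -/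
abbrev fibre (F : FunCat Φ.Elements k) (X : Γ) : Φ.obj X → ModuleCat.{u} k :=
  fun a => F.obj (Φ.elementsMk X a)

/-- The map of fibres induced by a map of the base. -/
abbrev fibreHom {X Y : Γ} (f : X ⟶ Y) (a : Φ.obj X) :
    Φ.elementsMk X a ⟶ Φ.elementsMk Y (Φ.map f a) := ⟨f, rfl⟩

/-- The end point of `g` equals `Φ.map g.1 x.2` only propositionally. This lemma absorbs the
transport, so that functoriality of the sum can be checked summand by summand. -/
theorem map_ι_eq (F : FunCat Φ.Elements k) {x y : Φ.Elements} (g : x ⟶ y) :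
    F.map g ≫ Sigma.ι (fibre F y.1) y.2 =
      F.map (fibreHom g.1 x.2) ≫ Sigma.ι (fibre F y.1) (Φ.map g.1 x.2) := by
  have aux (Y : Γ) (b : Φ.obj Y) (f : x.1 ⟶ Y) (h : Φ.map f x.2 = b) :
      F.map (show x ⟶ Φ.elementsMk Y b from ⟨f, h⟩) ≫ Sigma.ι (fibre F Y) b =
        F.map (fibreHom f x.2) ≫ Sigma.ι (fibre F Y) (Φ.map f x.2) := by
    subst h
    rfl
  exact aux y.1 y.2 g.1 g.2

variable (k Φ) in
/-- The sum over the fibres, the left adjoint of restriction to the category of elements. -/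
def elementsSum : FunCat Φ.Elements k ⥤ FunCat Γ k where
  obj F :=
    { obj := fun X => ∐ fibre F X
      map := fun {X Y} f => Sigma.desc fun a => F.map (fibreHom f a) ≫ Sigma.ι (fibre F Y) (Φ.map f a)
      map_id := fun X => Sigma.hom_ext _ _ fun a => by
        rw [Sigma.ι_desc, Category.comp_id]
        refine (map_ι_eq F (𝟙 (Φ.elementsMk X a))).symm.trans ?_
        rw [F.map_id, Category.id_comp]
      map_comp := fun {X Y Z} f g => Sigma.hom_ext _ _ fun a => by
        rw [Sigma.ι_desc, Sigma.ι_desc_assoc, Category.assoc, Sigma.ι_desc]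
        refine (map_ι_eq F (fibreHom f a ≫ fibreHom g (Φ.map f a))).symm.trans ?_
        rw [F.map_comp, Category.assoc] }
  map {F G} α :=
    { app := fun X => Limits.Sigma.map fun a => α.app (Φ.elementsMk X a)
      naturality := fun X Y f => Sigma.hom_ext _ _ fun a => by
        simp }
  map_id F := by
    ext X : 2
    exact Sigma.hom_ext _ _ fun a => by simp
  map_comp α β := by
    ext X : 2
    exact Sigma.hom_ext _ _ fun a => by simp

theorem ι_elementsSum_obj_map (F : FunCat Φ.Elements k) {X Y : Γ} (f : X ⟶ Y) (a : Φ.obj X) :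
    Sigma.ι (fibre F X) a ≫ ((elementsSum k Φ).obj F).map f =
      F.map (fibreHom f a) ≫ Sigma.ι (fibre F Y) (Φ.map f a) :=
  Sigma.ι_desc _ _

theorem ι_elementsSum_map_app {F G : FunCat Φ.Elements k} (α : F ⟶ G) (X : Γ) (a : Φ.obj X) :
    Sigma.ι (fibre F X) a ≫ ((elementsSum k Φ).map α).app X =
      α.app (Φ.elementsMk X a) ≫ Sigma.ι (fibre G X) a :=
  ι_colimMap _ _

/-- The sum over the fibres is left adjoint to restriction to the category of elements. -/
def elementsSumAdj : elementsSum k Φ ⊣ pull (CategoryOfElements.π Φ) :=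
  Adjunction.mkOfHomEquiv
    { homEquiv := fun F G =>
        { toFun := fun h =>
            { app := fun x => Sigma.ι (fibre F x.1) x.2 ≫ h.app x.1
              naturality := fun x y g => by
                have h1 := h.naturality g.1
                have h2 := congrArg (Sigma.ι (fibre F x.1) x.2 ≫ ·) h1
                refine Eq.trans ?_ (h2.trans (Category.assoc _ _ _).symm)
                refine (Category.assoc _ _ _).symm.trans
                  ((congrArg (· ≫ h.app y.1) (map_ι_eq F g)).trans ?_)
                refine Eq.trans ?_ (Category.assoc _ _ _)
                exact congrArg (· ≫ h.app y.1) (ι_elementsSum_obj_map F g.1 x.2).symm }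
          invFun := fun g =>
            { app := fun X => Sigma.desc fun a => g.app (Φ.elementsMk X a)
              naturality := fun X Y f => Sigma.hom_ext _ _ fun a => by
                refine (Category.assoc _ _ _).symm.trans
                  ((congrArg (· ≫ _) (Sigma.ι_desc _ _)).trans ?_)
                refine (Category.assoc _ _ _).trans
                  ((whisker_eq (F.map (fibreHom f a)) (?_ : _ = g.app (Φ.elementsMk Y (Φ.map f a)))).trans ?_)
                · exact Sigma.ι_desc _ _
                refine (g.naturality (fibreHom f a)).trans ?_
                refine Eq.trans ?_ (Category.assoc _ _ _)
                refine eq_whisker (Eq.symm ?_) (G.map f)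
                exact Sigma.ι_desc _ _ }
          left_inv := fun h => by
            ext X : 2
            exact Sigma.hom_ext _ _ fun a => Sigma.ι_desc _ _
          right_inv := fun g => by
            ext X : 2
            exact Sigma.ι_desc _ _ }
      homEquiv_naturality_left_symm := fun f g => by
        refine NatTrans.ext (funext fun X => Sigma.hom_ext _ _ fun a => ?_)
        refine (Sigma.ι_desc _ _).trans ?_
        refine Eq.trans ?_ (Category.assoc _ _ _)
        refine Eq.trans ?_ (eq_whisker (ι_elementsSum_map_app f X a).symm _)
        refine Eq.trans ?_ (Category.assoc _ _ _).symm
        refine whisker_eq (f.app (Φ.elementsMk X a)) (Eq.symm ?_)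
        exact Sigma.ι_desc _ _
      homEquiv_naturality_right := fun f g => by
        refine NatTrans.ext (funext fun X => ?_)
        exact (Category.assoc _ _ _).symm }

theorem elementsSumAdj_homEquiv_app {F : FunCat Φ.Elements k} {G : FunCat Γ k}
    (h : (elementsSum k Φ).obj F ⟶ G) (x : Φ.Elements) :
    (elementsSumAdj.homEquiv F G h).app x = Sigma.ι (fibre F x.1) x.2 ≫ h.app x.1 := by
  simp only [elementsSumAdj, Adjunction.mkOfHomEquiv_homEquiv]
  rfl

instance : (elementsSum k Φ).Additive where
  map_add {F G f g} := by
    refine NatTrans.ext (funext fun X => Sigma.hom_ext _ _ fun a => ?_)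
    refine (ι_elementsSum_map_app (f + g) X a).trans ?_
    refine Eq.trans ?_ (Preadditive.comp_add _ _ _ _ _ _).symm
    refine (Preadditive.add_comp _ _ _ _ _ _).trans ?_
    exact congrArg₂ (· + ·) (ι_elementsSum_map_app f X a).symm
      (ι_elementsSum_map_app g X a).symm

instance : PreservesFiniteColimits (elementsSum k Φ) := by
  have := elementsSumAdj (Φ := Φ) (k := k).leftAdjoint_preservesColimits
  infer_instance

/-- The fibre of the category of elements. -/
def fibreInclusion (X : Γ) : Discrete (Φ.obj X) ⥤ Φ.Elements :=
  Discrete.functor fun a => Φ.elementsMk X a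

/-- At each object the functor is a colimit over a discrete category, and direct sums of vector
spaces are exact. -/
instance : PreservesFiniteLimits (elementsSum k Φ) :=
  preservesFiniteLimits_of_evaluation _ fun X => by
    have e : pull (fibreInclusion X) ⋙ colim ≅
        elementsSum k Φ ⋙ (evaluation Γ (ModuleCat.{u} k)).obj X :=
      NatIso.ofComponents (fun F => HasColimit.isoOfNatIso (Discrete.natIso fun a => Iso.refl _))
        (fun f => colimit.hom_ext fun a => by
          have h1 (F : FunCat Φ.Elements k) : colimit.ι (fibreInclusion X ⋙ F) a ≫
              (HasColimit.isoOfNatIso (Discrete.natIso fun a => Iso.refl _) :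
                colimit (fibreInclusion X ⋙ F) ≅ ∐ fibre F X).hom = Sigma.ι (fibre F X) a.as := by
            exact (HasColimit.isoOfNatIso_ι_hom _ _).trans (Category.id_comp _)
          refine (Category.assoc _ _ _).symm.trans
            ((congrArg (· ≫ _) (ι_colimMap _ _)).trans ?_)
          refine (Category.assoc _ _ _).trans ((whisker_eq _ (h1 _)).trans ?_)
          refine Eq.trans ?_ ((eq_whisker (h1 _) _).symm.trans (Category.assoc _ _ _))
          exact (ι_elementsSum_map_app f X a.as).symm)
    exact preservesFiniteLimits_of_natIso e

/-- The map from a direct sum of copies of `M` to `M ⊗ k[I]`. -/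
def copiesToTensor (M : ModuleCat.{u} k) (I : Type) :
    (∐ fun _ : I => M) ⟶ ModuleCat.of k (TensorProduct k M (I →₀ k)) :=
  Sigma.desc fun i => ModuleCat.ofHom ((TensorProduct.mk k M (I →₀ k)).flip (Finsupp.single i 1))

instance isIso_copiesToTensor (M : ModuleCat.{u} k) (I : Type) : IsIso (copiesToTensor M I) := by
  let g : ModuleCat.of k (TensorProduct k M (I →₀ k)) ⟶ ∐ fun _ : I => M :=
    ModuleCat.ofHom (TensorProduct.lift (Finsupp.linearCombination k
      fun i : I => (Sigma.ι (fun _ : I => M) i).hom).flip)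
  refine ⟨g, Sigma.hom_ext _ _ fun i => ?_, ?_⟩
  · rw [copiesToTensor, Sigma.ι_desc_assoc, Category.comp_id]
    refine ModuleCat.hom_ext (LinearMap.ext fun x => ?_)
    simp [g]
  · refine ModuleCat.hom_ext (TensorProduct.ext (LinearMap.ext fun x => Finsupp.lhom_ext' fun i =>
      LinearMap.ext_ring ?_))
    have h := congrArg (fun t => t.hom x) (Sigma.ι_desc (f := fun _ : I => M) (fun i => ModuleCat.ofHom
      ((TensorProduct.mk k M (I →₀ k)).flip (Finsupp.single i 1))) i)
    have h2 : g.hom (x ⊗ₜ Finsupp.single i 1) = Sigma.ι (fun _ : I => M) i x := by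
      simp [g]
    refine (congrArg (copiesToTensor M I).hom h2).trans h
end Elements

/-! ### `Δᵒᵖ` as the category of elements of the marked points -/

namespace Lambda

theorem cast_lift_cast (q : ℕ) {n m : ℕ+} (f : LiftHom n m) (a : ℤ) :
    ((f (((a : ZMod (q * n)).cast : ℤ)) : ℤ) : ZMod (q * m)) = (f a : ZMod (q * m)) := by
  obtain ⟨c, hc⟩ := exists_cast_eq (q * n) a
  rw [hc, lift_add_mul, Int.cast_add, Int.cast_mul, Int.cast_natCast, ZMod.natCast_self, mul_zero,
    add_zero]

/-- The functor of marked points, `[n] ↦ ℤ/qn`. -/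
def points (q : ℕ) : Lambda q ⥤ Type where
  obj X := ZMod (q * X.card)
  map {X Y} := Quotient.lift (s := LiftHom.setoid q X.card Y.card)
    (fun f => TypeCat.ofHom fun x : ZMod (q * X.card) => (f (x.cast : ℤ) : ZMod (q * Y.card)))
    (fun f g ⟨c, h⟩ => by
      congr 1
      funext x
      rw [h, mul_assoc, Int.cast_add, Int.cast_mul]
      have : (((q : ℤ) * ((Y.card : ℕ) : ℤ) : ℤ) : ZMod (q * Y.card)) = 0 := by
        exact_mod_cast ZMod.natCast_self (q * Y.card)
      rw [this, mul_zero, add_zero])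
  map_id X := ConcreteCategory.hom_ext _ _ fun x => ZMod.intCast_zmod_cast x
  map_comp := by
    rintro X Y Z ⟨f⟩ ⟨g⟩
    exact ConcreteCategory.hom_ext _ _ fun x => (cast_lift_cast q g _).symm

theorem points_map_homMk {q : ℕ} {X Y : Lambda q} (f : LiftHom X.card Y.card) (a : ℤ) :
    (points q).map (homMk f) (a : ZMod (q * X.card)) = (f a : ZMod (q * Y.card)) :=
  cast_lift_cast q f a

theorem periodicExt_nonneg_iff {S T : SimplexCategory} (φ : S ⟶ T) (b : ℤ) :
    0 ≤ periodicExt φ b ↔ 0 ≤ b := by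
  obtain ⟨c, r, rfl⟩ := exists_rep S b
  rw [periodicExt_apply]
  have hr : ((r : ℕ) : ℤ) < S.len + 1 := by exact_mod_cast r.2
  have ht : ((φ.toOrderHom r : ℕ) : ℤ) < T.len + 1 := by exact_mod_cast (φ.toOrderHom r).2
  have key (t v : ℤ) (hv : 0 ≤ v) (hvt : v < t) : 0 ≤ c * t + v ↔ 0 ≤ c := by
    constructor
    · intro h
      by_contra hc
      nlinarith
    · intro h
      nlinarith
  rw [key _ _ (by positivity) ht, key _ _ (by positivity) hr]

theorem dualFun_zero {S T : SimplexCategory} (φ : S ⟶ T) : dualFun φ 0 = 0 :=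
  eq_of_forall_ge_iff fun b => by rw [dualFun_gc, periodicExt_nonneg_iff]

theorem dualHom_injective {S T : SimplexCategory} {φ ψ : S ⟶ T} (h : dualHom φ = dualHom ψ) :
    φ = ψ := by
  have hp (b : ℤ) : periodicExt φ b = periodicExt ψ b := by
    refine eq_of_forall_le_iff fun a => ?_
    rw [← dualFun_gc, ← dualFun_gc]
    exact iff_of_eq (congrArg (fun t : LiftHom _ _ => t a ≤ b) h)
  refine SimplexCategory.Hom.ext _ _ (OrderHom.ext _ _ (funext fun r => Fin.ext ?_))
  have := hp (0 * (S.len + 1) + (r : ℕ))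
  rw [periodicExt_apply, periodicExt_apply] at this
  omega

/-- The map `φ` is the right adjoint of `f`, with `φ(r)` the greatest `a` such that `f(a) ≤ r`. The
values of `f` at `0` and at one period force `0 ≤ φ(r) ≤ T.len`. -/
theorem exists_dualHom_eq {S T : SimplexCategory} (f : LiftHom (simplexCard T) (simplexCard S))
    (h0 : f 0 = 0) : ∃ φ : S ⟶ T, dualHom φ = f := by
  have hT : ((simplexCard T : ℕ) : ℤ) = T.len + 1 := by simp [simplexCard]
  have hS : ((simplexCard S : ℕ) : ℤ) = S.len + 1 := by simp [simplexCard]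
  have ht : f (T.len + 1) = S.len + 1 := by
    have := f.map_add' 0
    rwa [h0, zero_add, zero_add, hT, hS] at this
  have key (r : Fin (S.len + 1)) : ∃ a : Fin (T.len + 1), ∀ a' : ℤ, f a' ≤ (r : ℕ) ↔ a' ≤ (a : ℕ) := by
    have hr : ((r : ℕ) : ℤ) < S.len + 1 := by exact_mod_cast r.2
    have hb (a : ℤ) (ha : f a ≤ (r : ℕ)) : a ≤ T.len := by
      by_contra hlt
      have := f.monotone' (show (T.len + 1 : ℤ) ≤ a by omega)
      have : f (T.len + 1) ≤ f a := this
      omega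
    obtain ⟨a, ha, ha'⟩ := Int.exists_greatest_of_bdd (P := fun a => f a ≤ (r : ℕ)) ⟨_, hb⟩
      ⟨0, by rw [h0]; positivity⟩
    have ha0 : 0 ≤ a := ha' 0 (by rw [h0]; positivity)
    refine ⟨⟨a.toNat, by have := hb a ha; omega⟩, fun a' => ?_⟩
    rw [show ((a.toNat : ℕ) : ℤ) = a by omega]
    exact ⟨ha' a', fun h => (f.monotone' h).trans ha⟩
  choose g hg using key
  refine ⟨SimplexCategory.mkHom ⟨g, fun r r' h => ?_⟩, ?_⟩
  · have h1 := (hg r (g r : ℕ)).2 le_rfl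
    have h2 := (hg r' (g r : ℕ)).1 (h1.trans (by exact_mod_cast h))
    exact_mod_cast h2
  · ext a
    refine eq_of_forall_ge_iff fun b => ?_
    refine (dualFun_gc _ a b).trans ?_
    obtain ⟨c, r, rfl⟩ := exists_rep S b
    rw [periodicExt_apply]
    have h1 := f.map_add_mul a (-c)
    rw [hT, hS] at h1
    have h2 := hg r (a + -c * (T.len + 1))
    refine Iff.trans ?_ (h2.symm.trans ?_)
    · change a ≤ c * (T.len + 1) + (g r : ℕ) ↔ _
      constructor <;> intro h <;> linarith
    · rw [h1]
      constructor <;> intro h <;> linarith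

/-- The lift of the embedding `j` to the category of elements of the functor of marked points. -/
def jLift (q : ℕ) : SimplexCategoryᵒᵖ ⥤ (points q).Elements where
  obj S := (points q).elementsMk ((j q).obj S) (0 : ZMod _)
  map {S T} f := ⟨(j q).map f, by
    have := points_map_homMk (q := q) (X := (j q).obj S) (Y := (j q).obj T) (dualHom f.unop) 0
    rw [Int.cast_zero] at this
    refine this.trans ?_
    refine (congrArg (fun t : ℤ => (t : ZMod (q * ((j q).obj T).card))) (dualFun_zero f.unop)).trans ?_
    exact Int.cast_zero⟩
  map_id S := CategoryOfElements.ext _ _ _ ((j q).map_id S)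
  map_comp f g := CategoryOfElements.ext _ _ _ ((j q).map_comp f g)

/-- Both lifts fix `0`, so the translation by a power of `σ^q` that relates them is zero. -/
instance (q : ℕ) : (jLift q).Faithful where
  map_injective {S T f g} h := by
    have h1 : (j q).map f = (j q).map g := congrArg Subtype.val h
    obtain ⟨c, hc⟩ := Quotient.exact h1
    refine Quiver.Hom.unop_inj (dualHom_injective (LiftHom.ext (funext fun a => ?_)))
    have h0 : dualFun g.unop 0 = dualFun f.unop 0 + c * q * (simplexCard T.unop : ℕ) := hc 0
    rw [dualFun_zero, dualFun_zero] at h0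
    have ha : dualFun g.unop a = dualFun f.unop a + c * q * (simplexCard T.unop : ℕ) := hc a
    change dualFun f.unop a = dualFun g.unop a
    linarith

instance (q : ℕ) : (jLift q).Full where
  map_surjective {S T} := by
    rintro ⟨⟨f⟩, hf⟩
    have h0 : ((f 0 : ℤ) : ZMod (q * (simplexCard T.unop : ℕ))) = 0 := by
      have := points_map_homMk (q := q) (X := (j q).obj S) (Y := (j q).obj T) f 0
      rw [Int.cast_zero] at this
      exact this.symm.trans hf
    rw [ZMod.intCast_zmod_eq_zero_iff_dvd] at h0
    obtain ⟨c, hc⟩ := h0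
    -- A map that preserves the marked point `0` sends `0` to a multiple of `q` periods; this
    -- multiple is removed by a power of `σ^q`.
    let f' : LiftHom (simplexCard S.unop) (simplexCard T.unop) :=
      ⟨fun a => f a + -c * q * (simplexCard T.unop : ℕ), fun a b h => by
        have := f.monotone' h
        change f a + _ ≤ f b + _
        have : f a ≤ f b := this
        linarith, fun a => by
        have : f (a + (simplexCard S.unop : ℕ)) = f a + (simplexCard T.unop : ℕ) := f.map_add' a
        change f (a + (simplexCard S.unop : ℕ)) + _ = f a + _ + _
        rw [this]; ring⟩
    obtain ⟨φ, hφ⟩ := exists_dualHom_eq f' (by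
      change f 0 + -c * q * (simplexCard T.unop : ℕ) = 0
      rw [hc]; push_cast; ring)
    refine ⟨φ.op, CategoryOfElements.ext _ _ _ ?_⟩
    refine (congrArg (homMk (p := q) (X := (j q).obj S) (Y := (j q).obj T)) hφ).trans ?_
    exact Quotient.sound ⟨c, fun a => by 
      change f a = f a + -c * q * (simplexCard T.unop : ℕ) + c * q * (simplexCard T.unop : ℕ)
      ring⟩

/-- The rotation of `[n]` by `a`. -/
def rotate (n : ℕ+) (a : ℤ) : LiftHom n n :=
  ⟨fun x => x + a, fun _ _ h => by simpa using h, fun x => by ring⟩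

/-- Rotations are isomorphisms. -/
def rotateIso {q : ℕ} (X : Lambda q) (a : ℤ) : X ≅ X where
  hom := homMk (rotate X.card a)
  inv := homMk (rotate X.card (-a))
  hom_inv_id := congrArg (homMk (p := q)) (LiftHom.ext (funext fun x => by
    change x + a + -a = x; ring))
  inv_hom_id := congrArg (homMk (p := q)) (LiftHom.ext (funext fun x => by
    change x + -a + a = x; ring))

/-- A rotation moves the marked point `0` to any other one. -/
instance (q : ℕ) : (jLift q).EssSurj where
  mem_essImage := by
    rintro ⟨⟨⟨n, hn⟩⟩, a⟩
    obtain ⟨n, rfl⟩ := Nat.exists_eq_succ_of_ne_zero hn.ne'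
    obtain ⟨b, rfl⟩ := ZMod.intCast_surjective a
    let X : Lambda q := (j q).obj (Opposite.op (SimplexCategory.mk n))
    refine ⟨Opposite.op (SimplexCategory.mk n), ⟨CategoryOfElements.isoMk _ _ (rotateIso X b) ?_⟩⟩
    have := points_map_homMk (rotate X.card b) 0
    rw [Int.cast_zero] at this
    refine this.trans ?_
    exact congrArg (fun t : ℤ => (t : ZMod (q * X.card))) (zero_add b)

instance (q : ℕ) : (jLift q).IsEquivalence where

end Lambda

/-! ### The exact left adjoint `j_!` and the Shapiro-type lemma -/

section JShriek
open Lambda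
variable {k : Type u} [Field k] {q : ℕ}

theorem pointFun_map_single {X Y : Lambda q} (f : X ⟶ Y) (x : ZMod (q * X.card)) :
    (pointFun k q).map f (Finsupp.single x 1 : ZMod (q * X.card) →₀ k) =
      (Finsupp.single ((points q).map f x : ZMod (q * Y.card)) 1 : ZMod (q * Y.card) →₀ k) := by
  obtain ⟨f, rfl⟩ := Quotient.exists_rep f
  obtain ⟨a, rfl⟩ := ZMod.intCast_surjective x
  refine (pointMap_single q f a).trans ?_
  exact congrArg (fun t => Finsupp.single t (1 : k)) (points_map_homMk f a).symm

/-- The map `x ↦ x ⊗ v_a` over a marked point `a`. -/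
def elementsVertex (A : FunCat (Lambda q) k) :
    (pull (CategoryOfElements.π (points q))).obj A ⟶
      (pull (CategoryOfElements.π (points q))).obj (A ⊗ pointFun k q) where
  app x := ModuleCat.ofHom ((TensorProduct.mk k (A.obj x.1) (ZMod (q * x.1.card) →₀ k)).flip
    (Finsupp.single (show ZMod (q * x.1.card) from x.2) 1))
  naturality x y f := by
    refine ModuleCat.hom_ext (LinearMap.ext fun a => ?_)
    have h := pointFun_map_single (k := k) f.1 x.2
    rw [f.2] at h
    exact congrArg (fun t : ZMod (q * y.1.card) →₀ k => A.map f.1 a ⊗ₜ[k] t) h.symm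

/-- The sum over the marked points of a restricted functor is a tensor product. -/
def elementsTensorHom (A : FunCat (Lambda q) k) :
    (elementsSum k (points q)).obj ((pull (CategoryOfElements.π (points q))).obj A) ⟶
      A ⊗ pointFun k q :=
  (elementsSumAdj.homEquiv _ _).symm (elementsVertex A)

instance (A : FunCat (Lambda q) k) : IsIso (elementsTensorHom A) := by
  have (X : Lambda q) : IsIso ((elementsTensorHom A).app X) := by
    have h : (elementsTensorHom A).app X = copiesToTensor (A.obj X) (ZMod (q * X.card)) := by
      refine Sigma.hom_ext _ _ fun a => ?_
      have h1 := elementsSumAdj_homEquiv_app (elementsTensorHom A) ((points q).elementsMk X a)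
      rw [elementsTensorHom, Equiv.apply_symm_apply] at h1
      refine h1.symm.trans ?_
      refine Eq.symm ?_
      exact Sigma.ι_desc _ _
    exact (congrArg (fun t => IsIso t) h).mpr (isIso_copiesToTensor _ _)
  exact NatIso.isIso_of_isIso_app _

variable (k q) in
/-- The left adjoint `j_!` of the restriction along `j`. -/
def jShriek : FunCat SimplexCategoryᵒᵖ k ⥤ FunCat (Lambda q) k :=
  pull (jLift q).inv ⋙ elementsSum k (points q)

instance : (jShriek k q).Additive := inferInstanceAs (_ ⋙ _).Additive
instance : PreservesFiniteLimits (jShriek k q) := comp_preservesFiniteLimits _ _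
instance : PreservesFiniteColimits (jShriek k q) := comp_preservesFiniteColimits _ _

/-- The adjunction between the restriction functors along the equivalence `jLift`. -/
def jLiftAdj : pull (k := k) (jLift q).inv ⊣ pull (k := k) (jLift q) :=
  (jLift q).asEquivalence.toAdjunction.whiskerLeft (ModuleCat.{u} k)

theorem isIso_jLiftAdj_counit_app (B : FunCat (points q).Elements k) : IsIso (jLiftAdj.counit.app B) := by
  have (x : (points q).Elements) : IsIso ((jLiftAdj.counit.app B).app x) := by
    refine (inferInstance : IsIso (B.map ((jLift q).asEquivalence.counitIso.hom.app x)))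
  exact NatIso.isIso_of_isIso_app _

/-- The adjunction `j_! ⊣ j^*`. -/
def jShriekAdj : jShriek k q ⊣ pull (j q) := jLiftAdj.comp elementsSumAdj

/-- The map `x ↦ x ⊗ v_0`. -/
def vertex (A : FunCat (Lambda q) k) :
    (pull (j q)).obj A ⟶ (pull (j q)).obj (A ⊗ pointFun k q) :=
  (pull (jLift q)).map (elementsVertex A)

/-- The isomorphism `j_! j^* A ≅ A ⊗ j_! k`. -/
def jShriekIso (A : FunCat (Lambda q) k) :
    (jShriek k q).obj ((pull (j q)).obj A) ≅ A ⊗ pointFun k q :=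
  (elementsSum k (points q)).mapIso
    (@asIso _ _ _ _ _ (isIso_jLiftAdj_counit_app
      ((pull (CategoryOfElements.π (points q))).obj A))) ≪≫
    asIso (elementsTensorHom A)

/-- Makes the unit explicit as `x ↦ x ⊗ v_0`, so that the comparisons over `Λ_p` and over `Λ` can be
matched. -/
theorem jShriekAdj_homEquiv_jShriekIso (A : FunCat (Lambda q) k) :
    jShriekAdj.unit.app ((pull (j q)).obj A) ≫ (pull (j q)).map (jShriekIso A).hom = vertex A := by
  let B := (pull (CategoryOfElements.π (points q))).obj A
  have h1 : elementsSumAdj.homEquiv _ _ ((elementsSum k (points q)).map (jLiftAdj.counit.app B) ≫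
      elementsTensorHom A) = jLiftAdj.counit.app B ≫ elementsVertex A := by
    rw [Adjunction.homEquiv_naturality_left]
    exact whisker_eq _ (Equiv.apply_symm_apply _ _)
  have h2 : jLiftAdj.homEquiv _ _ (jLiftAdj.counit.app B ≫ elementsVertex A) = vertex A := by
    rw [Adjunction.homEquiv_naturality_right]
    refine (eq_whisker (?_ : _ = 𝟙 _) _).trans (Category.id_comp _)
    exact (jLiftAdj.homEquiv_unit _ _ _).trans (jLiftAdj.right_triangle_components B)
  refine Eq.trans ?_ ((congrArg (jLiftAdj.homEquiv _ _) h1).trans h2)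
  refine (jShriekAdj.homEquiv_unit _ _ _).symm.trans ?_
  exact congrFun (congrArg DFunLike.coe (congrFun (congrFun
    (Adjunction.comp_homEquiv jLiftAdj (elementsSumAdj (k := k) (Φ := points q))) _) _)) _

/-- The comparison map `Ext(A ⊗ j_! k, B) ⟶ Ext(j^* A, j^* B)`. -/
def extVertex {A B : FunCat (Lambda q) k} {n : ℕ} (y : Ext (A ⊗ pointFun k q) B n) :
    Ext ((pull (j q)).obj A) ((pull (j q)).obj B) n :=
  (Ext.mk₀ (vertex A)).comp (y.mapExactFunctor (pull (j q))) (zero_add n)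

/-- It is the adjunction bijection for `j_! ⊣ j^*` after `j_! j^* A ≅ A ⊗ j_! k`; both functors are
exact. -/
theorem extVertex_bijective (A B : FunCat (Lambda q) k) (n : ℕ) :
    Function.Bijective (extVertex (A := A) (B := B) (n := n)) := by
  have h : extVertex (A := A) (B := B) (n := n) =
      extAdj jShriekAdj ∘ fun y => (Ext.mk₀ (jShriekIso A).hom).comp y (zero_add n) := by
    funext y
    dsimp only [extVertex, extAdj, Function.comp]
    rw [Ext.mapExactFunctor_comp, Ext.mapExactFunctor_mk₀, Ext.mk₀_comp_mk₀_assoc,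
      jShriekAdj_homEquiv_jShriekIso]
  rw [h]
  refine (extAdj_bijective jShriekAdj _ B n).comp (Function.bijective_iff_has_inverse.2
    ⟨fun y => (Ext.mk₀ (jShriekIso A).inv).comp y (zero_add n), fun y => ?_, fun y => ?_⟩)
  · simp
  · simp

end JShriek

/-! ### Acyclicity over `Λ_q` from acyclicity over `Δᵒᵖ` -/

section Vanishing
open Lambda

section General
variable {Γ : Type} [SmallCategory Γ] {k : Type u} [Field k]

theorem ext_eq_zero_of_iso {X Y Z : FunCat Γ k} (e : X ≅ Y) {n : ℕ} (h : ∀ y : Ext Y Z n, y = 0)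
    (x : Ext X Z n) : x = 0 := by
  have hx : x = (Ext.mk₀ e.hom).comp ((Ext.mk₀ e.inv).comp x (zero_add n)) (zero_add n) := by
    simp
  rw [hx, h ((Ext.mk₀ e.inv).comp x (zero_add n)), Ext.comp_zero]

theorem ext_eq_zero_of_shortExact {S : ShortComplex (FunCat Γ k)} (hS : S.ShortExact)
    {Z : FunCat Γ k} {n : ℕ} (y : Ext S.X₃ Z n)
    (hy : (Ext.mk₀ S.g).comp y (zero_add n) = 0)
    (h : ∀ m, 1 + m = n → ∀ z : Ext S.X₁ Z m, z = 0) : y = 0 := by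
  cases n with
  | zero =>
    obtain ⟨f, rfl⟩ := (Ext.mk₀_bijective _ _).2 y
    rw [Ext.mk₀_comp_mk₀, Ext.mk₀_eq_zero_iff] at hy
    have := hS.epi_g
    rw [(cancel_epi S.g).1 (hy.trans comp_zero.symm), Ext.mk₀_zero]
  | succ n =>
    obtain ⟨x, hx⟩ := Ext.contravariant_sequence_exact₃ hS Z y hy (add_comm 1 n)
    rw [← hx, h n (add_comm 1 n) x, Ext.comp_zero]

end General

variable {k : Type u} [Field k] {q : ℕ}

/-- Passing to `Δᵒᵖ` leaves `Ext(j^*A ⊗ j^*W, k)`, whose first argument has `S ↦ k^S` as a tensor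
factor. -/
theorem ext_tensor_pointFun_eq_zero {W : FunCat (Lambda q) k} {N : FunCat SimplexCategoryᵒᵖ k}
    (e : (pull (j q)).obj W ≅ fnFun k ⊗ N) (A : FunCat (Lambda q) k) {n : ℕ}
    (y : Ext ((A ⊗ W) ⊗ pointFun k q) (constFun (Lambda q) k) n) : y = 0 := by
  apply (extVertex_bijective _ _ _).1
  refine Eq.trans ?_ (?_ : extVertex 0 = 0).symm
  · let e' : (pull (j q)).obj (A ⊗ W) ≅ fnFun k ⊗ (N ⊗ (pull (j q)).obj A) :=
      (β_ ((pull (j q)).obj A) ((pull (j q)).obj W)) ≪≫ whiskerRightIso e _ ≪≫ α_ _ _ _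
    exact ext_eq_zero_of_iso e' (fun z => ext_fnFun_tensor_eq_zero _ z) _
  · dsimp only [extVertex]
    exact (congrArg (fun t => Ext.comp _ t _) ((pull (j q)).mapExtAddHom _ _ n).map_zero).trans
      (Ext.comp_zero _ _ _ _ _)

/-- The vanishing on `(A ⊗ W) ⊗ j_! k` moves a class to degree `n - 1` on `(A ⊗ W) ⊗ Z`. There the
middle term is `(A ⊗ j^o_* k) ⊗ W`, covered by the induction with `A` changed, so the class moves on
to degree `n - 2` on `A ⊗ W`. -/
theorem ext_tensor_eq_zero [NeZero q] {W : FunCat (Lambda q) k} {N : FunCat SimplexCategoryᵒᵖ k}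
    (e : (pull (j q)).obj W ≅ fnFun k ⊗ N) (A : FunCat (Lambda q) k) {n : ℕ}
    (y : Ext (A ⊗ W) (constFun (Lambda q) k) n) : y = 0 := by
  induction n using Nat.strong_induction_on generalizing A with
  | _ n ih =>
  have hr := (rightSeq_shortExact k q).map_of_exact (tensorLeft (A ⊗ W))
  have hl := (leftSeq_shortExact k q).map_of_exact (tensorLeft (A ⊗ W))
  refine ext_eq_zero_of_iso (unitorIso (A ⊗ W)).symm (fun y => ?_) y
  refine ext_eq_zero_of_shortExact hr y (ext_tensor_pointFun_eq_zero e A _) fun m hm z => ?_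
  let e' : (A ⊗ W) ⊗ edgeFun k q ≅ (A ⊗ edgeFun k q) ⊗ W :=
    α_ _ _ _ ≪≫ whiskerLeftIso A (β_ W (edgeFun k q)) ≪≫ (α_ _ _ _).symm
  refine ext_eq_zero_of_shortExact hl z
    (ext_eq_zero_of_iso e' (fun t => ih m (by omega) _ t) _) fun l hlm w => ?_
  exact ext_eq_zero_of_iso (unitorIso (A ⊗ W)) (fun t => ih l (by omega) _ t) w

end Vanishing

/-! ### The functor `j^o_* k` restricted to `Δᵒᵖ` -/

section EdgeFun
open Lambda
variable (k : Type u) [Field k] (q : ℕ)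

/-- The map `g ⊗ c ↦ ∑ g(r) e_{cs + r}`. -/
def fnToEdge (s : ℕ) :
    TensorProduct k (Fin (s + 1) → k) (ZMod q →₀ k) →ₗ[k] (ZMod (q * (s + 1)) →₀ k) :=
  TensorProduct.lift (LinearMap.flip (Finsupp.linearCombination k fun c : ZMod q =>
    Fintype.linearCombination k fun r : Fin (s + 1) =>
      (Finsupp.single (((c.cast : ℤ) * (s + 1) + (r : ℕ) : ℤ) : ZMod (q * (s + 1))) (1 : k))))

variable {k q}

theorem fnToEdge_tmul (s : ℕ) (g : Fin (s + 1) → k) (c : ZMod q) :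
    fnToEdge k q s (g ⊗ₜ Finsupp.single c 1) = ∑ r, g r • Finsupp.single
      (((c.cast : ℤ) * (s + 1) + (r : ℕ) : ℤ) : ZMod (q * (s + 1))) (1 : k) := by
  simp [fnToEdge, Fintype.linearCombination_apply]

/-- Division with remainder gives surjectivity, and both sides have dimension `q (s + 1)`. -/
theorem fnToEdge_bijective [NeZero q] (s : ℕ) : Function.Bijective (fnToEdge k q s) := by
  have hs : Function.Surjective (fnToEdge k q s) := by
    rw [← LinearMap.range_eq_top, eq_top_iff]
    intro f _
    induction f using Finsupp.induction_linear with
    | zero => exact zero_mem _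
    | add f g hf hg => exact add_mem (hf trivial) (hg trivial)
    | single y b =>
      have hb : (Finsupp.single y b : ZMod (q * (s + 1)) →₀ k) = b • Finsupp.single y 1 := by simp
      rw [hb]
      refine Submodule.smul_mem _ _ ?_
      obtain ⟨a, rfl⟩ := ZMod.intCast_surjective y
      obtain ⟨c, r, rfl⟩ := exists_rep (SimplexCategory.mk s) a
      refine ⟨(Pi.single r 1 : Fin (s + 1) → k) ⊗ₜ Finsupp.single (c : ZMod q) 1, ?_⟩
      rw [fnToEdge_tmul, Finset.sum_eq_single r]
      · obtain ⟨d, hd⟩ := exists_cast_eq q c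
        rw [Pi.single_eq_same, one_smul, hd]
        congr 1
        rw [ZMod.intCast_eq_intCast_iff_dvd_sub]
        exact ⟨-d, by simp only [SimplexCategory.len_mk]; push_cast; ring⟩
      · intro r' _ hr'
        rw [Pi.single_eq_of_ne hr', zero_smul]
      · simp
  refine ⟨?_, hs⟩
  refine (LinearMap.injective_iff_surjective_of_finrank_eq_finrank ?_).2 hs
  have : NeZero (q * (s + 1)) := ⟨mul_ne_zero (NeZero.ne q) (by omega)⟩
  rw [Module.finrank_tensorProduct, Module.finrank_fintype_fun_eq_card, Module.finrank_finsupp_self,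
    Module.finrank_finsupp_self, Fintype.card_fin, ZMod.card, ZMod.card, mul_comm]

/-- By the Galois connection, the path that is the image of edge `r` consists of exactly those edges
that the periodic extension of `φ` sends to `r`. So edges transform like delta functions under
pull-back along `φ`. -/
theorem edgeMap_dualHom {S T : SimplexCategory} (φ : S ⟶ T) (c : ℤ) (r : Fin (T.len + 1)) :
    edgeMap (k := k) q (dualHom φ)
      (Finsupp.single ((c * (T.len + 1) + (r : ℕ) : ℤ) : ZMod (q * simplexCard T)) 1) =
    ∑ r' with φ.toOrderHom r' = r,
      Finsupp.single ((c * (S.len + 1) + (r' : ℕ) : ℤ) : ZMod (q * simplexCard S)) 1 := by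
  have hmem (y : ℤ) : y ∈ Finset.Ico (dualFun φ (c * (T.len + 1) + (r : ℕ)))
      (dualFun φ (c * (T.len + 1) + (r : ℕ) + 1)) ↔
        periodicExt φ y = c * (T.len + 1) + (r : ℕ) := by
    rw [Finset.mem_Ico, ← not_le, dualFun_gc, dualFun_gc]
    omega
  rw [edgeMap_single, path]
  symm
  refine Finset.sum_bij (fun r' _ => c * (S.len + 1) + (r' : ℕ)) ?_ ?_ ?_ ?_
  · intro r' hr'
    have hr : φ.toOrderHom r' = r := by simpa using hr'
    refine (hmem _).2 ?_
    rw [periodicExt_apply, hr]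
  · intro a _ b _ h
    exact Fin.ext (by omega)
  · intro b hb
    have hb' := (hmem b).1 hb
    obtain ⟨c', r', rfl⟩ := exists_rep S b
    rw [periodicExt_apply] at hb'
    have h1 : ((φ.toOrderHom r' : ℕ) : ℤ) < T.len + 1 := by exact_mod_cast (φ.toOrderHom r').2
    have h2 : ((r : ℕ) : ℤ) < T.len + 1 := by exact_mod_cast r.2
    have hc : c' = c := by
      rcases lt_trichotomy c' c with h | h | h
      · nlinarith
      · exact h
      · nlinarith
    subst hc
    exact ⟨r', by simpa using Fin.ext (by omega), rfl⟩
  · intro r' _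
    rfl

theorem edgeMap_dualHom_sum {S T : SimplexCategory} (φ : S ⟶ T) (c : ℤ) (g : Fin (T.len + 1) → k) :
    edgeMap (k := k) q (dualHom φ) (∑ r, g r •
      Finsupp.single ((c * (T.len + 1) + (r : ℕ) : ℤ) : ZMod (q * simplexCard T)) 1) =
    ∑ r, g (φ.toOrderHom r) •
      Finsupp.single ((c * (S.len + 1) + (r : ℕ) : ℤ) : ZMod (q * simplexCard S)) 1 := by
  rw [map_sum, ← Finset.sum_fiberwise (g := φ.toOrderHom)]
  refine Finset.sum_congr rfl fun r _ => ?_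
  rw [map_smul, edgeMap_dualHom, Finset.smul_sum]
  refine Finset.sum_congr rfl fun r' hr' => ?_
  rw [(Finset.mem_filter.1 hr').2]

variable (k q) in
/-- The natural map from the functions with values in `k[ℤ/q]` to the edges. -/
def fnToEdgeHom : fnFun k ⊗ (Functor.const _).obj (ModuleCat.of k (ZMod q →₀ k)) ⟶
    (pull (j q)).obj (edgeFun k q) where
  app S := ModuleCat.ofHom (fnToEdge k q S.unop.len)
  naturality T S φ := by
    refine ModuleCat.hom_ext (TensorProduct.ext (LinearMap.ext fun g : Fin (T.unop.len + 1) → k =>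
      Finsupp.lhom_ext' fun c => LinearMap.ext_ring ?_))
    refine (fnToEdge_tmul S.unop.len (fun r => g (φ.unop.toOrderHom r)) c).trans ?_
    refine Eq.trans ?_ (congrArg (edgeMap q (dualHom φ.unop)) (fnToEdge_tmul T.unop.len g c)).symm
    exact (edgeMap_dualHom_sum φ.unop c.cast g).symm

instance [NeZero q] : IsIso (fnToEdgeHom k q) := by
  have (S : SimplexCategoryᵒᵖ) : IsIso ((fnToEdgeHom k q).app S) :=
    (ConcreteCategory.isIso_iff_bijective _).2 (fnToEdge_bijective S.unop.len)
  exact NatIso.isIso_of_isIso_app _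

theorem ext_tensor_edgeFun_eq_zero [NeZero q] (A : FunCat (Lambda q) k) {n : ℕ}
    (y : Ext (A ⊗ edgeFun k q) (constFun (Lambda q) k) n) : y = 0 :=
  ext_tensor_eq_zero (asIso (fnToEdgeHom k q)).symm A y

/-- Since `π j_q = j_1`, the pulled-back functor has the same restriction to `Δᵒᵖ` as the edges of
`Λ`. -/
theorem ext_tensor_pull_edgeFun_eq_zero [NeZero q] (A : FunCat (Lambda q) k) {n : ℕ}
    (y : Ext (A ⊗ (pull (proj q)).obj (edgeFun k 1)) (constFun (Lambda q) k) n) : y = 0 :=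
  ext_tensor_eq_zero (W := (pull (proj q)).obj (edgeFun k 1)) (asIso (fnToEdgeHom k 1)).symm A y

end EdgeFun

/-! ### The covering of circles of degree `p` -/

section Reduction
open Lambda
variable {k : Type u} [Field k]

/-- The map of chains induced by the reduction `ℤ/N → ℤ/M`. -/
def reduce (k : Type u) [Field k] {N M : ℕ} (h : M ∣ N) : (ZMod N →₀ k) →ₗ[k] (ZMod M →₀ k) :=
  Finsupp.lmapDomain k k (ZMod.castHom h (ZMod M))

theorem reduce_single {N M : ℕ} (h : M ∣ N) (a : ℤ) :
    reduce k h (Finsupp.single (a : ZMod N) 1) = Finsupp.single (a : ZMod M) 1 := by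
  rw [reduce, Finsupp.lmapDomain_apply, Finsupp.mapDomain_single, map_intCast]

theorem reduce_path {N M : ℕ} (h : M ∣ N) (a b : ℤ) : reduce k h (path k N a b) = path k M a b := by
  simp_rw [path, map_sum, reduce_single]

theorem path_mul (N c : ℕ) : path k N 0 (c * N : ℕ) = (c : k) • path k N 0 N := by
  induction c with
  | zero => simp [path]
  | succ c ih =>
    rw [← path_add N (b := (c * N : ℕ)) (by positivity) (by push_cast; nlinarith), ih]
    have := path_period (k := k) N (c * N : ℕ)
    rw [show (((c + 1) * N : ℕ) : ℤ) = (c * N : ℕ) + N by push_cast; ring, this]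
    push_cast
    rw [add_smul, one_smul]

theorem one_mul_dvd (p n : ℕ) : 1 * n ∣ p * n := by rw [one_mul]; exact dvd_mul_left _ _

theorem augm_reduce {N M : ℕ} (h : M ∣ N) (a : ℤ) :
    augm k M (reduce k h (Finsupp.single (a : ZMod N) 1)) =
      augm k N (Finsupp.single (a : ZMod N) 1) := by
  rw [reduce_single, augm_single, augm_single]

theorem bdry_reduce {N M : ℕ} (h : M ∣ N) (a : ℤ) :
    bdry k M (reduce k h (Finsupp.single (a : ZMod N) 1)) =
      reduce k h (bdry k N (Finsupp.single (a : ZMod N) 1)) := by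
  rw [reduce_single, ← path_succ, ← path_succ, bdry_path _ (by omega), bdry_path _ (by omega), map_sub,
    reduce_single, reduce_single]

/-- The fundamental cycle of the large circle winds `p` times around the small one. This is where
the characteristic enters. -/
theorem reduce_fund (p n : ℕ) [CharP k p] : reduce k (one_mul_dvd p n) (fund k (p * n) 1) = 0 := by
  have h := path_mul (k := k) (1 * n) p
  rw [CharP.cast_eq_zero k p, zero_smul] at h
  rw [fund_apply, one_smul, reduce_path, ← h]
  simp

/-- The pull-back of the second extension along `f.τ₃` is the push-out of the first along `f.τ₁`. -/
theorem comp_extClass_eq_zero {Γ : Type} [SmallCategory Γ] {S₁ S₂ : ShortComplex (FunCat Γ k)}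
    (h₁ : S₁.ShortExact) (h₂ : S₂.ShortExact) (f : S₁ ⟶ S₂) (hf : f.τ₁ = 0) :
    (Ext.mk₀ f.τ₃).comp h₂.extClass (zero_add 1) = 0 := by
  rw [← ShortComplex.ShortExact.extClass_naturality h₁ h₂ f, hf, Ext.mk₀_zero, Ext.comp_zero]

variable (k) (p : ℕ)

/-- The reduction map on points. -/
def pointReduce : pointFun k p ⟶ (pull (proj p)).obj (pointFun k 1) where
  app X := ModuleCat.ofHom (reduce k (one_mul_dvd p X.card))
  naturality := by
    rintro X Y ⟨f⟩
    refine ModuleCat.hom_ext (finsupp_ext _ fun a => ?_)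
    change reduce k _ (pointMap p f _) = pointMap 1 f (reduce k _ _)
    rw [pointMap_single, reduce_single, reduce_single]
    exact (pointMap_single 1 f a).symm

/-- The reduction map on edges. -/
def edgeReduce : edgeFun k p ⟶ (pull (proj p)).obj (edgeFun k 1) where
  app X := ModuleCat.ofHom (reduce k (one_mul_dvd p X.card))
  naturality := by
    rintro X Y ⟨f⟩
    refine ModuleCat.hom_ext (finsupp_ext _ fun a => ?_)
    change reduce k _ (edgeMap p f _) = edgeMap 1 f (reduce k _ _)
    rw [edgeMap_single, reduce_single, reduce_path]
    exact (edgeMap_single 1 f a).symm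

theorem pointReduce_augmentation :
    pointReduce k p ≫ (pull (proj p)).map (augmentation k 1) = augmentation k p := by
  refine NatTrans.ext (funext fun X => ModuleCat.hom_ext (finsupp_ext _ fun a => ?_))
  exact augm_reduce (k := k) (one_mul_dvd p X.card) a

theorem edgeReduce_boundaryMap :
    edgeReduce k p ≫ (pull (proj p)).map (boundaryMap k 1) = boundaryMap k p ≫ pointReduce k p := by
  refine NatTrans.ext (funext fun X => ModuleCat.hom_ext (finsupp_ext _ fun a => ?_))
  exact bdry_reduce (one_mul_dvd p X.card) a

theorem fundamentalCycle_edgeReduce [CharP k p] : fundamentalCycle k p ≫ edgeReduce k p = 0 := by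
  refine NatTrans.ext (funext fun X => ModuleCat.hom_ext (LinearMap.ext_ring ?_))
  exact reduce_fund p X.card

/-- The reduction map on cycles. -/
def cycleReduce : kernel (augmentation k p) ⟶ (pull (proj p)).obj (kernel (augmentation k 1)) :=
  have := ((rightSeq_shortExact k 1).map_of_exact (pull (proj p))).mono_f
  ((rightSeq_shortExact k 1).map_of_exact (pull (proj p))).exact.lift
    (kernel.ι (augmentation k p) ≫ pointReduce k p) (by
      refine (Category.assoc _ _ _).trans ?_
      exact (whisker_eq _ (pointReduce_augmentation k p)).trans (kernel.condition _))

theorem cycleReduce_ι : cycleReduce k p ≫ (pull (proj p)).map (kernel.ι (augmentation k 1)) =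
    kernel.ι (augmentation k p) ≫ pointReduce k p :=
  have := ((rightSeq_shortExact k 1).map_of_exact (pull (proj p))).mono_f
  ((rightSeq_shortExact k 1).map_of_exact (pull (proj p))).exact.lift_f _ _

/-- The reduction map on the sequence `0 ⟶ Z ⟶ j_! k ⟶ k ⟶ 0`. -/
def rightSeqReduce : rightSeq k p ⟶ (rightSeq k 1).map (pull (proj p)) where
  τ₁ := cycleReduce k p
  τ₂ := pointReduce k p
  τ₃ := 𝟙 (constFun (Lambda p) k)
  comm₁₂ := cycleReduce_ι k p
  comm₂₃ := (pointReduce_augmentation k p).trans (Category.comp_id _).symm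

/-- The reduction map on the sequence `0 ⟶ k ⟶ j_* k ⟶ Z ⟶ 0` vanishes on `k`. -/
def leftSeqReduce [NeZero p] [CharP k p] : leftSeq k p ⟶ (leftSeq k 1).map (pull (proj p)) where
  τ₁ := 0
  τ₂ := edgeReduce k p
  τ₃ := cycleReduce k p
  comm₁₂ := zero_comp.trans (fundamentalCycle_edgeReduce k p).symm
  comm₂₃ := by
    have := ((rightSeq_shortExact k 1).map_of_exact (pull (proj p))).mono_f
    refine (cancel_mono ((rightSeq k 1).map (pull (proj p))).f).1 ?_
    have h1 : (leftSeq k 1).g ≫ kernel.ι (augmentation k 1) = boundaryMap k 1 := kernel.lift_ι _ _ _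
    have h2 : (leftSeq k p).g ≫ kernel.ι (augmentation k p) = boundaryMap k p := kernel.lift_ι _ _ _
    have h3 := ((pull (proj p)).map_comp _ _).symm.trans (congrArg (pull (proj p)).map h1)
    refine (Category.assoc _ _ _).trans ((whisker_eq _ h3).trans ?_)
    refine (edgeReduce_boundaryMap k p).trans ?_
    refine Eq.trans ?_ (Category.assoc _ _ _).symm
    refine Eq.trans ?_ (whisker_eq _ (cycleReduce_ι k p)).symm
    exact (eq_whisker h2 _).symm.trans (Category.assoc _ _ _)

variable {k p}

/-- Both comparison maps end in the same `Ext` over `Δᵒᵖ`, because `π j_p = j_1` and reduction sends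
`v_0` to `v_0`. -/
theorem extVertex_pull (E : FunCat (Lambda 1) k) {n : ℕ}
    (z : Ext (E ⊗ pointFun k 1) (constFun (Lambda 1) k) n) :
    extVertex (A := (pull (proj p)).obj E) (B := constFun (Lambda p) k)
      ((Ext.mk₀ ((tensorLeft ((pull (proj p)).obj E)).map (pointReduce k p))).comp
        (z.mapExactFunctor (pull (proj p))) (zero_add n)) = extVertex z := by
  dsimp only [extVertex]
  refine (congrArg (fun t => (Ext.mk₀ (vertex _)).comp t (zero_add n))
    (Ext.mapExactFunctor_comp (pull (j p)) _ _ _)).trans ?_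
  rw [Ext.mapExactFunctor_mk₀]
  refine (Ext.mk₀_comp_mk₀_assoc _ _ _).trans ?_
  refine congrArg₂ (fun f t => (Ext.mk₀ f).comp t (zero_add n)) ?_
    (mapExactFunctor_functorComp (pull (proj p)) (pull (j p)) z).symm
  refine NatTrans.ext (funext fun S => ModuleCat.hom_ext (LinearMap.ext fun x => ?_))
  have h := reduce_single (k := k) (one_mul_dvd p (simplexCard S.unop)) 0
  rw [Int.cast_zero, Int.cast_zero] at h
  exact congrArg (fun t : ZMod (1 * (simplexCard S.unop : ℕ)) →₀ k =>
    TensorProduct.tmul k (M := E.obj ((j 1).obj S)) x t) h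

theorem exists_pull_eq (E : FunCat (Lambda 1) k) {n : ℕ}
    (y : Ext ((pull (proj p)).obj E ⊗ pointFun k p) (constFun (Lambda p) k) n) :
    ∃ z : Ext (E ⊗ pointFun k 1) (constFun (Lambda 1) k) n,
      (Ext.mk₀ ((tensorLeft ((pull (proj p)).obj E)).map (pointReduce k p))).comp
        (z.mapExactFunctor (pull (proj p))) (zero_add n) = y := by
  obtain ⟨z, hz⟩ := (extVertex_bijective E (constFun (Lambda 1) k) n).2 
    (extVertex (A := (pull (proj p)).obj E) y)
  exact ⟨z, (extVertex_bijective _ _ _).1 ((extVertex_pull (p := p) E z).trans hz)⟩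

/-- By acyclicity of the pulled-back edges, `w` is a multiple of the class of the pulled-back left
sequence. The reduction on cycles kills that class, as the reduction is zero on `k`. -/
theorem cycleReduce_comp_eq_zero [NeZero p] [CharP k p] (A : FunCat (Lambda p) k) {n : ℕ}
    (w : Ext (A ⊗ (pull (proj p)).obj (kernel (augmentation k 1))) (constFun (Lambda p) k) n) :
    (Ext.mk₀ ((tensorLeft A).map (cycleReduce k p))).comp w (zero_add n) = 0 := by
  have hS := ((leftSeq_shortExact k 1).map_of_exact (pull (proj p))).map_of_exact (tensorLeft A)
  have hw : (Ext.mk₀ ((((leftSeq k 1).map (pull (proj p))).map (tensorLeft A))).g).comp w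
      (zero_add n) = 0 := ext_tensor_pull_edgeFun_eq_zero A _
  cases n with
  | zero =>
    -- In degree `0` there is no connecting class to divide by, and `w` itself vanishes.
    have : w = 0 := ext_eq_zero_of_shortExact hS w hw fun m hm => by omega
    rw [this, Ext.comp_zero]
  | succ n =>
    obtain ⟨v, rfl⟩ := Ext.contravariant_sequence_exact₃ hS _ w hw (add_comm 1 n)
    have hS' := (leftSeq_shortExact k p).map_of_exact (tensorLeft A)
    have h := comp_extClass_eq_zero hS' hS
      ((tensorLeft A).mapShortComplex.map (leftSeqReduce k p)) ((tensorLeft A).map_zero _ _)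
    refine (Ext.comp_assoc _ _ _ (zero_add 1) (add_comm 1 n) (by omega)).symm.trans ?_
    exact (congrArg (fun t => Ext.comp t v (add_comm 1 n)) h).trans (Ext.zero_comp _ _ _ _ _)

/-- Classes on `A ⊗ j_! k` vanish on the cycles if `A` comes from `Λ`. -/
theorem kernel_ι_comp_eq_zero [NeZero p] [CharP k p] (E : FunCat (Lambda 1) k) {n : ℕ}
    (y : Ext ((pull (proj p)).obj E ⊗ pointFun k p) (constFun (Lambda p) k) n) :
    (Ext.mk₀ ((tensorLeft ((pull (proj p)).obj E)).map (kernel.ι (augmentation k p)))).comp y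
      (zero_add n) = 0 := by
  obtain ⟨z, rfl⟩ := exists_pull_eq E y
  let A := (pull (proj p)).obj E
  -- Reduction commutes with the inclusion of cycles, so the restriction of `y` factors through
  -- `cycleReduce`.
  have h : (tensorLeft A).map (kernel.ι (augmentation k p)) ≫ (tensorLeft A).map (pointReduce k p) =
      (tensorLeft A).map (cycleReduce k p) ≫
        (tensorLeft A).map ((pull (proj p)).map (kernel.ι (augmentation k 1))) := by
    rw [← Functor.map_comp, ← Functor.map_comp, cycleReduce_ι]
  refine (Ext.mk₀_comp_mk₀_assoc _ _ _).trans ?_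
  refine (congrArg (fun t => Ext.comp (Ext.mk₀ t) (z.mapExactFunctor (pull (proj p)))
    (zero_add n)) h).trans ?_
  refine (Ext.mk₀_comp_mk₀_assoc _ _ _).symm.trans ?_
  exact cycleReduce_comp_eq_zero A _

end Reduction

/-! ### The restriction map on `H^2` -/

section Restriction
open Lambda
variable {k : Type u} [Field k] {q : ℕ}

/-- This becomes `Ext^{n+1}(k, k)` over `Δᵒᵖ`, and the constant functor is a restriction along
`cons`. -/
theorem ext_pointFun_eq_zero {n : ℕ} (y : Ext (pointFun k q) (constFun (Lambda q) k) (n + 1)) :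
    y = 0 := by
  refine ext_eq_zero_of_iso (λ_ (pointFun k q)).symm (fun z => ?_) y
  refine (extVertex_bijective (constFun (Lambda q) k) _ _).1 ?_
  exact (ext_pull_cons_eq_zero (constFun MinSimplexᵒᵖ k) _).trans
    (ext_pull_cons_eq_zero (constFun MinSimplexᵒᵖ k) _).symm

theorem ext_edgeFun_eq_zero [NeZero q] {n : ℕ} (y : Ext (edgeFun k q) (constFun (Lambda q) k) n) :
    y = 0 :=
  ext_eq_zero_of_iso (λ_ (edgeFun k q)).symm (fun z => ext_tensor_edgeFun_eq_zero (𝟙_ _) z) y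

variable (k q) in
/-- The class of `0 ⟶ Z ⟶ j_! k ⟶ k ⟶ 0`. -/
def rightClass : Ext (constFun (Lambda q) k) (kernel (augmentation k q)) 1 :=
  (rightSeq_shortExact k q).extClass

variable (k q) in
/-- The class of `0 ⟶ k ⟶ j_* k ⟶ Z ⟶ 0`. -/
def leftClass [NeZero q] : Ext (kernel (augmentation k q)) (constFun (Lambda q) k) 1 :=
  (leftSeq_shortExact k q).extClass

/-- Every class in `H^2(Λ_q, k)` is a multiple of the periodicity class. -/
theorem exists_eq_comp_periodicity [NeZero q] (x : Coh (Lambda q) k 2) :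
    ∃ c : Ext (constFun (Lambda q) k) (constFun (Lambda q) k) 0,
      (rightClass k q).comp ((leftClass k q).comp c (add_zero 1)) rfl = x := by
  obtain ⟨w, rfl⟩ := Ext.contravariant_sequence_exact₃ (rightSeq_shortExact k q) _ x
    (ext_pointFun_eq_zero _) (rfl : 1 + 1 = 2)
  obtain ⟨c, rfl⟩ := Ext.contravariant_sequence_exact₃ (leftSeq_shortExact k q) _ w
    (ext_edgeFun_eq_zero _) (add_zero 1)
  exact ⟨c, rfl⟩

/-- This is `π^* u`. The pulled-back right class is the right class over `Λ_p` followed by the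
reduction of cycles, which annihilates the pulled-back left class. -/
theorem pull_rightSeq_comp_leftSeq_eq_zero (p : ℕ) [NeZero p] [CharP k p] :
    ((rightClass k 1).mapExactFunctor (pull (proj p))).comp
      ((leftClass k 1).mapExactFunctor (pull (proj p))) rfl = 0 := by
  have h := ShortComplex.ShortExact.extClass_naturality (rightSeq_shortExact k p)
    ((rightSeq_shortExact k 1).map_of_exact (pull (proj p))) (rightSeqReduce k p)
  have h' := comp_extClass_eq_zero (leftSeq_shortExact k p)
    ((leftSeq_shortExact k 1).map_of_exact (pull (proj p))) (leftSeqReduce k p) rfl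
  have h1 : (rightClass k 1).mapExactFunctor (pull (proj p)) =
      (rightClass k p).comp (Ext.mk₀ (cycleReduce k p)) (add_zero 1) :=
    (Ext.mapExactFunctor_extClass _ _).trans ((Ext.mk₀_id_comp _).symm.trans h.symm)
  have h2 : (Ext.mk₀ (cycleReduce k p)).comp ((leftClass k 1).mapExactFunctor (pull (proj p)))
      (zero_add 1) = 0 := by
    have h3 : (leftClass k 1).mapExactFunctor (pull (proj p)) =
        ((leftSeq_shortExact k 1).map_of_exact (pull (proj p))).extClass :=
      Ext.mapExactFunctor_extClass _ _
    rw [h3]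
    exact h'
  rw [h1]
  refine (Ext.comp_assoc_of_second_deg_zero _ _ _ _).trans ?_
  exact (congrArg (fun t => Ext.comp _ t _) h2).trans (Ext.comp_zero _ _ _ _ _)

theorem cohPull_proj_eq_zero (p : ℕ) [NeZero p] [CharP k p] (x : Coh (Lambda 1) k 2) :
    cohPull k (proj p) 2 x = 0 := by
  obtain ⟨c, rfl⟩ := exists_eq_comp_periodicity x
  change Ext.mapExactFunctor (pull (proj p)) _ = 0
  rw [Ext.mapExactFunctor_comp, Ext.mapExactFunctor_comp]
  refine (Ext.comp_assoc_of_third_deg_zero _ _ _ _).symm.trans ?_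
  exact (congrArg (fun t => Ext.comp t _ _) (pull_rightSeq_comp_leftSeq_eq_zero p)).trans
    (Ext.zero_comp _ _ _ _ _)

end Restriction

/-! ### The Connes sequence on `Ext(-, k)` -/

section Gysin
open Lambda
variable {k : Type u} [Field k] {p : ℕ}

/-- The map `A ⊗ j_! k ⟶ A`. -/
def tensorAug (A : FunCat (Lambda p) k) : A ⊗ pointFun k p ⟶ A :=
  (tensorLeft A).map (augmentation k p) ≫ (unitorIso A).hom

theorem mk₀_unitorIso_inv_comp_eq_zero (A : FunCat (Lambda p) k) {B : FunCat (Lambda p) k} {n : ℕ}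
    (y : Ext ((tensorLeft A).obj (constFun (Lambda p) k)) B n)
    (h : (Ext.mk₀ (unitorIso A).inv).comp y (zero_add n) = 0) : y = 0 := by
  have := congrArg (fun t => (Ext.mk₀ (unitorIso A).hom).comp t (zero_add n)) h
  simpa using this

theorem mk₀_unitorIso_hom_comp_eq_zero (A : FunCat (Lambda p) k) {B : FunCat (Lambda p) k} {n : ℕ}
    (y : Ext A B n) (h : (Ext.mk₀ (unitorIso A).hom).comp y (zero_add n) = 0) : y = 0 := by
  have := congrArg (fun t => (Ext.mk₀ (unitorIso A).inv).comp t (zero_add n)) h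
  simpa using this

theorem tensorAug_comp (A : FunCat (Lambda p) k) {B : FunCat (Lambda p) k} {n : ℕ} (y : Ext A B n) :
    (Ext.mk₀ (tensorAug A)).comp y (zero_add n) =
      (Ext.mk₀ ((tensorLeft A).map (augmentation k p))).comp
        ((Ext.mk₀ (unitorIso A).hom).comp y (zero_add n)) (zero_add n) :=
  (Ext.mk₀_comp_mk₀_assoc _ _ _).symm

variable [NeZero p]

/-- The connecting class `A ⊗ r ∈ Ext^1(A ⊗ k, A ⊗ Z)`. -/
def rightExt (A : FunCat (Lambda p) k) :
    Ext ((tensorLeft A).obj (constFun (Lambda p) k)) ((tensorLeft A).obj (kernel (augmentation k p))) 1 :=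
  ((rightSeq_shortExact k p).map_of_exact (tensorLeft A)).extClass

/-- The connecting class `A ⊗ l ∈ Ext^1(A ⊗ Z, A ⊗ k)`. -/
def leftExt (A : FunCat (Lambda p) k) :
    Ext ((tensorLeft A).obj (kernel (augmentation k p))) ((tensorLeft A).obj (constFun (Lambda p) k)) 1 :=
  ((leftSeq_shortExact k p).map_of_exact (tensorLeft A)).extClass

/-- The action of the periodicity class. -/
def periodicityExt (A : FunCat (Lambda p) k) : Ext A A 2 := tensorClass A (periodicityClass k p)

theorem periodicityExt_eq (A : FunCat (Lambda p) k) :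
    periodicityExt A = (Ext.mk₀ (unitorIso A).inv).comp ((rightExt A).comp
      ((leftExt A).comp (Ext.mk₀ (unitorIso A).hom) (add_zero 1)) rfl) (zero_add 2) := by
  have h : (periodicityClass k p).mapExactFunctor (tensorLeft A) = (rightExt A).comp (leftExt A) rfl :=
    (Ext.mapExactFunctor_comp (tensorLeft A) (rightClass k p) (leftClass k p) rfl).trans
      (congrArg₂ (fun s t => Ext.comp s t rfl) (Ext.mapExactFunctor_extClass _ _)
        (Ext.mapExactFunctor_extClass _ _))
  dsimp only [periodicityExt, tensorClass]
  rw [h]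
  exact congrArg (fun t => Ext.comp _ t _) (Ext.comp_assoc_of_third_deg_zero _ _ _ _)

theorem periodicityExt_comp (A : FunCat (Lambda p) k) {B : FunCat (Lambda p) k} {n m : ℕ}
    (y : Ext A B n) (hm : 2 + n = m) :
    (periodicityExt A).comp y hm = (Ext.mk₀ (unitorIso A).inv).comp
      ((rightExt A).comp ((leftExt A).comp ((Ext.mk₀ (unitorIso A).hom).comp y (zero_add n))
        (rfl : 1 + n = 1 + n)) (by omega)) (zero_add m) := by
  rw [periodicityExt_eq, Ext.comp_assoc _ _ _ (zero_add 2) hm (by omega),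
    Ext.comp_assoc _ _ _ rfl (rfl : 1 + n = 1 + n) (by omega),
    Ext.comp_assoc _ _ _ (add_zero 1) (zero_add n) (by omega)]

theorem tensorAug_comp_periodicityExt (A : FunCat (Lambda p) k) :
    (Ext.mk₀ (tensorAug A)).comp (periodicityExt A) rfl = 0 := by
  rw [periodicityExt_eq]
  refine (Ext.mk₀_comp_mk₀_assoc _ _ _).trans ?_
  have h : tensorAug A ≫ (unitorIso A).inv = (tensorLeft A).map (augmentation k p) := by
    simp [tensorAug]
  rw [h]
  exact ((rightSeq_shortExact k p).map_of_exact (tensorLeft A)).comp_extClass_assoc _ _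

/-- With the next lemma, multiplication by the left class is bijective, because the middle term `A ⊗
j^o_* k` is acyclic. Hence `u` behaves like the right class alone. -/
theorem leftExt_comp_eq_zero (A : FunCat (Lambda p) k) {n m : ℕ}
    (y : Ext ((tensorLeft A).obj (constFun (Lambda p) k)) (constFun (Lambda p) k) n) (hm : 1 + n = m)
    (h : (leftExt A).comp y hm = 0) : y = 0 := by
  obtain ⟨w, rfl⟩ := Ext.contravariant_sequence_exact₁
    ((leftSeq_shortExact k p).map_of_exact (tensorLeft A)) _ y hm h
  exact (congrArg (fun t => Ext.comp _ t _) (ext_tensor_edgeFun_eq_zero A w)).trans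
    (Ext.comp_zero _ _ _ _ _)

theorem exists_leftExt_comp (A : FunCat (Lambda p) k) {n m : ℕ}
    (w : Ext ((tensorLeft A).obj (kernel (augmentation k p))) (constFun (Lambda p) k) m)
    (hm : 1 + n = m) : ∃ y, (leftExt A).comp y hm = w :=
  Ext.contravariant_sequence_exact₃ ((leftSeq_shortExact k p).map_of_exact (tensorLeft A)) _ w
    (ext_tensor_edgeFun_eq_zero A _) hm

/-- A class that vanishes on `A ⊗ j_! k` is divisible by the right class; dividing the quotient by
the left class exhibits a multiple of `u`. -/
theorem exists_periodicityExt_comp (A : FunCat (Lambda p) k) {n m : ℕ}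
    (y : Ext A (constFun (Lambda p) k) m) (hm : 2 + n = m)
    (h : (Ext.mk₀ (tensorAug A)).comp y (zero_add m) = 0) :
    ∃ z : Ext A (constFun (Lambda p) k) n, (periodicityExt A).comp z hm = y := by
  rw [tensorAug_comp] at h
  obtain ⟨w, hw⟩ := Ext.contravariant_sequence_exact₃
    ((rightSeq_shortExact k p).map_of_exact (tensorLeft A)) _ _ h (show 1 + (1 + n) = m by omega)
  obtain ⟨v, rfl⟩ := exists_leftExt_comp A w rfl
  refine ⟨(Ext.mk₀ (unitorIso A).inv).comp v (zero_add n), ?_⟩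
  rw [periodicityExt_comp]
  have hv : (Ext.mk₀ (unitorIso A).hom).comp ((Ext.mk₀ (unitorIso A).inv).comp v (zero_add n))
    (zero_add n) = v := by simp
  rw [hv]
  have hw' : (rightExt A).comp ((leftExt A).comp v rfl) (show 1 + (1 + n) = m by omega) = 
    (Ext.mk₀ (unitorIso A).hom).comp y (zero_add m) := hw
  rw [hw']
  simp

/-- The same argument in the degrees `0` and `1`, where there is no class of degree `m - 2` to
multiply by `u`. -/
theorem eq_zero_of_tensorAug_comp (A : FunCat (Lambda p) k) {m : ℕ} (hm : m < 2)
    (y : Ext A (constFun (Lambda p) k) m)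
    (h : (Ext.mk₀ (tensorAug A)).comp y (zero_add m) = 0) : y = 0 := by
  rw [tensorAug_comp] at h
  refine mk₀_unitorIso_hom_comp_eq_zero A y ?_
  refine ext_eq_zero_of_shortExact ((rightSeq_shortExact k p).map_of_exact (tensorLeft A)) _ h
    fun l hl w => ?_
  exact ext_eq_zero_of_shortExact ((leftSeq_shortExact k p).map_of_exact (tensorLeft A)) w
    (ext_tensor_edgeFun_eq_zero A _) fun l' hl' => by omega

variable [CharP k p] (E : FunCat (Lambda 1) k)

/-- If `u y = 0`, then the product of the left class with `y` is the restriction to the cycles of a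
class on `A ⊗ j_! k`. For pulled-back `A` such restrictions vanish. -/
theorem periodicityExt_comp_eq_zero {n m : ℕ}
    (y : Ext ((pull (proj p)).obj E) (constFun (Lambda p) k) n) (hm : 2 + n = m)
    (h : (periodicityExt ((pull (proj p)).obj E)).comp y hm = 0) : y = 0 := by
  rw [periodicityExt_comp] at h
  have h1 := mk₀_unitorIso_inv_comp_eq_zero _ _ h
  refine mk₀_unitorIso_hom_comp_eq_zero _ y (leftExt_comp_eq_zero _ _ rfl ?_)
  obtain ⟨w, hw⟩ := Ext.contravariant_sequence_exact₁
    ((rightSeq_shortExact k p).map_of_exact (tensorLeft _)) _ _ _ h1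
  exact hw.symm.trans (kernel_ι_comp_eq_zero E w)

/-- The same vanishing, read at the next place of the long exact sequence: the obstruction to
extending `z` is its restriction to the cycles. -/
theorem exists_tensorAug_comp {n : ℕ}
    (z : Ext ((pull (proj p)).obj E ⊗ pointFun k p) (constFun (Lambda p) k) n) :
    ∃ y : Ext ((pull (proj p)).obj E) (constFun (Lambda p) k) n,
      (Ext.mk₀ (tensorAug ((pull (proj p)).obj E))).comp y (zero_add n) = z := by
  obtain ⟨w, hw⟩ := Ext.contravariant_sequence_exact₂
    ((rightSeq_shortExact k p).map_of_exact (tensorLeft ((pull (proj p)).obj E))) _ z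
      (kernel_ι_comp_eq_zero E z)
  have hw' (v : Ext ((tensorLeft ((pull (proj p)).obj E)).obj (constFun (Lambda p) k))
      (constFun (Lambda p) k) n) :
      (Ext.mk₀ (unitorIso _).hom).comp ((Ext.mk₀ (unitorIso _).inv).comp v (zero_add n))
        (zero_add n) = v := by simp
  refine ⟨(Ext.mk₀ (unitorIso _).inv).comp w (zero_add n), ?_⟩
  rw [tensorAug_comp]
  exact (congrArg (fun t => Ext.comp _ t _) (hw' w)).trans hw

end Gysin

/-! ### The Connes sequence on homology -/

section GysinHomology
open Lambda
variable {k : Type u} [Field k] {p : ℕ}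

theorem subsingleton_homologyOf {Γ : Type} [SmallCategory Γ] (E : FunCat Γ k) {n : ℤ} (hn : n < 0) :
    Subsingleton (homologyOf E n) :=
  subsingleton_chains_homology E (by omega)

/-- The map `H_n(A ⊗ j_! k) ⟶ H_n(A)`. -/
def augHomology (A : FunCat (Lambda p) k) (n : ℤ) : homologyOf (A ⊗ pointFun k p) n ⟶ HC A n :=
  extAct (Ext.mk₀ (tensorAug A)) (-n) (-n) (by simp)

variable [NeZero p]

theorem augHomology_exact (A : FunCat (Lambda p) k) (n : ℤ) :
    Function.Exact (augHomology A n) (periodicity A n) := by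
  -- Below degree `2` the target of `u` is zero and exactness means surjectivity of the
  -- augmentation; from degree `2` on, duality applies to both maps.
  rcases lt_or_ge n 2 with hn | hn
  · have h1 := subsingleton_homologyOf A (n := n - 2) (by omega)
    have hs : Function.Surjective (augHomology A n) := by
      rcases lt_or_ge n 0 with hn' | hn'
      · have := subsingleton_homologyOf A hn'
        exact fun y => ⟨0, Subsingleton.elim (α := homologyOf _ _) _ _⟩
      · exact extAct_surjective (N' := n.toNat) (N := n.toNat) _ _ (by omega) (by omega) (by omega)
          fun y hy => eq_zero_of_tensorAug_comp A (by omega) y hy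
    intro y
    exact ⟨fun _ => hs y, fun _ => Subsingleton.elim (α := homologyOf A (n - 2)) _ _⟩
  · exact extAct_exact (N'' := (n - 2).toNat) (N' := n.toNat) (N := n.toNat)
      (Ext.mk₀ (tensorAug A)) (periodicityExt A) _ _ (by omega) (by omega) (by omega) (by omega)
      (by omega) (tensorAug_comp_periodicityExt A)
      fun y hy => exists_periodicityExt_comp A y _ hy

variable [CharP k p] (E : FunCat (Lambda 1) k)

theorem periodicity_surjective (n : ℤ) :
    Function.Surjective (periodicity ((pull (proj p)).obj E) n) := by
  rcases lt_or_ge n 2 with hn | hn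
  · have := subsingleton_homologyOf ((pull (proj p)).obj E) (n := n - 2) (by omega)
    exact fun y => ⟨0, Subsingleton.elim (α := homologyOf _ _) _ _⟩
  · exact extAct_surjective (N' := (n - 2).toNat) (N := n.toNat)
      (periodicityExt ((pull (proj p)).obj E)) _ (by omega) (by omega) (by omega)
      fun y hy => periodicityExt_comp_eq_zero E y _ hy

theorem augHomology_injective (n : ℤ) :
    Function.Injective (augHomology ((pull (proj p)).obj E) n) := by
  rcases lt_or_ge n 0 with hn | hn
  · have := subsingleton_homologyOf ((pull (proj p)).obj E ⊗ pointFun k p) hn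
    exact Function.injective_of_subsingleton _
  · exact extAct_injective (N' := n.toNat) (N := n.toNat) _ _ (by omega) (by omega) (by omega)
      fun y => exists_tensorAug_comp E y

end GysinHomology

/-! ### Comparison with left derived functors; Hochschild homology -/

section LeftDerived
variable {C D : Type*} [Category* C] [Category* D] [HasZeroObject C] [HasZeroObject D]
  {ι ι' : Type*} {c : ComplexShape ι} {c' : ComplexShape ι'} [Preadditive C] [Preadditive D]

/-- An additive functor commutes with the extension of complexes by zero. -/
theorem nonempty_mapExtendIso (F : C ⥤ D) [F.Additive] (e : c.Embedding c') [e.IsRelIff]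
    (K : HomologicalComplex C c) :
    Nonempty ((F.mapHomologicalComplex c').obj (K.extend e) ≅
      ((F.mapHomologicalComplex c).obj K).extend e) := by
  let φ : ((F.mapHomologicalComplex c').obj (K.extend e)).restriction e ⟶
      (F.mapHomologicalComplex c).obj K :=
    { f := fun i => F.map (K.extendXIso e rfl).hom
      comm' := fun i j _ => by
        have h := K.extend_d_eq e (rfl : e.f i = _) (rfl : e.f j = _)
        have h' : (K.extend e).d (e.f i) (e.f j) ≫ (K.extendXIso e rfl).hom =
            (K.extendXIso e rfl).hom ≫ K.d i j := by
          rw [h]; simp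
        exact (F.map_comp _ _).symm.trans ((congrArg F.map h'.symm).trans (F.map_comp _ _)) }
  have hφ : e.HasLift φ := fun j hj i' hij => by
    have h : IsZero ((K.extend e).X i') := K.isZero_extend_X e i' fun i hi => hj.2 i (hi ▸ hij)
    exact (F.map_isZero h).eq_of_src _ _
  let ψ := e.liftExtend φ hφ
  have : IsIso ψ := by
    have (i' : ι') : IsIso (ψ.f i') := by
      by_cases hi : ∃ i, e.f i = i'
      · obtain ⟨i, hi⟩ := hi
        refine (e.isIso_liftExtend_f_iff φ hφ hi).2 ?_
        exact (inferInstance : IsIso (F.map (K.extendXIso e rfl).hom))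
      · push Not at hi
        have h1 : IsZero (((F.mapHomologicalComplex c').obj (K.extend e)).X i') :=
          F.map_isZero (K.isZero_extend_X e i' hi)
        have h2 := ((F.mapHomologicalComplex c).obj K).isZero_extend_X e i' hi
        exact ⟨0, h1.eq_of_src _ _, h2.eq_of_src _ _⟩
    exact HomologicalComplex.Hom.isIso_of_components _
  exact ⟨asIso ψ⟩

end LeftDerived

section
variable {Γ : Type} [SmallCategory Γ] {k : Type u} [Field k]

theorem nonempty_homologyOf_iso (E : FunCat Γ k) (n : ℕ) :
    Nonempty (homologyOf E n ≅ (colim.leftDerived n).obj E) := by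
  obtain ⟨e⟩ := nonempty_mapExtendIso (colim (J := Γ) (C := ModuleCat.{u} k))
    ComplexShape.embeddingDownNat (projectiveResolution E).complex
  refine ⟨(HomologicalComplex.homologyFunctor _ _ (-(n : ℤ))).mapIso e ≪≫
    HomologicalComplex.extendHomologyIso _ _ (j := n) rfl ≪≫
    ((projectiveResolution E).isoLeftDerivedObj colim n).symm⟩

theorem nonempty_homologyOf_iso_of_iso {E E' : FunCat Γ k} (e : E ≅ E') (n : ℤ) :
    Nonempty (homologyOf E n ≅ homologyOf E' n) := by
  rcases lt_or_ge n 0 with hn | hn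
  · have h1 := (ModuleCat.isZero_iff_subsingleton).2 (subsingleton_homologyOf E hn)
    have h2 := (ModuleCat.isZero_iff_subsingleton).2 (subsingleton_homologyOf E' hn)
    exact ⟨h1.iso h2⟩
  lift n to ℕ using hn
  obtain ⟨e₁⟩ := nonempty_homologyOf_iso E n
  obtain ⟨e₂⟩ := nonempty_homologyOf_iso E' n
  exact ⟨e₁ ≪≫ (colim.leftDerived n).mapIso e ≪≫ e₂.symm⟩

variable {Γ₂ : Type} [SmallCategory Γ₂]

/-- `L` is exact and preserves projectives, so it takes a projective resolution to a projective
resolution. The functors `colim ∘ L` and `colim` agree, as both are left adjoint to the constant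
functor construction. -/
theorem nonempty_homologyOf_iso_of_adj (F : Γ₂ ⥤ Γ) (L : FunCat Γ₂ k ⥤ FunCat Γ k) [L.Additive]
    [PreservesFiniteLimits L] [PreservesFiniteColimits L] (adj : L ⊣ pull F) (X : FunCat Γ₂ k) (n : ℤ) :
    Nonempty (homologyOf (L.obj X) n ≅ homologyOf X n) := by
  rcases lt_or_ge n 0 with hn | hn
  · have h1 := (ModuleCat.isZero_iff_subsingleton).2 (subsingleton_homologyOf (L.obj X) hn)
    have h2 := (ModuleCat.isZero_iff_subsingleton).2 (subsingleton_homologyOf X hn)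
    exact ⟨h1.iso h2⟩
  lift n to ℕ using hn
  obtain ⟨e₁⟩ := nonempty_homologyOf_iso (L.obj X) n
  obtain ⟨e₂⟩ := nonempty_homologyOf_iso X n
  have : L.PreservesProjectiveObjects := ⟨fun hP => adj.map_projective _ hP⟩
  let e₃ : L ⋙ colim ≅ colim :=
    (adj.comp colimConstAdj).leftAdjointUniq colimConstAdj
  refine ⟨e₁ ≪≫ (L.mapProjectiveResolution (projectiveResolution X)).isoLeftDerivedObj colim n ≪≫
    (HomologicalComplex.homologyFunctor _ _ n).mapIso
      ((NatIso.mapHomologicalComplex e₃ _).app (projectiveResolution X).complex) ≪≫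
      ((projectiveResolution X).isoLeftDerivedObj colim n).symm ≪≫ e₂.symm⟩

end

section
open Lambda
variable {k : Type u} [Field k] {q : ℕ}

/-- Existence is enough: `HH` enters only as a graded space, to be identified with the kernel of
`u`. -/
theorem nonempty_homologyOf_tensor_iso (A : FunCat (Lambda q) k) (n : ℤ) :
    Nonempty (homologyOf (A ⊗ pointFun k q) n ≅ HH A n) := by
  obtain ⟨e⟩ := nonempty_homologyOf_iso_of_adj (j q) (jShriek k q) jShriekAdj
    ((pull (j q)).obj A) n
  obtain ⟨e'⟩ := nonempty_homologyOf_iso_of_iso (jShriekIso A) n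
  exact ⟨e'.symm ≪≫ e⟩

end

/-! ### The long exact homology sequence of a mapping cone -/

section ConeSequence
open HomologicalComplex CochainComplex Pretriangulated
variable {k : Type u} [Field k] {X Y Z : CochainComplex (ModuleCat.{u} k) ℤ}

theorem exact_homologyMap_of_distinguished
    (T : Triangle (HomotopyCategory (ModuleCat.{u} k) (ComplexShape.up ℤ))) (hT : T ∈ distTriang _)
    (f : X ⟶ Y) (g : Y ⟶ Z)
    (e₁ : T.obj₁ ≅ (HomotopyCategory.quotient _ _).obj X)
    (e₂ : T.obj₂ ≅ (HomotopyCategory.quotient _ _).obj Y)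
    (e₃ : T.obj₃ ≅ (HomotopyCategory.quotient _ _).obj Z)
    (hf : T.mor₁ ≫ e₂.hom = e₁.hom ≫ (HomotopyCategory.quotient _ _).map f)
    (hg : T.mor₂ ≫ e₃.hom = e₂.hom ≫ (HomotopyCategory.quotient _ _).map g) (b : ℤ) :
    Function.Exact (homologyMap f b) (homologyMap g b) := by
  let F := HomotopyCategory.homologyFunctor (ModuleCat.{u} k) (ComplexShape.up ℤ) b
  let α (K : CochainComplex (ModuleCat.{u} k) ℤ) :
      F.obj ((HomotopyCategory.quotient _ _).obj K) ≅ K.homology b :=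
    (HomotopyCategory.homologyFunctorFactors (ModuleCat.{u} k) (ComplexShape.up ℤ) b).app K
  have hα {K L : CochainComplex (ModuleCat.{u} k) ℤ} (f : K ⟶ L) :
      F.map ((HomotopyCategory.quotient _ _).map f) ≫ (α L).hom = (α K).hom ≫ homologyMap f b :=
    (HomotopyCategory.homologyFunctorFactors (ModuleCat.{u} k) (ComplexShape.up ℤ) b).hom.naturality f
  have hex := F.map_distinguished_exact T hT
  have h1 : F.map T.mor₁ ≫ F.map e₂.hom ≫ (α Y).hom =
      (F.map e₁.hom ≫ (α X).hom) ≫ homologyMap f b := by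
    rw [← Functor.map_comp_assoc, hf, Functor.map_comp_assoc, Category.assoc, hα]
  have h2 : F.map T.mor₂ ≫ F.map e₃.hom ≫ (α Z).hom =
      (F.map e₂.hom ≫ (α Y).hom) ≫ homologyMap g b := by
    rw [← Functor.map_comp_assoc, hg, Functor.map_comp_assoc, Category.assoc, hα]
  have hz : homologyMap f b ≫ homologyMap g b = 0 := by
    rw [← cancel_epi (F.map e₁.hom ≫ (α X).hom), ← Category.assoc, ← h1, Category.assoc, ← h2,
      ← Functor.map_comp_assoc, comp_distTriang_mor_zero₁₂ T hT, Functor.map_zero, zero_comp,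
      comp_zero]
  have e : (shortComplexOfDistTriangle T hT).map F ≅ ShortComplex.mk _ _ hz :=
    ShortComplex.isoMk (F.mapIso e₁ ≪≫ α X) (F.mapIso e₂ ≪≫ α Y) (F.mapIso e₃ ≪≫ α Z)
      h1.symm h2.symm
  exact (ShortComplex.ShortExact.moduleCat_exact_iff_function_exact _).1
    ((ShortComplex.exact_iff_of_iso e).1 hex)

/-- The shift of a map of complexes. -/
def shiftHom (φ : X ⟶ Y) (n : ℤ) : X⟦n⟧ ⟶ Y⟦n⟧ :=
  (CategoryTheory.shiftFunctor _ n).map φ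

/-- The connecting map of a mapping cone. -/
def coneConnecting (φ : X ⟶ Y) : mappingCone φ ⟶ X⟦(1 : ℤ)⟧ := (mappingCone.triangle φ).mor₃

/-- The quotient functor to the homotopy category commutes with the shift. -/
def quotientShift (X : CochainComplex (ModuleCat.{u} k) ℤ) :
    ((HomotopyCategory.quotient (ModuleCat.{u} k) (ComplexShape.up ℤ)).obj X)⟦(1 : ℤ)⟧ ≅
      (HomotopyCategory.quotient _ _).obj (X⟦(1 : ℤ)⟧) :=
  ((HomotopyCategory.quotient _ _).commShiftIso (1 : ℤ)).symm.app X

theorem quotientShift_naturality (φ : X ⟶ Y) :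
    ((HomotopyCategory.quotient _ _).map φ)⟦(1 : ℤ)⟧' ≫ (quotientShift Y).hom =
      (quotientShift X).hom ≫ (HomotopyCategory.quotient _ _).map (shiftHom φ 1) :=
  ((HomotopyCategory.quotient (ModuleCat.{u} k) (ComplexShape.up ℤ)).commShiftIso
    (1 : ℤ)).inv.naturality φ

variable (φ : X ⟶ Y)

theorem triangleh_mor₃_quotientShift :
    (mappingCone.triangleh φ).mor₃ ≫ (quotientShift X).hom =
      (HomotopyCategory.quotient _ _).map (coneConnecting φ) := by
  refine (Category.assoc _ _ _).trans ((whisker_eq _ ?_).trans (Category.comp_id _))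
  exact Iso.hom_inv_id_app _ _

theorem exact_homologyMap_inr (b : ℤ) :
    Function.Exact (homologyMap φ b) (homologyMap (mappingCone.inr φ) b) :=
  exact_homologyMap_of_distinguished (mappingCone.triangleh φ)
    (HomotopyCategory.mappingCone_triangleh_distinguished φ) _ _ (Iso.refl _) (Iso.refl _) (Iso.refl _)
    ((Category.comp_id _).trans (Category.id_comp _).symm)
    ((Category.comp_id _).trans (Category.id_comp _).symm) b

theorem exact_inr_coneConnecting (b : ℤ) :
    Function.Exact (homologyMap (mappingCone.inr φ) b) (homologyMap (coneConnecting φ) b) :=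
  exact_homologyMap_of_distinguished (mappingCone.triangleh φ).rotate
    (rot_of_distTriang _ (HomotopyCategory.mappingCone_triangleh_distinguished φ)) _ _
    (Iso.refl _) (Iso.refl _) (quotientShift X)
    ((Category.comp_id _).trans (Category.id_comp _).symm)
    ((triangleh_mor₃_quotientShift φ).trans (Category.id_comp _).symm) b

/-- Rotating twice gives the map `-φ[1]`; the sign does not change its kernel. -/
theorem exact_coneConnecting_shiftHom (b : ℤ) :
    Function.Exact (homologyMap (coneConnecting φ) b) (homologyMap (shiftHom φ 1) b) := by
  have hneg : (-((HomotopyCategory.quotient _ _).map φ)⟦(1 : ℤ)⟧') ≫ (quotientShift Y).hom =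
      (quotientShift X).hom ≫ (HomotopyCategory.quotient _ _).map (-shiftHom φ 1) := by
    rw [Functor.map_neg, Preadditive.comp_neg, Preadditive.neg_comp, quotientShift_naturality]
  have h := exact_homologyMap_of_distinguished (mappingCone.triangleh φ).rotate.rotate
    (rot_of_distTriang _ (rot_of_distTriang _
      (HomotopyCategory.mappingCone_triangleh_distinguished φ)))
    (coneConnecting φ) (-shiftHom φ 1) (Iso.refl _) (quotientShift X) (quotientShift Y)
    ((triangleh_mor₃_quotientShift φ).trans (Category.id_comp _).symm) hneg b
  intro x
  rw [← h x, homologyMap_neg]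
  exact neg_eq_zero.symm

end ConeSequence

/-! ### The homotopy fibre of an endomorphism -/

section TelescopeSequence
open HomologicalComplex CochainComplex
variable {k : Type u} [Field k] {W : CochainComplex (ModuleCat.{u} k) ℤ} (φ : W ⟶ W)

/-- The projection of the homotopy fibre of `φ` to the source of `φ`. -/
def fibreProj : (mappingCone φ)⟦(-1 : ℤ)⟧ ⟶ W :=
  shiftHom (coneConnecting φ) (-1) ≫ (shiftShiftNeg W (1 : ℤ)).hom

/-- The isomorphism `H^a(K[n]) ≅ H^b(K)`, `n + a = b`. -/
def hshift (K : CochainComplex (ModuleCat.{u} k) ℤ) (n a b : ℤ) (h : n + a = b) :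
    (K⟦n⟧).homology a ≅ K.homology b :=
  (CochainComplex.ShiftSequence.shiftIso (ModuleCat.{u} k) n a b h).app K

theorem hshift_naturality {K L : CochainComplex (ModuleCat.{u} k) ℤ} (f : K ⟶ L) (n a b : ℤ)
    (h : n + a = b) :
    homologyMap (shiftHom f n) a ≫ (hshift L n a b h).hom = (hshift K n a b h).hom ≫ homologyMap f b :=
  (CochainComplex.ShiftSequence.shiftIso (ModuleCat.{u} k) n a b h).hom.naturality f

theorem homologyMap_shiftHom_apply {K L : CochainComplex (ModuleCat.{u} k) ℤ} (f : K ⟶ L)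
    {n a b : ℤ} (h : n + a = b) (x : (K⟦n⟧).homology a) :
    (hshift L n a b h).hom (homologyMap (shiftHom f n) a x) =
      homologyMap f b ((hshift K n a b h).hom x) :=
  congrArg (fun t => t.hom x) (hshift_naturality f n a b h)

theorem iso_hom_injective {M N : ModuleCat.{u} k} (e : M ≅ N) : Function.Injective e.hom :=
  (ModuleCat.mono_iff_injective e.hom).1 inferInstance

theorem iso_hom_surjective {M N : ModuleCat.{u} k} (e : M ≅ N) : Function.Surjective e.hom :=
  (ModuleCat.epi_iff_surjective e.hom).1 inferInstance

theorem homologyMap_fibreProj_apply (a : ℤ) (x : ((mappingCone φ)⟦(-1 : ℤ)⟧).homology a) :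
    homologyMap (fibreProj φ) a x = homologyMap (shiftShiftNeg W (1 : ℤ)).hom a
      (homologyMap (shiftHom (coneConnecting φ) (-1)) a x) :=
  congrArg (fun t : ((mappingCone φ)⟦(-1 : ℤ)⟧).homology a ⟶ W.homology a => t.hom x)
    (homologyMap_comp (shiftHom (coneConnecting φ) (-1)) (shiftShiftNeg W (1 : ℤ)).hom a)

/-- Shifting back and forth, on homology. -/
def hshiftShiftNeg (W : CochainComplex (ModuleCat.{u} k) ℤ) (a : ℤ) :
    ((W⟦(1 : ℤ)⟧)⟦(-1 : ℤ)⟧).homology a ≅ W.homology a :=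
  (homologyFunctor _ _ a).mapIso (shiftShiftNeg W (1 : ℤ))

/-- The kernel of the projection is the cokernel of `φ` one degree lower. For the telescope this is
the `lim¹` term. -/
theorem fibreProj_injective (a : ℤ) (hφ : Function.Surjective (homologyMap φ (-1 + a))) :
    Function.Injective (homologyMap (fibreProj φ) a) := by
  rw [injective_iff_map_eq_zero]
  intro x hx
  rw [homologyMap_fibreProj_apply] at hx
  have h1 : homologyMap (shiftHom (coneConnecting φ) (-1)) a x = 0 :=
    iso_hom_injective (hshiftShiftNeg W a) (hx.trans (map_zero (hshiftShiftNeg W a).hom.hom).symm)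
  have h2 := homologyMap_shiftHom_apply (coneConnecting φ) (rfl : -1 + a = -1 + a) x
  rw [h1, map_zero] at h2
  obtain ⟨y, hy⟩ := (exact_inr_coneConnecting φ _ _).1 h2.symm
  obtain ⟨z, rfl⟩ := hφ y
  rw [(exact_homologyMap_inr φ _).apply_apply_eq_zero] at hy
  exact iso_hom_injective (hshift _ (-1) a _ rfl) (hy.symm.trans (map_zero _).symm)

theorem hshiftShiftNeg_naturality (a : ℤ) (x : ((W⟦(1 : ℤ)⟧)⟦(-1 : ℤ)⟧).homology a) :
    (hshiftShiftNeg W a).hom (homologyMap (shiftHom (shiftHom φ 1) (-1)) a x) =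
      homologyMap φ a ((hshiftShiftNeg W a).hom x) := by
  have h : shiftHom (shiftHom φ 1) (-1) ≫ (shiftShiftNeg W (1 : ℤ)).hom =
      (shiftShiftNeg W (1 : ℤ)).hom ≫ φ :=
    (shiftFunctorCompIsoId (CochainComplex (ModuleCat.{u} k) ℤ) (1 : ℤ) (-1) (by simp)).hom.naturality φ
  have h' := (homologyMap_comp _ _ a).symm.trans
    ((congrArg (fun t => homologyMap t a) h).trans (homologyMap_comp _ _ a))
  exact congrArg (fun t : ((W⟦(1 : ℤ)⟧)⟦(-1 : ℤ)⟧).homology a ⟶ W.homology a => t.hom x) h'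

theorem fibreProj_exact (a : ℤ) :
    Function.Exact (homologyMap (fibreProj φ) a) (homologyMap φ a) := by
  intro w
  obtain ⟨v, rfl⟩ := iso_hom_surjective (hshiftShiftNeg W a) w
  rw [← hshiftShiftNeg_naturality]
  have h0 : (hshiftShiftNeg W a).hom (homologyMap (shiftHom (shiftHom φ 1) (-1)) a v) = 0 ↔
      homologyMap (shiftHom φ 1) (-1 + a) ((hshift _ (-1) a _ rfl).hom v) = 0 := by
    rw [← homologyMap_shiftHom_apply]
    rw [map_eq_zero_iff _ (iso_hom_injective _), map_eq_zero_iff _ (iso_hom_injective _)]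
  rw [h0, exact_coneConnecting_shiftHom φ (-1 + a)]
  constructor
  · rintro ⟨y, hy⟩
    obtain ⟨x, rfl⟩ := iso_hom_surjective (hshift _ (-1) a _ rfl) y
    rw [← homologyMap_shiftHom_apply] at hy
    refine ⟨x, (homologyMap_fibreProj_apply φ a x).trans ?_⟩
    rw [iso_hom_injective _ hy]
    rfl
  · rintro ⟨x, hx⟩
    rw [homologyMap_fibreProj_apply] at hx
    have h1 : homologyMap (shiftHom (coneConnecting φ) (-1)) a x = v :=
      iso_hom_injective (hshiftShiftNeg W a) hx
    exact ⟨(hshift _ (-1) a _ rfl).hom x, by rw [← homologyMap_shiftHom_apply, h1]⟩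

end TelescopeSequence

/-! ### Homology of a product of complexes -/

section ProductHomology
open HomologicalComplex
variable {k : Type u} [Field k]

theorem exists_cycle_of_d_eq_zero (L : CochainComplex (ModuleCat.{u} k) ℤ) {b c : ℤ} (h : b + 1 = c)
    (x : L.X b) (hx : L.d b c x = 0) : ∃ z : L.cycles b, L.iCycles b z = x := by
  subst h
  let f : ModuleCat.of k k ⟶ L.X b := ModuleCat.ofHom (LinearMap.toSpanSingleton k _ x)
  have hf : f ≫ L.d b (b + 1) = 0 := by
    refine ModuleCat.hom_ext (LinearMap.ext_ring ?_)
    change L.d b (b + 1) ((1 : k) • x) = 0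
    rw [one_smul, hx]
  refine ⟨L.liftCycles f (b + 1) (by simp) hf (1 : k), ?_⟩
  refine (congrArg (fun t : ModuleCat.of k k ⟶ L.X b => t.hom (1 : k))
    (L.liftCycles_i f (b + 1) (by simp) hf)).trans ?_
  exact one_smul k x

theorem d_iCycles_apply (L : CochainComplex (ModuleCat.{u} k) ℤ) (b c : ℤ) (z : L.cycles b) :
    L.d b c (L.iCycles b z) = 0 :=
  congrArg (fun t : L.cycles b ⟶ L.X c => t.hom z) (L.iCycles_d b c)

theorem iCycles_injective (L : CochainComplex (ModuleCat.{u} k) ℤ) (b : ℤ) :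
    Function.Injective (L.iCycles b) :=
  (ModuleCat.mono_iff_injective _).1 inferInstance

theorem homologyπ_surjective (L : CochainComplex (ModuleCat.{u} k) ℤ) (b : ℤ) :
    Function.Surjective (L.homologyπ b) :=
  (ModuleCat.epi_iff_surjective _).1 inferInstance

theorem homologyπ_eq_zero_iff (L : CochainComplex (ModuleCat.{u} k) ℤ) {a b : ℤ} (h : a + 1 = b)
    (z : L.cycles b) : L.homologyπ b z = 0 ↔ ∃ y : L.X a, L.d a b y = L.iCycles b z := by
  have hex : (ShortComplex.mk _ _ (L.toCycles_comp_homologyπ a b)).Exact :=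
    ShortComplex.exact_of_g_is_cokernel _ (L.homologyIsCokernel a b (by simp [← h]))
  have hex' := (ShortComplex.ShortExact.moduleCat_exact_iff_function_exact _).1 hex z
  refine hex'.trans ⟨?_, ?_⟩
  · rintro ⟨y, rfl⟩
    exact ⟨y, (congrArg (fun t : L.X a ⟶ L.X b => t.hom y) (L.toCycles_i a b)).symm⟩
  · rintro ⟨y, hy⟩
    refine ⟨y, iCycles_injective L b ?_⟩
    exact (congrArg (fun t : L.X a ⟶ L.X b => t.hom y) (L.toCycles_i a b)).trans hy

theorem homologyMap_homologyπ_apply {L M : CochainComplex (ModuleCat.{u} k) ℤ} (f : L ⟶ M) (b : ℤ)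
    (z : L.cycles b) : homologyMap f b (L.homologyπ b z) = M.homologyπ b (cyclesMap f b z) :=
  congrArg (fun t : L.cycles b ⟶ M.homology b => t.hom z) (homologyπ_naturality f b)

theorem iCycles_cyclesMap_apply {L M : CochainComplex (ModuleCat.{u} k) ℤ} (f : L ⟶ M) (b : ℤ)
    (z : L.cycles b) : M.iCycles b (cyclesMap f b z) = f.f b (L.iCycles b z) :=
  congrArg (fun t : L.cycles b ⟶ M.X b => t.hom z) (cyclesMap_i f b)

theorem hom_f_d_apply {L M : CochainComplex (ModuleCat.{u} k) ℤ} (f : L ⟶ M) (b c : ℤ)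
    (x : L.X b) : M.d b c (f.f b x) = f.f c (L.d b c x) :=
  congrArg (fun t : L.X b ⟶ M.X c => t.hom x) (f.comm b c)

variable (K : ℕ → CochainComplex (ModuleCat.{u} k) ℤ)

/-- The terms of a product of complexes are the products of the terms. -/
def piEvalIsLimit (b : ℤ) : IsLimit (Fan.mk ((∏ᶜ K).X b) fun i => (Pi.π K i).f b) :=
  isLimitFanMkObjOfIsLimit (HomologicalComplex.eval (ModuleCat.{u} k) (ComplexShape.up ℤ) b) K
    (Pi.π K) (productIsProduct K)

theorem exists_pi_f_eq (b : ℤ) (v : ∀ i, (K i).X b) :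
    ∃ x : (∏ᶜ K : CochainComplex (ModuleCat.{u} k) ℤ).X b, ∀ i, (Pi.π K i).f b x = v i := by
  let s : Fan fun i => (K i).X b := Fan.mk (ModuleCat.of k k) fun i =>
    ModuleCat.ofHom (LinearMap.toSpanSingleton k _ (v i))
  refine ⟨(piEvalIsLimit K b).lift s (1 : k), fun i => ?_⟩
  refine (congrArg (fun t : ModuleCat.of k k ⟶ (K i).X b => t.hom (1 : k))
    ((piEvalIsLimit K b).fac s ⟨i⟩)).trans ?_
  exact one_smul k (v i)

theorem pi_f_ext (b : ℤ) (x y : (∏ᶜ K : CochainComplex (ModuleCat.{u} k) ℤ).X b)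
    (h : ∀ i, (Pi.π K i).f b x = (Pi.π K i).f b y) : x = y := by
  have : ModuleCat.ofHom (LinearMap.toSpanSingleton k _ x) =
      ModuleCat.ofHom (LinearMap.toSpanSingleton k _ y) := by
    refine (piEvalIsLimit K b).hom_ext fun ⟨i⟩ => ModuleCat.hom_ext (LinearMap.ext_ring ?_)
    change (Pi.π K i).f b ((1 : k) • x) = (Pi.π K i).f b ((1 : k) • y)
    rw [one_smul, one_smul, h]
  have h1 := congrArg (fun t : ModuleCat.of k k ⟶ (∏ᶜ K : CochainComplex (ModuleCat.{u} k) ℤ).X b =>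
    t.hom (1 : k)) this
  exact (one_smul k x).symm.trans (h1.trans (one_smul k y))

theorem exists_homologyMap_pi_eq (b : ℤ) (v : ∀ i, (K i).homology b) :
    ∃ x : (∏ᶜ K : CochainComplex (ModuleCat.{u} k) ℤ).homology b,
      ∀ i, homologyMap (Pi.π K i) b x = v i := by
  choose c hc using fun i => homologyπ_surjective (K i) b (v i)
  obtain ⟨x, hx⟩ := exists_pi_f_eq K b fun i => (K i).iCycles b (c i)
  obtain ⟨z, hz⟩ := exists_cycle_of_d_eq_zero (∏ᶜ K) rfl x (by
    refine pi_f_ext K _ _ _ fun i => ?_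
    rw [← hom_f_d_apply, hx, d_iCycles_apply, map_zero])
  refine ⟨(∏ᶜ K : CochainComplex (ModuleCat.{u} k) ℤ).homologyπ b z, fun i => ?_⟩
  rw [homologyMap_homologyπ_apply, ← hc]
  congr 1
  refine iCycles_injective _ b ?_
  rw [iCycles_cyclesMap_apply, hz, hx]

/-- Primitives chosen in each factor assemble to a primitive in the product, because products are
formed degreewise. -/
theorem homology_pi_eq_zero (b : ℤ) (x : (∏ᶜ K : CochainComplex (ModuleCat.{u} k) ℤ).homology b)
    (h : ∀ i, homologyMap (Pi.π K i) b x = 0) : x = 0 := by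
  obtain ⟨z, rfl⟩ := homologyπ_surjective _ b x
  have h' (i : ℕ) : ∃ y : (K i).X (b - 1), (K i).d (b - 1) b y =
      (Pi.π K i).f b ((∏ᶜ K : CochainComplex (ModuleCat.{u} k) ℤ).iCycles b z) := by
    rw [← iCycles_cyclesMap_apply, ← homologyπ_eq_zero_iff _ (by ring), ← homologyMap_homologyπ_apply, h]
  choose y hy using h'
  obtain ⟨w, hw⟩ := exists_pi_f_eq K (b - 1) y
  rw [homologyπ_eq_zero_iff _ (sub_add_cancel b 1)]
  exact ⟨w, pi_f_ext K _ _ _ fun i => by rw [← hom_f_d_apply, hw, hy]⟩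

end ProductHomology

/-! ### The derived limit of a tower with surjective transition maps -/

section TelescopeHomology
open HomologicalComplex CochainComplex
variable {k : Type u} [Field k] {K : CochainComplex (ModuleCat.{u} k) ℤ}

/-- The action of a degree `2` endomorphism on homology. -/
def towerAct (U : K ⟶ K⟦(2 : ℤ)⟧) (b b' : ℤ) (h : 2 + b = b') : K.homology b ⟶ K.homology b' :=
  homologyMap U b ≫ (hshift K 2 b b' h).hom

variable (K) in
/-- The `i`-th component of a homology class of the product `∏_{i ≥ 0} K[-2i]`. -/
def towerProdEval (i : ℕ) (a b : ℤ) (h : -2 * (i : ℤ) + a = b) :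
    (towerProd K).homology a ⟶ K.homology b :=
  homologyMap (Pi.π (fun i : ℕ => K⟦(-2 * (i : ℤ))⟧) i) a ≫ (hshift K (-2 * (i : ℤ)) a b h).hom

/-- The `i`-th component of a homology class of the derived inverse limit. -/
def telescopeEval (U : K ⟶ K⟦(2 : ℤ)⟧) (i : ℕ) (a b : ℤ) (h : -2 * (i : ℤ) + a = b) :
    (telescope U).homology a ⟶ K.homology b :=
  homologyMap (telescopeProj U i) a ≫ (hshift K (-2 * (i : ℤ)) a b h).hom

/-- After the shift identifications every transition map of the tower becomes the action of `U`; the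
shift isomorphisms are compatible with addition of shifts. -/
theorem homologyMap_towerMap (U : K ⟶ K⟦(2 : ℤ)⟧) (i : ℕ) (a b c : ℤ)
    (hc : -2 * ((i + 1 : ℕ) : ℤ) + a = c) (hb : 2 + c = b) (hb' : -2 * (i : ℤ) + a = b) :
    homologyMap (towerMap U i) a ≫ (hshift K (-2 * (i : ℤ)) a b hb').hom =
      (hshift K (-2 * ((i + 1 : ℕ) : ℤ)) a c hc).hom ≫ towerAct U c b hb := by
  have h1 := Functor.shiftIso_hom_app_comp
    (homologyFunctor (ModuleCat.{u} k) (ComplexShape.up ℤ) 0) (-2 * ((i + 1 : ℕ) : ℤ)) 2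
    (-2 * (i : ℤ)) (by push_cast; ring) a c b hc hb K
  refine (eq_whisker (homologyMap_comp (shiftHom U (-2 * ((i + 1 : ℕ) : ℤ))) _ a) _).trans ?_
  refine (Category.assoc _ _ _).trans ((whisker_eq _ h1.symm).trans ?_)
  refine (Category.assoc _ _ _).symm.trans ((eq_whisker (hshift_naturality U _ a c hc) _).trans ?_)
  exact Category.assoc _ _ _

theorem towerProdEval_idSubShift (U : K ⟶ K⟦(2 : ℤ)⟧) (i : ℕ) (a b c : ℤ)
    (hc : -2 * ((i + 1 : ℕ) : ℤ) + a = c) (hb : 2 + c = b) (hb' : -2 * (i : ℤ) + a = b)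
    (x : (towerProd K).homology a) :
    towerProdEval K i a b hb' (homologyMap (idSubShift U) a x) =
      towerProdEval K i a b hb' x - towerAct U c b hb (towerProdEval K (i + 1) a c hc x) := by
  have h0 : idSubShift U ≫ Pi.π (fun i : ℕ => K⟦(-2 * (i : ℤ))⟧) i =
      Pi.π (fun i : ℕ => K⟦(-2 * (i : ℤ))⟧) i -
        Pi.π (fun i : ℕ => K⟦(-2 * (i : ℤ))⟧) (i + 1) ≫ towerMap U i := by
    refine (Preadditive.sub_comp _ _ _).trans ?_
    exact congrArg₂ (· - ·) (Category.id_comp _) (Pi.lift_π _ _)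
  have h1 : homologyMap (idSubShift U) a ≫ towerProdEval K i a b hb' =
      towerProdEval K i a b hb' - towerProdEval K (i + 1) a c hc ≫ towerAct U c b hb := by
    refine (Category.assoc _ _ _).symm.trans ?_
    refine (eq_whisker ((homologyMap_comp _ _ a).symm.trans
      ((congrArg (fun t => homologyMap t a) h0).trans (homologyMap_sub _ _ a))) _).trans ?_
    refine (Preadditive.sub_comp _ _ _).trans ?_
    refine congrArg₂ (· - ·) rfl ?_
    refine (eq_whisker (homologyMap_comp _ _ a) _).trans ((Category.assoc _ _ _).trans ?_)
    exact (whisker_eq _ (homologyMap_towerMap U i a b c hc hb hb')).trans (Category.assoc _ _ _).symm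
  exact congrArg (fun t : (towerProd K).homology a ⟶ K.homology b => t.hom x) h1

theorem telescopeEval_eq (U : K ⟶ K⟦(2 : ℤ)⟧) (i : ℕ) (a b : ℤ) (h : -2 * (i : ℤ) + a = b)
    (x : (telescope U).homology a) :
    telescopeEval U i a b h x =
      towerProdEval K i a b h (homologyMap (fibreProj (idSubShift U)) a x) := by
  have h0 : telescopeProj U i = fibreProj (idSubShift U) ≫ Pi.π _ i := (Category.assoc _ _ _).symm
  have h1 : telescopeEval U i a b h =
      homologyMap (fibreProj (idSubShift U)) a ≫ towerProdEval K i a b h :=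
    (eq_whisker ((congrArg (fun t => homologyMap t a) h0).trans (homologyMap_comp _ _ a)) _).trans
      (Category.assoc _ _ _)
  exact congrArg (fun t : (telescope U).homology a ⟶ K.homology b => t.hom x) h1

theorem exists_towerProdEval_eq (a : ℤ) (b : ℕ → ℤ) (hb : ∀ i : ℕ, -2 * (i : ℤ) + a = b i)
    (v : ∀ i, K.homology (b i)) :
    ∃ x : (towerProd K).homology a, ∀ i, towerProdEval K i a (b i) (hb i) x = v i := by
  choose w hw using fun i : ℕ => iso_hom_surjective (hshift K (-2 * (i : ℤ)) a (b i) (hb i)) (v i)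
  obtain ⟨x, hx⟩ := exists_homologyMap_pi_eq (fun i : ℕ => K⟦(-2 * (i : ℤ))⟧) a w
  exact ⟨x, fun i => (congrArg (hshift K (-2 * (i : ℤ)) a (b i) (hb i)).hom (hx i)).trans (hw i)⟩

theorem towerProd_homology_eq_zero (a : ℤ) (b : ℕ → ℤ) (hb : ∀ i : ℕ, -2 * (i : ℤ) + a = b i)
    (x : (towerProd K).homology a) (h : ∀ i, towerProdEval K i a (b i) (hb i) x = 0) : x = 0 := by
  refine homology_pi_eq_zero (fun i : ℕ => K⟦(-2 * (i : ℤ))⟧) a x fun i => ?_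
  exact iso_hom_injective (hshift K (-2 * (i : ℤ)) a (b i) (hb i))
    ((h i).trans (map_zero (hshift K (-2 * (i : ℤ)) a (b i) (hb i)).hom.hom).symm)

theorem towerAct_telescopeEval (U : K ⟶ K⟦(2 : ℤ)⟧) (i : ℕ) (a b c : ℤ)
    (hc : -2 * ((i + 1 : ℕ) : ℤ) + a = c) (hb : 2 + c = b) (hb' : -2 * (i : ℤ) + a = b)
    (x : (telescope U).homology a) :
    towerAct U c b hb (telescopeEval U (i + 1) a c hc x) = telescopeEval U i a b hb' x := by
  rw [telescopeEval_eq, telescopeEval_eq]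
  have h := towerProdEval_idSubShift U i a b c hc hb hb' (homologyMap (fibreProj (idSubShift U)) a x)
  have h0 := (congrArg (towerProdEval K i a b hb')
    ((fibreProj_exact (idSubShift U) a).apply_apply_eq_zero x)).trans (map_zero _)
  exact (sub_eq_zero.1 (h.symm.trans h0)).symm

/-- A compatible family is an element of the product killed by `id - tU`, hence lifts to the
homotopy fibre. Surjectivity of `U` plays no role here. -/
theorem exists_telescopeEval_eq (U : K ⟶ K⟦(2 : ℤ)⟧) (a : ℤ) (b : ℕ → ℤ)
    (hb : ∀ i : ℕ, -2 * (i : ℤ) + a = b i) (hb' : ∀ i, 2 + b (i + 1) = b i)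
    (v : ∀ i, K.homology (b i)) (hv : ∀ i, towerAct U _ _ (hb' i) (v (i + 1)) = v i) :
    ∃ x : (telescope U).homology a, ∀ i, telescopeEval U i a (b i) (hb i) x = v i := by
  obtain ⟨w, hw⟩ := exists_towerProdEval_eq a b hb v
  obtain ⟨x, hx⟩ := (fibreProj_exact (idSubShift U) a w).1 (by
    refine towerProd_homology_eq_zero a b hb _ fun i => ?_
    rw [towerProdEval_idSubShift U i a (b i) (b (i + 1)) (hb (i + 1)) (hb' i) (hb i), hw, hw, hv,
      sub_self])
  exact ⟨x, fun i => (telescopeEval_eq U i a (b i) (hb i) x).trans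
    ((congrArg (towerProdEval K i a (b i) (hb i)) hx).trans (hw i))⟩

theorem homologyMap_idSubShift_surjective (U : K ⟶ K⟦(2 : ℤ)⟧)
    (hU : ∀ b b' h, Function.Surjective (towerAct U b b' h)) (a : ℤ) :
    Function.Surjective (homologyMap (idSubShift U) a) := by
  intro y
  let b (i : ℕ) : ℤ := -2 * (i : ℤ) + a
  have hb (i : ℕ) : 2 + b (i + 1) = b i := by simp only [b]; push_cast; ring
  choose s hs using fun i => hU (b (i + 1)) (b i) (hb i)
  -- Solves `x_i - U x_{i+1} = y_i` recursively, with `x_0 = 0` and `x_{i+1}` a preimage of `x_i -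
  -- y_i`.
  let v (i : ℕ) : K.homology (b i) :=
    Nat.rec (motive := fun i => K.homology (b i)) 0
      (fun i x => s i (x - towerProdEval K i a (b i) rfl y)) i
  obtain ⟨x, hx⟩ := exists_towerProdEval_eq a b (fun _ => rfl) v
  refine ⟨x, sub_eq_zero.1 (towerProd_homology_eq_zero a b (fun _ => rfl) _ fun i => ?_)⟩
  have hv : towerAct U _ _ (hb i) (v (i + 1)) = v i - towerProdEval K i a (b i) rfl y := hs i _
  rw [map_sub, towerProdEval_idSubShift U i a (b i) (b (i + 1)) rfl (hb i) rfl, hx, hx, hv]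
  abel

theorem telescopeEval_ext (U : K ⟶ K⟦(2 : ℤ)⟧)
    (hU : ∀ b b' h, Function.Surjective (towerAct U b b' h)) (a : ℤ) (b : ℕ → ℤ)
    (hb : ∀ i : ℕ, -2 * (i : ℤ) + a = b i) (x : (telescope U).homology a)
    (h : ∀ i, telescopeEval U i a (b i) (hb i) x = 0) : x = 0 := by
  refine fibreProj_injective (idSubShift U) a (homologyMap_idSubShift_surjective U hU _) ?_
  refine (towerProd_homology_eq_zero a b hb _ fun i => ?_).trans (map_zero _).symm
  rw [← telescopeEval_eq, h]

end TelescopeHomology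

/-! ### Divisible towers, polynomials in `u⁻¹` and Laurent series -/

/-- In the polynomials of a given degree all families of coefficients are finite. -/
def polyInvEquiv {k : Type u} [Field k] {H : ℤ → ModuleCat.{u} k} (hH : ∀ n < 0, Subsingleton (H n))
    (n : ℤ) :
    PolyInv H n ≃ₗ[k] ∀ s : {s : ℤ × ℕ // s.1 + 2 * (s.2 : ℤ) = n}, H s.1.1 :=
  LinearEquiv.ofBijective
    (LinearMap.pi fun s => DirectSum.component k _ (fun s => H s.1.1) s) <| by
    classical
    constructor
    · intro x y h
      exact DFinsupp.ext fun s => congrFun h s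
    · intro a
      -- Nonzero coefficients need `i ≥ 0`, and `i + 2l = n` then bounds both indices.
      have hfin : {s : {s : ℤ × ℕ // s.1 + 2 * (s.2 : ℤ) = n} | 0 ≤ s.1.1}.Finite := by
        refine Set.Finite.of_injOn (f := fun s => s.1) (t := Set.Icc (0 : ℤ) n ×ˢ Set.Iic n.toNat)
          ?_ Subtype.val_injective.injOn ((Set.finite_Icc 0 n).prod (Set.finite_Iic n.toNat))
        rintro ⟨⟨i, l⟩, h⟩ (hs : 0 ≤ i)
        simp only at h
        refine ⟨⟨hs, ?_⟩, ?_⟩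
        · change i ≤ n
          omega
        · change l ≤ n.toNat
          omega
      let β (s : {s : ℤ × ℕ // s.1 + 2 * (s.2 : ℤ) = n}) : Type u := H s.1.1
      let _ (s) : AddCommMonoid (β s) := inferInstanceAs (AddCommMonoid (H s.1.1))
      refine ⟨DirectSum.mk β hfin.toFinset fun s => a s, funext fun s => ?_⟩
      by_cases hs : s ∈ hfin.toFinset
      · exact DirectSum.mk_apply_of_mem (β := β) (f := fun s => a s) hs
      · have := hH s.1.1 (by simpa using hs)
        exact Subsingleton.elim _ _

/-- A graded space `M`, vanishing in negative degrees, with a surjective operator `u` of degree `-2`,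
and a graded space `H` identified with the kernel of `u`, with a retraction of `M` onto it. -/
structure DivisibleTower {k : Type u} [Field k] (M H : ℤ → ModuleCat.{u} k) where
  act : ∀ n n' : ℤ, n' + 2 = n → (M n →ₗ[k] M n')
  incl : ∀ n, H n →ₗ[k] M n
  retract : ∀ n, M n →ₗ[k] H n
  retract_incl : ∀ n y, retract n (incl n y) = y
  exact : ∀ n n' h, Function.Exact (incl n) (act n n' h)
  surjective : ∀ n n' h, Function.Surjective (act n n' h)
  subsingleton : ∀ n < 0, Subsingleton (M n)

namespace DivisibleTower
variable {k : Type u} [Field k] {M H : ℤ → ModuleCat.{u} k} (T : DivisibleTower M H)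

theorem subsingleton_coefficients {M H : ℤ → ModuleCat.{u} k} (T : DivisibleTower M H) (n : ℤ)
    (h : n < 0) : Subsingleton (H n) :=
  have := T.subsingleton n h
  (Function.LeftInverse.injective (T.retract_incl n)).subsingleton

/-- The coefficient at `u^{-l}` of an element `x` of `M n`: the retraction of `u^l x`. -/
def coefficient : ∀ (l : ℕ) (n i : ℤ), i + 2 * (l : ℤ) = n → (M n →ₗ[k] H i)
  | 0, n, i, h => (show i = n by simpa using h) ▸ T.retract i
  | l + 1, n, i, h => (coefficient l (n - 2) i (by push_cast at h; linarith)).comp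
      (T.act n (n - 2) (by ring))

theorem coefficient_zero (n : ℤ) (h : n + 2 * ((0 : ℕ) : ℤ) = n) :
    T.coefficient 0 n n h = T.retract n := rfl

theorem coefficient_act (l : ℕ) (n n' i : ℤ) (hn : n' + 2 = n) (h : i + 2 * (l : ℤ) = n')
    (h' : i + 2 * ((l + 1 : ℕ) : ℤ) = n) (x : M n) :
    T.coefficient l n' i h (T.act n n' hn x) = T.coefficient (l + 1) n i h' x := by
  obtain rfl : n' = n - 2 := by linarith
  rfl

/-- The coefficients of `u x` are those of `x` shifted by one, so `u x = 0` by induction on a bound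
for the degree. Then `x` lies in the image of `H n` and is recovered from its constant coefficient.
-/
theorem eq_zero_of_coefficient_eq_zero (n : ℤ) (x : M n)
    (hx : ∀ l i h, T.coefficient l n i h x = 0) : x = 0 := by
  obtain ⟨N, hN⟩ : ∃ N : ℕ, n < N := ⟨(n + 1).toNat, by omega⟩
  induction N generalizing n with
  | zero =>
    have := T.subsingleton n (by simpa using hN)
    exact Subsingleton.elim _ _
  | succ N ih =>
    have h0 : T.act n (n - 2) (by ring) x = 0 :=
      ih (n - 2) _ (fun l i h => by
        rw [T.coefficient_act l n (n - 2) i (by ring) h (by push_cast; linarith), hx])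
        (by push_cast at hN; linarith)
    obtain ⟨y, rfl⟩ := (T.exact n (n - 2) (by ring) x).1 h0
    have h1 := hx 0 n (by simp)
    rw [coefficient_zero, T.retract_incl] at h1
    rw [h1, map_zero]

theorem exists_coefficient_eq (n : ℤ) (a : ∀ (l : ℕ) (i : ℤ), i + 2 * (l : ℤ) = n → H i) :
    ∃ x : M n, ∀ l i h, T.coefficient l n i h x = a l i h := by
  obtain ⟨N, hN⟩ : ∃ N : ℕ, n < N := ⟨(n + 1).toNat, by omega⟩
  induction N generalizing n with
  | zero =>
    refine ⟨0, fun l i h => ?_⟩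
    have := T.subsingleton_coefficients i (by push_cast at hN; omega)
    exact Subsingleton.elim _ _
  | succ N ih =>
    obtain ⟨x', hx'⟩ := ih (n - 2) (fun l i h => a (l + 1) i (by push_cast; linarith))
      (by push_cast at hN; linarith)
    obtain ⟨x, rfl⟩ := T.surjective n (n - 2) (by ring) x'
    -- The lift `x` of `x'` already has the right higher coefficients. A correction from the kernel
    -- of `u` adjusts the constant one without changing the others.
    refine ⟨x + T.incl n (a 0 n (by simp) - T.retract n x), fun l i h => ?_⟩
    cases l with
    | zero =>
      obtain rfl : i = n := by simpa using h
      rw [coefficient_zero, map_add, T.retract_incl]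
      abel
    | succ l =>
      rw [← T.coefficient_act l n (n - 2) i (by ring) (by push_cast at h; linarith), map_add,
        (T.exact n _ _).apply_apply_eq_zero, map_add, map_zero, hx']
      exact add_zero _

/-- An element of `M n` as the family of its coefficients. -/
def coefficientEquiv (n : ℤ) :
    M n ≃ₗ[k] ∀ s : {s : ℤ × ℕ // s.1 + 2 * (s.2 : ℤ) = n}, H s.1.1 :=
  LinearEquiv.ofBijective (LinearMap.pi fun s => T.coefficient s.1.2 n s.1.1 s.2) <| by
    constructor
    · rw [injective_iff_map_eq_zero]
      intro x hx
      exact T.eq_zero_of_coefficient_eq_zero n x fun l i h => congrFun hx ⟨(i, l), h⟩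
    · intro a
      obtain ⟨x, hx⟩ := T.exists_coefficient_eq n fun l i h => a ⟨(i, l), h⟩
      exact ⟨x, funext fun s => hx _ _ s.2⟩

/-- `M ≅ H[u⁻¹]`. -/
def equivPolyInv (n : ℤ) : M n ≃ₗ[k] PolyInv H n :=
  (T.coefficientEquiv n).trans (polyInvEquiv T.subsingleton_coefficients n).symm

theorem equivPolyInv_apply (n : ℤ) (x : M n) (i : ℤ) (l : ℕ) (h : i + 2 * (l : ℤ) = n) :
    T.equivPolyInv n x ⟨(i, l), h⟩ = T.coefficient l n i h x :=
  congrFun ((polyInvEquiv T.subsingleton_coefficients n).apply_symm_apply (T.coefficientEquiv n x)) ⟨(i, l), h⟩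

/-- The inverse limit of a tower, in each degree: the space of all `(x_m)`, `x_m ∈ M (n + 2m)`, with
`u x_{m+1} = x_m`. -/
structure Limit (P : ModuleCat.{u} k) (n : ℤ) where
  eval : ∀ (m : ℕ) (n' : ℤ), n + 2 * (m : ℤ) = n' → (P →ₗ[k] M n')
  act_eval : ∀ m n' n'' h h' h'' y, T.act n'' n' h'' (eval (m + 1) n'' h' y) = eval m n' h y
  ext : ∀ y, (∀ m, eval m _ rfl y = 0) → y = 0
  exists_eval_eq : ∀ v : ∀ m : ℕ, M (n + 2 * (m : ℤ)),
    (∀ m, T.act _ _ (by push_cast; ring) (v (m + 1)) = v m) → ∃ y, ∀ m, eval m _ rfl y = v m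

namespace Limit
variable {T} {P : ModuleCat.{u} k} {n : ℤ} (L : T.Limit P n)

/-- The coefficient of `u^{-l}` in the `m`-th term depends only on `m - l`, which makes the
coefficient of `u^{m-l}` of the Laurent series well defined. -/
theorem coefficient_eval_add (m l t : ℕ) (i : ℤ) (h : i + 2 * (l : ℤ) = n + 2 * (m : ℤ))
    (h' : i + 2 * ((l + t : ℕ) : ℤ) = n + 2 * ((m + t : ℕ) : ℤ)) (y : P) :
    T.coefficient (l + t) _ i h' (L.eval (m + t) _ rfl y) = T.coefficient l _ i h (L.eval m _ rfl y) := by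
  induction t with
  | zero => rfl
  | succ t ih =>
    rw [← ih (by push_cast; linarith), ← L.act_eval (m + t) _ _ rfl rfl (by push_cast; ring),
      T.coefficient_act]
    rfl

theorem coefficient_eval_congr {m m' l l' : ℕ} (i : ℤ) (h : i + 2 * (l : ℤ) = n + 2 * (m : ℤ))
    (h' : i + 2 * (l' : ℤ) = n + 2 * (m' : ℤ)) (y : P) :
    T.coefficient l _ i h (L.eval m _ rfl y) = T.coefficient l' _ i h' (L.eval m' _ rfl y) := by
  rcases le_total l l' with hl | hl
  · obtain ⟨t, rfl⟩ := Nat.exists_eq_add_of_le hl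
    obtain rfl : m' = m + t := by push_cast at h'; omega
    exact (L.coefficient_eval_add m l t i h h' y).symm
  · obtain ⟨t, rfl⟩ := Nat.exists_eq_add_of_le hl
    obtain rfl : m = m' + t := by push_cast at h; omega
    exact L.coefficient_eval_add m' l' t i h' h y

/-- The Laurent series of an element of the limit. -/
def toLaurent : P →ₗ[k] Laurent H n :=
  LinearMap.codRestrict (Laurent H n)
    (LinearMap.pi fun s => (T.coefficient (-s.1.2).toNat _ s.1.1 (by have := s.2; omega)).comp
      (L.eval s.1.2.toNat _ rfl))
    -- For `j < -|n|` the degree `i = n + 2j` is negative, where the coefficients vanish.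
    fun y => ⟨-|n|, fun s hs => by
      have := T.subsingleton_coefficients s.1.1
        (by have := s.2; have := neg_abs_le n; have := le_abs_self n; omega)
      exact Subsingleton.elim _ _⟩

theorem toLaurent_apply (y : P) (m l : ℕ) (i : ℤ) (h : i + 2 * (l : ℤ) = n + 2 * (m : ℤ))
    (h' : i - 2 * ((m : ℤ) - l) = n) :
    (L.toLaurent y).1 ⟨(i, (m : ℤ) - l), h'⟩ = T.coefficient l _ i h (L.eval m _ rfl y) :=
  L.coefficient_eval_congr i (by simp only; omega) h y

theorem toLaurent_bijective : Function.Bijective L.toLaurent := by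
  constructor
  · rw [injective_iff_map_eq_zero]
    intro y hy
    refine L.ext y fun m => T.eq_zero_of_coefficient_eq_zero _ _ fun l i h => ?_
    rw [← L.toLaurent_apply y m l i h (by linarith), hy]
    rfl
  · intro a
    have ha {i j j' : ℤ} (e : j = j') (h : i - 2 * j = n) (h' : i - 2 * j' = n) :
        a.1 ⟨(i, j), h⟩ = a.1 ⟨(i, j'), h'⟩ := by subst e; rfl
    -- The `m`-th term of the compatible family is `u^{-m} a` with its positive powers dropped.
    choose v hv using fun m : ℕ => T.exists_coefficient_eq (n + 2 * (m : ℤ)) fun l i h =>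
      a.1 ⟨(i, (m : ℤ) - l), by linarith⟩
    obtain ⟨y, hy⟩ := L.exists_eval_eq v fun m => by
      refine sub_eq_zero.1 (T.eq_zero_of_coefficient_eq_zero _ _ fun l i h => ?_)
      rw [map_sub, T.coefficient_act l _ _ i _ h (by push_cast; linarith), hv, hv, sub_eq_zero]
      exact ha (by push_cast; ring) _ _
    refine ⟨y, Subtype.ext (funext fun ⟨⟨i, j⟩, h⟩ => ?_)⟩
    -- Writes the exponent as `m - l` with natural numbers `m` and `l`, at least one of them zero,
    -- as in the definition of `toLaurent`.
    have hj : j = (j.toNat : ℤ) - ((-j).toNat : ℕ) := by omega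
    refine (congrArg (T.coefficient _ _ i _) (hy j.toNat)).trans ?_
    exact (hv _ _ _ _).trans (ha hj.symm _ _)

/-- The limit is the space of Laurent series. -/
def equivLaurent : P ≃ₗ[k] Laurent H n := LinearEquiv.ofBijective L.toLaurent L.toLaurent_bijective

end Limit
end DivisibleTower

/-! ### Cyclic and periodic cyclic homology of a pull-back -/

section CyclicTower
variable {k : Type u} [Field k]

theorem exists_retraction {V W : ModuleCat.{u} k} (f : V ⟶ W) (hf : Function.Injective f) :
    ∃ r : W →ₗ[k] V, ∀ x, r (f x) = x := by
  obtain ⟨r, hr⟩ := f.hom.exists_leftInverse_of_injective (LinearMap.ker_eq_bot.2 hf)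
  exact ⟨r, fun x => LinearMap.congr_fun hr x⟩

variable {p : ℕ} [NeZero p] [CharP k p]

/-- The tower of the cyclic homology of the pull-back of a cyclic vector space to `Λ_p`. -/
def cyclicTower (E : FunCat (Lambda 1) k) :
    DivisibleTower (HC (Lambda.proj p ⋙ E)) (HH E) :=
  let A : FunCat (Lambda p) k := Lambda.proj p ⋙ E
  let e (n : ℤ) : HH E n ≅ homologyOf (A ⊗ pointFun k p) n :=
    (nonempty_homologyOf_tensor_iso A n).some.symm
  let ι (n : ℤ) : HH E n ⟶ HC A n := (e n).hom ≫ augHomology A n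
  have hι (n : ℤ) : Function.Injective (ι n) := by
    intro x y h
    exact iso_hom_injective (e n) (augHomology_injective E n h)
  { act := fun n n' h =>
      (towerAct (capMap A (periodicityClass k p)) (-n) (-n') (by linarith)).hom
    incl := fun n => (ι n).hom
    -- An arbitrary linear splitting in each degree; the resulting isomorphism with `HH(E)[u⁻¹]`
    -- depends on this choice.
    retract := fun n => (exists_retraction (ι n) (hι n)).choose
    retract_incl := fun n => (exists_retraction (ι n) (hι n)).choose_spec
    exact := fun n n' h x => by
      obtain rfl : n' = n - 2 := by linarith
      refine (augHomology_exact A n x).trans ⟨?_, ?_⟩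
      · rintro ⟨y, rfl⟩
        obtain ⟨z, rfl⟩ := iso_hom_surjective (e n) y
        exact ⟨z, rfl⟩
      · rintro ⟨z, rfl⟩
        exact ⟨(e n).hom z, rfl⟩
    surjective := fun n n' h => by
      obtain rfl : n' = n - 2 := by linarith
      exact periodicity_surjective E n
    subsingleton := fun n hn => subsingleton_homologyOf A hn }

theorem cyclicTower_act (E : FunCat (Lambda 1) k) (n : ℤ) (x : HC (Lambda.proj p ⋙ E) n) :
    (cyclicTower E).act n (n - 2) (by ring) x = periodicity (Lambda.proj p ⋙ E) n x := rfl

/-- Periodic cyclic homology is the inverse limit of the cyclic homology. -/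
def cyclicLimit (E : FunCat (Lambda 1) k) (n : ℤ) :
    (cyclicTower (p := p) E).Limit (HP (Lambda.proj p ⋙ E) n) n where
  eval m n' h := (telescopeEval (capMap (Lambda.proj p ⋙ E) (periodicityClass k p)) m (-n) (-n')
    (by linarith)).hom
  act_eval m n' n'' h h' h'' y := towerAct_telescopeEval _ m (-n) (-n') (-n'') _ _ _ y
  -- Surjectivity of `u` removes the `lim¹` term, so elements of `HP` are detected by their
  -- projections to `HC`.
  ext y hy := telescopeEval_ext _ (fun b b' h => by
      obtain ⟨c, rfl⟩ : ∃ c, b = -c := ⟨-b, by ring⟩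
      obtain ⟨c', rfl⟩ : ∃ c', b' = -c' := ⟨-b', by ring⟩
      exact (cyclicTower (p := p) E).surjective c c' (by linarith))
    (-n) (fun m => -(n + 2 * (m : ℤ))) (fun m => by ring) y hy
  exists_eval_eq v hv := exists_telescopeEval_eq _ (-n) (fun m => -(n + 2 * (m : ℤ)))
    (fun m => by ring) (fun m => by push_cast; ring) v hv

theorem cyclicLimit_eval (E : FunCat (Lambda 1) k) (n : ℤ) (m : ℕ) (y : HP (Lambda.proj p ⋙ E) n) :
    (cyclicLimit (p := p) E n).eval m _ rfl y = HPtoHC (Lambda.proj p ⋙ E) n m y := rfl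

end CyclicTower
end CyclicHomology
end

theorem lemma1p10 {k : Type u} [Field k] (p : ℕ) [Fact p.Prime] [CharP k p] :
    (∀ E : Lambda 1 ⥤ ModuleCat.{u} k,
      ∃ (eC : ∀ n : ℤ, HC (Lambda.proj p ⋙ E) n ≃ₗ[k] PolyInv (HH E) n)
        (eP : ∀ n : ℤ, HP (Lambda.proj p ⋙ E) n ≃ₗ[k] Laurent (HH E) n),
        (∀ (n : ℤ) (x : HC (Lambda.proj p ⋙ E) n) (i : ℤ) (l : ℕ)
          (h : i + 2 * (l : ℤ) = n - 2),
          eC (n - 2) (periodicity (Lambda.proj p ⋙ E) n x) ⟨(i, l), h⟩ =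
            eC n x ⟨(i, l + 1), by push_cast; linarith⟩) ∧
        (∀ (n : ℤ) (y : HP (Lambda.proj p ⋙ E) n) (m : ℕ) (i : ℤ) (l : ℕ)
          (h : i + 2 * (l : ℤ) = n + 2 * m),
          eC (n + 2 * m) (HPtoHC (Lambda.proj p ⋙ E) n m y) ⟨(i, l), h⟩ =
            (eP n y).1 ⟨(i, (m : ℤ) - l), by linarith⟩)) ∧
    (∀ x : Coh (Lambda 1) k 2, cohPull k (Lambda.proj p) 2 x = 0) := by
  refine ⟨fun E => ⟨(cyclicTower E).equivPolyInv, fun n => (cyclicLimit E n).equivLaurent,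
    fun n x i l h => ?_, fun n y m i l h => ?_⟩, cohPull_proj_eq_zero p⟩
  · rw [DivisibleTower.equivPolyInv_apply, DivisibleTower.equivPolyInv_apply, ← cyclicTower_act]
    exact (cyclicTower E).coefficient_act l n (n - 2) i _ h _ x
  · rw [DivisibleTower.equivPolyInv_apply, ← cyclicLimit_eval]
    exact ((cyclicLimit E n).toLaurent_apply y m l i h _).symm
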